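/- **Theorem.** There is an absolute constant $C>0$ such that the following holds. Let $n\ge 1$ be a power of two, $d\ge 1$, and $\epsilon\in(0,1)$, and let $$ r=\Big\lceil \max\big\{48^2\, d\ln(40nd)\,\ln\!\big(100^2 d\ln(40nd)\big),\; 40\,d\ln(40nd)/\epsilon\big\}\Big\rceil . $$ Let $H\in\mathbb R^{n\times n}$ be the normalized Hadamard matrix, i.e. $H=n^{-1/2}\tilde H_n$ with $\tilde H_1=(1)$ and $\tilde H_{2m}=\begin{pmatrix}\tilde H_m&\tilde H_m\\ \tilde H_m&-\tilde H_m\end{pmatrix}$. Let $D\in\mathbb R^{n\times n}$ be a diagonal matrix whose diagonal entries are independent uniform random signs, and, independently of $D$, let $i_1,\dots,i_r$ be independent and uniform in $\{1,\dots,n\}$; let $S\in\mathbb R^{n\times r}$ be the matrix whose $t$-th column is $\sqrt{n/r}\,e_{i_t}$. For $A\in\mathbb R^{n\times d}$ of rank $d$ and $b\in\mathbb R^n$ put $$ \mathcal Z=\min_{x\in\mathbb R^d}\|Ax-b\|_2,\qquad x_{opt}=A^\dagger b,\qquad \tilde x_{opt}=(S^THDA)^\dagger S^THD\,b, $$ where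 $\dagger$ denotes the Moore–Penrose pseudoinverse, and let $A=U_A\Sigma_AV_A^T$ be a thin singular value decomposition and $\kappa(A)=\sigma_{\max}(A)/\sigma_{\min}(A)$. 1. For all such $A$ and $b$, with probability at least $0.8$ the following two claims hold together: first, $$\|A\tilde x_{opt}-b\|_2\le(1+\epsilon)\mathcal Z ;$$ and second, for every $\gamma\in(0,1]$ with $\|U_AU_A^Tb\|_2\ge\gamma\|b\|_2$, $$\|x_{opt}-\tilde x_{opt}\|_2\le\sqrt\epsilon\,\Big(\kappa(A)\sqrt{\gamma^{-2}-1}\Big)\|x_{opt}\|_2 .$$ 2. At most $$ n(d+1)+2n(d+1)\log_2(r+1)+C\,rd^2 $$ operations suffice to compute $\tilde x_{opt}$: there is a randomized algebraic computation tree, depending only on $n$, $d$, $\epsilon$, whose worst-case number of steps is at most this number and which, on every input $(A,b)$ with $A$ of rank $d$, never divides by zero and outputs a vector with the law of $\tilde x_{opt}$. A step is an arithmetic operation $+,-,\times,/$ on two stored real numbers, the writing of a real constant into memory, a comparison of two stored real numbers, a fair coin toss, or the draw of a uniform index in $\{1,\dots,n\}$. -/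

import Mathlib

open Matrix MeasureTheory

noncomputable section

namespace RandLS

/-! ### Linear algebra -/

/-- The Euclidean norm of a vector. -/
def norm2 {m : ℕ} (v : Fin m → ℝ) : ℝ := ‖WithLp.toLp 2 v‖

/-- The four Penrose conditions: `X` is a Moore-Penrose pseudoinverse of `A`. -/
structure IsMoorePenrose {m n : ℕ} (A : Matrix (Fin m) (Fin n) ℝ)
    (X : Matrix (Fin n) (Fin m) ℝ) : Prop where
  mul_mul_left : A * X * A = A
  mul_mul_right : X * A * X = X
  symm_left : (A * X)ᵀ = A * X
  symm_right : (X * A)ᵀ = X * A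

theorem exists_isMoorePenrose {m n : ℕ} (A : Matrix (Fin m) (Fin n) ℝ) :
    ∃ X, IsMoorePenrose A X := by
  have hG : (Aᵀ * A).IsHermitian := by
    simpa [conjTranspose_eq_transpose_of_trivial] using isHermitian_conjTranspose_mul_self A
  set W : Matrix (Fin n) (Fin n) ℝ := hG.eigenvectorUnitary.1 with hW
  set ev := hG.eigenvalues with hev
  have h1 : Wᵀ * W = 1 := by
    have := (mem_unitaryGroup_iff').1 hG.eigenvectorUnitary.2
    simpa [star_eq_conjTranspose, conjTranspose_eq_transpose_of_trivial] using this
  have h2 : W * Wᵀ = 1 := mul_eq_one_comm.1 h1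
  have hs : Aᵀ * A = W * diagonal ev * Wᵀ := by
    have := hG.spectral_theorem
    rw [Unitary.conjStarAlgAut_apply] at this
    simpa [star_eq_conjTranspose, conjTranspose_eq_transpose_of_trivial, Function.comp_def]
      using this
  set L : Matrix (Fin n) (Fin n) ℝ := diagonal ev⁻¹ with hL
  set E : Matrix (Fin n) (Fin n) ℝ := diagonal ev with hE
  have hLE : L * E * L = L := by
    simp only [hL, hE, diagonal_mul_diagonal]
    congr 1; ext i
    by_cases h : ev i = 0 <;> simp [h]
  have hEL : E * L * E = E := by
    simp only [hL, hE, diagonal_mul_diagonal]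
    congr 1; ext i
    by_cases h : ev i = 0 <;> simp [h]
  have hcomm : L * E = E * L := by
    simp only [hL, hE, diagonal_mul_diagonal]
    congr 1; ext i
    exact mul_comm _ _
  have hXA : W * L * Wᵀ * Aᵀ * A = W * (L * E) * Wᵀ := by
    calc W * L * Wᵀ * Aᵀ * A = W * L * Wᵀ * (Aᵀ * A) := by simp only [Matrix.mul_assoc]
      _ = W * L * (Wᵀ * W) * E * Wᵀ := by rw [hs]; simp only [Matrix.mul_assoc]
      _ = _ := by rw [h1]; simp only [Matrix.mul_assoc, Matrix.mul_one]
  have hLt : Lᵀ = L := diagonal_transpose _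
  have hEt : Eᵀ = E := diagonal_transpose _
  refine ⟨W * L * Wᵀ * Aᵀ, ?_, ?_, ?_, ?_⟩
  · rw [Matrix.mul_assoc, hXA]
    have hz : Aᵀ * (A * (W * (L * E) * Wᵀ) - A) = 0 := by
      rw [Matrix.mul_sub, ← Matrix.mul_assoc, hs, sub_eq_zero]
      calc W * E * Wᵀ * (W * (L * E) * Wᵀ) = W * E * (Wᵀ * W) * (L * E) * Wᵀ := by
            simp only [Matrix.mul_assoc]
        _ = W * (E * L * E) * Wᵀ := by
            rw [h1]; simp only [Matrix.mul_assoc, Matrix.one_mul]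
        _ = _ := by rw [hEL]
    have hq : (A * (W * (L * E) * Wᵀ) - A)ᵀ * (A * (W * (L * E) * Wᵀ) - A) = 0 := by
      have : A * (W * (L * E) * Wᵀ) - A = A * (W * (L * E) * Wᵀ - 1) := by
        rw [Matrix.mul_sub, Matrix.mul_one]
      conv_lhs => rw [this]
      rw [transpose_mul, Matrix.mul_assoc, ← this, hz, Matrix.mul_zero]
    have := (conjTranspose_mul_self_eq_zero
      (A := A * (W * (L * E) * Wᵀ) - A)).1
      (by rw [conjTranspose_eq_transpose_of_trivial]; exact hq)
    exact sub_eq_zero.1 this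
  · rw [hXA]
    calc W * (L * E) * Wᵀ * (W * L * Wᵀ * Aᵀ)
          = W * (L * E) * (Wᵀ * W) * L * Wᵀ * Aᵀ := by simp only [Matrix.mul_assoc]
      _ = W * (L * E * L) * Wᵀ * Aᵀ := by
          rw [h1]; simp only [Matrix.mul_assoc, Matrix.one_mul]
      _ = _ := by rw [hLE]
  · simp only [transpose_mul, transpose_transpose, hLt, Matrix.mul_assoc]
  · rw [hXA]
    simp only [transpose_mul, transpose_transpose, hLt, hEt, Matrix.mul_assoc]
    rw [← Matrix.mul_assoc E, ← hcomm, Matrix.mul_assoc]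

theorem IsMoorePenrose.unique {m n : ℕ} {A : Matrix (Fin m) (Fin n) ℝ}
    {X Y : Matrix (Fin n) (Fin m) ℝ} (hX : IsMoorePenrose A X) (hY : IsMoorePenrose A Y) :
    X = Y := by
  have hA : A * X = A * Y := by
    calc A * X = A * Y * (A * X) := by rw [← Matrix.mul_assoc, hY.mul_mul_left]
      _ = (A * Y)ᵀ * (A * X)ᵀ := by rw [hX.symm_left, hY.symm_left]
      _ = (A * X * A * Y)ᵀ := by rw [← transpose_mul]; simp only [Matrix.mul_assoc]
      _ = A * Y := by rw [hX.mul_mul_left, hY.symm_left]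
  have hB : X * A = Y * A := by
    calc X * A = X * A * (Y * A) := by
          rw [Matrix.mul_assoc, ← Matrix.mul_assoc A, hY.mul_mul_left]
      _ = (X * A)ᵀ * (Y * A)ᵀ := by rw [hX.symm_right, hY.symm_right]
      _ = (Y * (A * X * A))ᵀ := by rw [← transpose_mul]; simp only [Matrix.mul_assoc]
      _ = Y * A := by rw [hX.mul_mul_left, hY.symm_right]
  rw [← hX.mul_mul_right, hB, Matrix.mul_assoc, hA, ← Matrix.mul_assoc, hY.mul_mul_right]

/-- The Moore-Penrose pseudoinverse. -/
def pinv {m n : ℕ} (A : Matrix (Fin m) (Fin n) ℝ) : Matrix (Fin n) (Fin m) ℝ :=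
  (exists_isMoorePenrose A).choose

theorem pinv_spec {m n : ℕ} (A : Matrix (Fin m) (Fin n) ℝ) : IsMoorePenrose A (pinv A) :=
  (exists_isMoorePenrose A).choose_spec

/-- The singular values of a matrix in decreasing order, numbered from `0`. -/
def singVal {n d : ℕ} (A : Matrix (Fin n) (Fin d) ℝ) (i : ℕ) : ℝ :=
  (Matrix.toEuclideanLin A).singularValues i

/-- The condition number `σ_max / σ_min` of a matrix with `d` columns, of rank `d`. -/
def condNum {n d : ℕ} (A : Matrix (Fin n) (Fin d) ℝ) : ℝ :=
  singVal A 0 / singVal A (d - 1)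

/-- `A = U Σ Vᵀ` is a thin singular value decomposition of the matrix `A` of rank `d`. -/
structure IsThinSVD {n d : ℕ} (A U : Matrix (Fin n) (Fin d) ℝ)
    (V : Matrix (Fin d) (Fin d) ℝ) : Prop where
  orth_left : Uᵀ * U = 1
  orth_right : Vᵀ * V = 1
  eq_mul : A = U * Matrix.diagonal (fun i : Fin d => singVal A i) * Vᵀ

theorem singVal_pos {n d : ℕ} {A : Matrix (Fin n) (Fin d) ℝ} (hA : A.rank = d) (i : Fin d) :
    0 < singVal A i := by
  unfold singVal
  rw [LinearMap.singularValues_pos_iff_lt_finrank_range]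
  have : A.rank = Module.finrank ℝ (LinearMap.range (Matrix.toEuclideanLin A)) :=
    Matrix.rank_eq_finrank_range_toLin A (PiLp.basisFun 2 ℝ _) (PiLp.basisFun 2 ℝ _)
  rw [← this, hA]; exact i.2

theorem exists_isThinSVD {n d : ℕ} {A : Matrix (Fin n) (Fin d) ℝ} (hA : A.rank = d) :
    ∃ U V, IsThinSVD A U V := by
  set T := Matrix.toEuclideanLin A with hT
  have hn : Module.finrank ℝ (EuclideanSpace ℝ (Fin d)) = d := by simp
  set v := T.isSymmetric_adjoint_comp_self.eigenvectorBasis hn with hv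
  have hev : ∀ i j, inner ℝ (T (v i)) (T (v j)) = if i = j then singVal A j ^ 2 else 0 := by
    intro i j
    rw [← LinearMap.adjoint_inner_right]
    have := T.isSymmetric_adjoint_comp_self.apply_eigenvectorBasis hn j
    rw [LinearMap.comp_apply] at this
    rw [hv, this, ← T.sq_singularValues_fin hn j, inner_smul_right,
      orthonormal_iff_ite.1 (OrthonormalBasis.orthonormal _) i j]
    simp [singVal, ← hT]
  set V : Matrix (Fin d) (Fin d) ℝ := Matrix.of fun a i => v i a with hV
  have hVV : Vᵀ * V = 1 := by
    ext i j
    have := orthonormal_iff_ite.1 v.orthonormal j i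
    rw [PiLp.inner_apply] at this
    simp only [Matrix.mul_apply, Matrix.one_apply, hV, Matrix.transpose_apply, Matrix.of_apply]
    simpa [eq_comm] using this
  have hVV' : V * Vᵀ = 1 := mul_eq_one_comm.1 hVV
  have hAV : ∀ a i, (A * V) a i = T (v i) a := by
    intro a i
    simp [hT, hV, Matrix.mul_apply, Matrix.mulVec, dotProduct, Matrix.toEuclideanLin]
  have hAVAV : (A * V)ᵀ * (A * V) = Matrix.diagonal fun i : Fin d => singVal A i ^ 2 := by
    ext i j
    have := hev j i
    rw [PiLp.inner_apply] at this
    simp only [Matrix.mul_apply, Matrix.transpose_apply, Matrix.diagonal_apply] at hAV ⊢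
    simp only [hAV]
    simp only [RCLike.inner_apply, conj_trivial] at this
    rw [this]
    by_cases h : i = j <;> simp [h, eq_comm]
  refine ⟨A * V * Matrix.diagonal fun i : Fin d => (singVal A i)⁻¹, V, ?_, hVV, ?_⟩
  · rw [transpose_mul, Matrix.diagonal_transpose, Matrix.mul_assoc, ← Matrix.mul_assoc _ (A * V),
      hAVAV, Matrix.diagonal_mul_diagonal, Matrix.diagonal_mul_diagonal, ← Matrix.diagonal_one]
    congr 1; ext i
    have := (singVal_pos hA i).ne'
    field_simp
  · rw [Matrix.mul_assoc (A * V), Matrix.diagonal_mul_diagonal]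
    have : (fun i : Fin d => (singVal A i)⁻¹ * singVal A i) = fun _ => 1 := by
      ext i; exact inv_mul_cancel₀ (singVal_pos hA i).ne'
    rw [this, Matrix.diagonal_one, Matrix.mul_one, Matrix.mul_assoc, hVV', Matrix.mul_one]

/-! ### The least squares problem -/

/-- The optimal value `min_x ‖A x - b‖` of the least squares problem. -/
def lsValue {n d : ℕ} (A : Matrix (Fin n) (Fin d) ℝ) (b : Fin n → ℝ) : ℝ :=
  ⨅ x : Fin d → ℝ, norm2 (A *ᵥ x - b)

/-- The minimum norm solution of the least squares problem. -/
def lsSolution {n d : ℕ} (A : Matrix (Fin n) (Fin d) ℝ) (b : Fin n → ℝ) : Fin d → ℝ :=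
  pinv A *ᵥ b

/-! ### The randomized algorithm -/

/-- The index set of size `2 ^ (k + 1)` as two consecutive blocks of size `2 ^ k`. -/
def halves (k : ℕ) : Fin (2 ^ k) ⊕ Fin (2 ^ k) ≃ Fin (2 ^ (k + 1)) :=
  finSumFinEquiv.trans (finCongr (by rw [pow_succ]; omega))

/-- The Hadamard matrix with entries `±1`, of order `2 ^ k`. -/
def hadamardPM : (k : ℕ) → Matrix (Fin (2 ^ k)) (Fin (2 ^ k)) ℝ
  | 0 => Matrix.of fun _ _ => 1
  | k + 1 => Matrix.reindex (halves k) (halves k)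
      (Matrix.fromBlocks (hadamardPM k) (hadamardPM k) (hadamardPM k) (-hadamardPM k))

/-- The normalized Hadamard transform. -/
def hadamard (k : ℕ) : Matrix (Fin (2 ^ k)) (Fin (2 ^ k)) ℝ :=
  (1 / Real.sqrt ((2 ^ k : ℕ) : ℝ)) • hadamardPM k

/-- The random choices of the algorithm: `n` random signs, and `r` row indices. -/
abbrev Sample (n r : ℕ) : Type := (Fin n → Bool) × (Fin r → Fin n)

/-- The random diagonal matrix of signs. -/
def signMatrix {n r : ℕ} (ω : Sample n r) : Matrix (Fin n) (Fin n) ℝ :=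
  Matrix.diagonal fun i => if ω.1 i then 1 else -1

/-- The `n × r` sampling matrix whose `t`-th column is `√(n / r) e_i` for the `t`-th sampled
index `i`. -/
def samplingMatrix {n r : ℕ} (ω : Sample n r) : Matrix (Fin n) (Fin r) ℝ :=
  Matrix.of fun i t => if ω.2 t = i then Real.sqrt ((n : ℝ) / (r : ℝ)) else 0

/-- The sketching matrix `Sᵀ H D`. -/
def sketch {k r : ℕ} (ω : Sample (2 ^ k) r) : Matrix (Fin r) (Fin (2 ^ k)) ℝ :=
  (samplingMatrix ω)ᵀ * hadamard k * signMatrix ω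

/-- The output `(Sᵀ H D A)† Sᵀ H D b` of the algorithm for the random choices `ω`. -/
def sketchedSolution {k d r : ℕ} (A : Matrix (Fin (2 ^ k)) (Fin d) ℝ) (b : Fin (2 ^ k) → ℝ)
    (ω : Sample (2 ^ k) r) : Fin d → ℝ :=
  pinv (sketch ω * A) *ᵥ (sketch ω *ᵥ b)

/-- The number of sampled constraints, rounded up to an integer. -/
def sampleSize (n d : ℕ) (ε : ℝ) : ℕ :=
  ⌈max (48 ^ 2 * (d : ℝ) * Real.log (40 * n * d) *
          Real.log (100 ^ 2 * (d : ℝ) * Real.log (40 * n * d)))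
        (40 * (d : ℝ) * Real.log (40 * n * d) / ε)⌉₊

/-- The law of the random choices: signs and indices are all independent and uniform. -/
def sampleLaw (n r : ℕ) [NeZero n] : PMF (Sample n r) := PMF.uniformOfFintype (Sample n r)

/-! ### Randomized real arithmetic programs -/

/-- Arithmetic operations on real numbers. -/
inductive ArithOp : Type
  | add | sub | mul | div

/-- Division by zero is undefined. -/
def ArithOp.eval : ArithOp → ℝ → ℝ → Option ℝ
  | .add, x, y => some (x + y)
  | .sub, x, y => some (x - y)
  | .mul, x, y => some (x * y)
  | .div, x, y => if y = 0 then none else some (x / y)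

/-- The memory cells, each of which holds one real number: `n × (d + 1)` cells for the augmented
input matrix `[A b]`, and work cells numbered by `ℕ`. -/
abbrev Cell (n d : ℕ) : Type := (Fin n × Fin (d + 1)) ⊕ ℕ

/-- Randomized algebraic computation trees with memory cells. A program cannot inspect a real
number except by arithmetic and by comparison of two cells; it may toss a fair coin, and it may
draw a uniformly random element of `Fin n`. -/
inductive Program (n d : ℕ) : Type
  /-- stop, and output the contents of `d` cells -/
  | halt (out : Fin d → Cell n d)
  /-- write a constant into the cell `dst` -/
  | const (dst : Cell n d) (c : ℝ) (next : Program n d)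
  /-- apply an arithmetic operation to the cells `i` and `j`, write the result into `dst` -/
  | arith (o : ArithOp) (dst i j : Cell n d) (next : Program n d)
  /-- branch according to whether the content of `i` is at most that of `j` -/
  | ifLE (i j : Cell n d) (yes no : Program n d)
  /-- toss a fair coin -/
  | coin (next : Bool → Program n d)
  /-- draw a uniformly random index -/
  | draw (next : Fin n → Program n d)

namespace Program

/-- The worst-case number of steps: every instruction other than `halt` counts as one step, and
the maximum is over all the branches. -/
def steps {n d : ℕ} : Program n d → ℕ
  | halt _ => 0
  | const _ _ next => steps next + 1
  | arith _ _ _ _ next => steps next + 1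
  | ifLE _ _ yes no => max (steps yes) (steps no) + 1
  | coin next => max (steps (next true)) (steps (next false)) + 1
  | draw next => (Finset.univ.sup fun i => steps (next i)) + 1

/-- The law of the output of a program started on the memory `mem`; the output is `none` if the
program divides by zero. -/
def run {n d : ℕ} [NeZero n] : Program n d → (Cell n d → ℝ) → PMF (Option (Fin d → ℝ))
  | halt out, mem => PMF.pure (some fun j => mem (out j))
  | const dst c next, mem => run next (Function.update mem dst c)
  | arith o dst i j next, mem =>
      match o.eval (mem i) (mem j) with
      | none => PMF.pure none
      | some v => run next (Function.update mem dst v)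
  | ifLE i j yes no, mem => open Classical in if mem i ≤ mem j then run yes mem else run no mem
  | coin next, mem => (PMF.uniformOfFintype Bool).bind fun c => run (next c) mem
  | draw next, mem => (PMF.uniformOfFintype (Fin n)).bind fun i => run (next i) mem

/-- The initial memory: the input `[A b]`, and zero in all the work cells. -/
def input {n d : ℕ} (A : Matrix (Fin n) (Fin d) ℝ) (b : Fin n → ℝ) : Cell n d → ℝ
  | .inl (i, j) => Fin.snoc (α := fun _ => ℝ) (A i) (b i) j
  | .inr _ => 0

end Program

end RandLS

end

open Matrix MeasureTheory

noncomputable section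

namespace RandLS

/-! ### Trace inequalities -/

section Trace

variable {ι : Type*} [Fintype ι]

/-! Accuracy. Write `β = b - A x_opt`, `A = U Σ Vᵀ` and `X = Sᵀ H D`. Both error claims follow from
two properties of `X`: `‖X U v‖² ≥ ‖v‖² / √2` for all `v`, and `‖(X U)ᵀ X β‖² ≤ (ε / 2) ‖β‖²`.
Indeed, if `A (x - x_opt) = U z` for the sketched solution `x`, the sketched normal equations read
`(X U)ᵀ X U z = (X U)ᵀ X β`, which forces `‖z‖² ≤ ε ‖β‖²` (`sketched_error_le`). Pythagoras turns
this into the residual bound, and the extreme singular values of `A` turn it into the bound on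
`x_opt - x`.

Probability. All laws are uniform on finite sets, so probabilities appear as cardinalities. By
Hoeffding and a union bound, all rows of `H D U` are short except for a share `1/20` of the sign
patterns. Given short rows, the sampled Gram matrix is a sum of independent bounded positive
semidefinite matrices of mean `1`. The lower tail of its spectrum is bounded by the Ahlswede-Winter
method: Golden-Thompson strips the summands off the trace of the exponential one at a time
(`sum_trace_exp_le`). Golden-Thompson itself comes from the Lieb-Thirring inequality at exponents `2
^ k` and the Lie-Trotter formula. The second property is Markov's inequality for a second moment,
because `(H D U)ᵀ H D β = Uᵀ β = 0`.

Operation count. The program makes all random choices first; each outcome then has its own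
straight-line code, the evaluation of an acyclic graph. Only the rows of the fast Walsh-Hadamard
transform that the `r` sampled rows depend on are computed, which replaces `log n` levels by about
`log r` (`sum_card_walshRows_le`). The pseudoinverse needs neither square roots nor a decision about
the rank: Gram-Schmidt on the columns of the sketched `[A b]` leaves a triangular system, and
Gram-Schmidt on the rows of that system yields its solution of least norm (`sum_gsVec_gsCoef_eq`),
in `O(r d²)` operations. -/

theorem trace_mul_conjTranspose_nonneg (X : Matrix ι ι ℝ) : 0 ≤ (X * Xᴴ).trace :=
  (posSemidef_self_mul_conjTranspose X).trace_nonneg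

/-- Expand `0 ≤ tr ((M - Mᴴ)(M - Mᴴ)ᴴ)`. -/
theorem trace_mul_self_le (M : Matrix ι ι ℝ) : (M * M).trace ≤ (M * Mᴴ).trace := by
  have h := trace_mul_conjTranspose_nonneg (M - Mᴴ)
  rw [conjTranspose_sub, conjTranspose_conjTranspose, Matrix.sub_mul, Matrix.mul_sub,
    Matrix.mul_sub, trace_sub, trace_sub, trace_sub, ← conjTranspose_mul,
    trace_conjTranspose, Matrix.trace_mul_comm Mᴴ M] at h
  simp only [star_trivial] at h
  linarith

theorem two_mul_trace_mul_le {P Q : Matrix ι ι ℝ} (hP : P.IsHermitian) (hQ : Q.IsHermitian) :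
    2 * (P * Q).trace ≤ (P * P).trace + (Q * Q).trace := by
  have h := trace_mul_conjTranspose_nonneg (P - Q)
  rw [(hP.sub hQ).eq, Matrix.sub_mul, Matrix.mul_sub, Matrix.mul_sub, trace_sub, trace_sub,
    trace_sub, Matrix.trace_mul_comm Q P] at h
  linarith

variable [DecidableEq ι]

theorem trace_mul_pow_comm (X Y : Matrix ι ι ℝ) (N : ℕ) :
    ((X * Y) ^ N).trace = ((Y * X) ^ N).trace := by
  cases N with
  | zero => simp
  | succ N =>
    have h : ∀ N : ℕ, (X * Y) ^ (N + 1) = X * (Y * X) ^ N * Y := by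
      intro N
      induction N with
      | zero => simp
      | succ N ih => rw [pow_succ, ih, pow_succ (Y * X)]; simp only [Matrix.mul_assoc]
    rw [h, Matrix.mul_assoc, Matrix.trace_mul_comm, Matrix.mul_assoc, ← pow_succ]

/-- Weyl's and Lieb and Thirring's trace inequalities, for exponents that are powers of two. -/
theorem trace_pow_le_and_trace_mul_pow_le (k : ℕ) :
    (∀ M : Matrix ι ι ℝ, (M ^ 2 ^ (k + 1)).trace ≤ ((M * Mᴴ) ^ 2 ^ k).trace) ∧
    ∀ P Q : Matrix ι ι ℝ, P.IsHermitian → Q.IsHermitian →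
      ((P * Q) ^ 2 ^ k).trace ≤ (P ^ 2 ^ k * Q ^ 2 ^ k).trace := by
  induction k with
  | zero =>
    refine ⟨fun M => ?_, fun P Q _ _ => by simp⟩
    simpa [pow_two] using trace_mul_self_le M
  | succ k ih =>
    obtain ⟨W, LT⟩ := ih
    -- The two inequalities feed each other. Weyl for `M` at `k + 1`: Weyl for `M²` at `k`, a cyclic
    -- rotation, Lieb-Thirring for `Mᴴ M` and `M Mᴴ` at `k`, and `2 tr (PQ) ≤ tr P² + tr Q²`, whose
    -- two right-hand terms agree here. Lieb-Thirring for `P, Q` at `k + 1`: Weyl for `P Q` at `k`,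
    -- a rotation, and Lieb-Thirring for `P², Q²` at `k`.
    constructor
    · intro M
      have e1 : M ^ 2 ^ (k + 1 + 1) = (M * M) ^ 2 ^ (k + 1) := by
        rw [← pow_two, ← pow_mul, ← pow_succ']
      have h1 := W (M * M)
      have h2 : ((M * M * (M * M)ᴴ) ^ 2 ^ k).trace = ((Mᴴ * M * (M * Mᴴ)) ^ 2 ^ k).trace := by
        rw [conjTranspose_mul, show M * M * (Mᴴ * Mᴴ) = M * (M * Mᴴ * Mᴴ) by
          simp only [Matrix.mul_assoc], trace_mul_pow_comm,
          show M * Mᴴ * Mᴴ * M = M * Mᴴ * (Mᴴ * M) by simp only [Matrix.mul_assoc],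
          trace_mul_pow_comm]
      have hP : (Mᴴ * M).IsHermitian := isHermitian_conjTranspose_mul_self M
      have hQ : (M * Mᴴ).IsHermitian := isHermitian_mul_conjTranspose_self M
      have h3 := LT _ _ hP hQ
      have h4 := two_mul_trace_mul_le (hP.pow (2 ^ k)) (hQ.pow (2 ^ k))
      have h5 := trace_mul_pow_comm M Mᴴ (2 ^ (k + 1))
      simp only [← pow_two, ← pow_mul, ← pow_succ] at h4
      rw [e1]
      linarith
    · intro P Q hP hQ
      have h1 := W (P * Q)
      have h2 : ((P * Q * (P * Q)ᴴ) ^ 2 ^ k).trace = ((P * P * (Q * Q)) ^ 2 ^ k).trace := by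
        rw [conjTranspose_mul, hP.eq, hQ.eq,
          show P * Q * (Q * P) = P * (Q * Q * P) by simp only [Matrix.mul_assoc],
          trace_mul_pow_comm,
          show Q * Q * P * P = Q * Q * (P * P) by simp only [Matrix.mul_assoc],
          trace_mul_pow_comm]
      have hPP : (P * P).IsHermitian := by simpa [pow_two] using hP.pow 2
      have hQQ : (Q * Q).IsHermitian := by simpa [pow_two] using hQ.pow 2
      have h3 := LT _ _ hPP hQQ
      have e : ∀ X : Matrix ι ι ℝ, (X * X) ^ 2 ^ k = X ^ 2 ^ (k + 1) := fun X => by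
        rw [← pow_two, ← pow_mul, ← pow_succ']
      rw [e P, e Q] at h3
      linarith

end Trace

/-! ### The Lie-Trotter product formula -/

section Trotter

open Filter Topology NormedSpace

/-- Telescoping: the factors `S` are exchanged for `T` one at a time. -/
theorem norm_pow_sub_pow_le {𝔸 : Type*} [NormedRing 𝔸] [NormOneClass 𝔸] {S T : 𝔸} {K : ℝ} (hS : ‖S‖ ≤ K) (hT : ‖T‖ ≤ K) (hK : 1 ≤ K)
    (N : ℕ) : ‖S ^ N - T ^ N‖ ≤ N * K ^ N * ‖S - T‖ := by
  have hK0 : 0 ≤ K := by linarith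
  induction N with
  | zero => simp
  | succ N ih =>
    have e : S ^ (N + 1) - T ^ (N + 1) = S ^ N * (S - T) + (S ^ N - T ^ N) * T := by
      rw [pow_succ, pow_succ]; noncomm_ring
    have h1 : ‖S ^ N * (S - T)‖ ≤ K ^ (N + 1) * ‖S - T‖ :=
      calc ‖S ^ N * (S - T)‖ ≤ ‖S ^ N‖ * ‖S - T‖ := norm_mul_le _ _
        _ ≤ K ^ (N + 1) * ‖S - T‖ := by
          gcongr
          exact (norm_pow_le _ _).trans ((pow_le_pow_left₀ (norm_nonneg _) hS _).trans
            (pow_le_pow_right₀ hK (Nat.le_succ _)))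
    have h2 : ‖(S ^ N - T ^ N) * T‖ ≤ N * K ^ N * ‖S - T‖ * K :=
      calc ‖(S ^ N - T ^ N) * T‖ ≤ ‖S ^ N - T ^ N‖ * ‖T‖ := norm_mul_le _ _
        _ ≤ _ := by gcongr
    rw [e]
    refine (norm_add_le _ _).trans ((add_le_add h1 h2).trans (le_of_eq ?_))
    push_cast; ring

theorem norm_exp_le_exp_norm {𝔸 : Type*} [NormedRing 𝔸] [NormedAlgebra ℝ 𝔸] [NormOneClass 𝔸]
    (X : 𝔸) : ‖exp X‖ ≤ Real.exp ‖X‖ := by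
  rw [exp_eq_tsum ℝ, Real.exp_eq_exp_ℝ, exp_eq_tsum ℝ]
  refine tsum_of_norm_bounded (expSeries_summable' (𝕂 := ℝ) ‖X‖).hasSum fun n => ?_
  rw [norm_smul, norm_inv, Real.norm_natCast, smul_eq_mul]
  gcongr
  exact norm_pow_le X n

variable {𝔸 : Type*} [NormedRing 𝔸] [NormedAlgebra ℝ 𝔸] [CompleteSpace 𝔸]

/-- The curves `exp (t (A + B))` and `exp (t A) exp (t B)` have the same value and the same
derivative at `t = 0`, so they differ by `o(1 / N)` at `t = 1 / N`. -/
theorem tendsto_smul_exp_sub_exp_mul_exp (A B : 𝔸) :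
    Tendsto (fun N : ℕ => (N : ℝ) •
      (exp ((N : ℝ)⁻¹ • (A + B)) - exp ((N : ℝ)⁻¹ • A) * exp ((N : ℝ)⁻¹ • B))) atTop (𝓝 0) := by
  have hd : ∀ X : 𝔸, HasDerivAt (fun t : ℝ => exp (t • X)) X 0 := by
    intro X
    have := hasDerivAt_exp_smul_const (𝕂 := ℝ) X (0 : ℝ)
    simpa using this
  have h := (hd (A + B)).sub ((hd A).mul (hd B))
  simp only [zero_smul, exp_zero, mul_one, one_mul, sub_self] at h
  have h2 := h.tendsto_slope_zero_right
  have hN : Tendsto (fun N : ℕ => (N : ℝ)⁻¹) atTop (𝓝[>] 0) :=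
    tendsto_inv_atTop_nhdsGT_zero.comp tendsto_natCast_atTop_atTop
  have := h2.comp hN
  simpa [Function.comp_def] using this

/-- Telescoping `N` factors loses a factor `N` times `K ^ N`. Since `K ^ N = exp (‖A‖ + ‖B‖)` does
not depend on `N`, the `o(1 / N)` distance of the factors suffices. -/
theorem tendsto_exp_mul_exp_pow [NormOneClass 𝔸] (A B : 𝔸) :
    Tendsto (fun N : ℕ => (exp ((N : ℝ)⁻¹ • A) * exp ((N : ℝ)⁻¹ • B)) ^ N) atTop
      (𝓝 (exp (A + B))) := by
  have key : ∀ N : ℕ, 0 < N →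
      ‖(exp ((N : ℝ)⁻¹ • A) * exp ((N : ℝ)⁻¹ • B)) ^ N - exp (A + B)‖ ≤
        Real.exp (‖A‖ + ‖B‖) * ‖(N : ℝ) •
      (exp ((N : ℝ)⁻¹ • (A + B)) - exp ((N : ℝ)⁻¹ • A) * exp ((N : ℝ)⁻¹ • B))‖ := by
    intro N hN
    have hN' : (0 : ℝ) < N := by exact_mod_cast hN
    set K : ℝ := Real.exp ((N : ℝ)⁻¹ * (‖A‖ + ‖B‖)) with hK
    have hs : ∀ X : 𝔸, ‖(N : ℝ)⁻¹ • X‖ = (N : ℝ)⁻¹ * ‖X‖ := fun X => by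
      rw [norm_smul, Real.norm_of_nonneg (by positivity)]
    have e : exp (A + B) = exp ((N : ℝ)⁻¹ • (A + B)) ^ N := by
      let _ : NormedAlgebra ℚ 𝔸 := NormedAlgebra.restrictScalars ℚ ℝ 𝔸
      rw [← NormedSpace.exp_nsmul, ← Nat.cast_smul_eq_nsmul ℝ, smul_smul, mul_inv_cancel₀ hN'.ne', one_smul]
    have hKN : K ^ N = Real.exp (‖A‖ + ‖B‖) := by
      rw [hK, ← Real.exp_nat_mul]; congr 1; field_simp
    have h1 : ‖exp ((N : ℝ)⁻¹ • (A + B))‖ ≤ K := by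
      refine (norm_exp_le_exp_norm _).trans (Real.exp_le_exp.2 ?_)
      rw [hs]; gcongr; exact norm_add_le _ _
    have h2 : ‖exp ((N : ℝ)⁻¹ • A) * exp ((N : ℝ)⁻¹ • B)‖ ≤ K := by
      refine (norm_mul_le _ _).trans ((mul_le_mul (norm_exp_le_exp_norm _) (norm_exp_le_exp_norm _) (norm_nonneg _)
        (Real.exp_pos _).le).trans (le_of_eq ?_))
      rw [← Real.exp_add, hs, hs, hK]; congr 1; ring
    have h3 := norm_pow_sub_pow_le h1 h2 (Real.one_le_exp (by positivity)) N
    rw [norm_sub_rev, e, norm_smul, Real.norm_of_nonneg hN'.le, ← hKN]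
    refine h3.trans (le_of_eq (by ring))
  rw [tendsto_iff_norm_sub_tendsto_zero]
  have h0 := ((tendsto_smul_exp_sub_exp_mul_exp A B).norm).const_mul (Real.exp (‖A‖ + ‖B‖))
  rw [norm_zero, mul_zero] at h0
  refine squeeze_zero' (Eventually.of_forall fun _ => norm_nonneg _) ?_ h0
  filter_upwards [eventually_gt_atTop 0] with N hN using key N hN

end Trotter

/-! ### The Golden-Thompson inequality -/

section GoldenThompson

open Filter Topology NormedSpace

variable {ι : Type*} [Fintype ι] [DecidableEq ι]

open scoped Matrix.Norms.L2Operator in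
theorem tendsto_matrix_exp_mul_exp_pow (A B : Matrix ι ι ℝ) :
    Tendsto (fun N : ℕ => (exp ((N : ℝ)⁻¹ • A) * exp ((N : ℝ)⁻¹ • B)) ^ N) atTop
      (𝓝 (exp (A + B))) := by
  -- In the zero ring of empty matrices `‖1‖ = 1` fails, so this case is separate.
  rcases isEmpty_or_nonempty ι with h | h
  · refine tendsto_const_nhds.congr fun _ => Subsingleton.elim _ _
  · exact tendsto_exp_mul_exp_pow A B

/-- The Golden-Thompson inequality. -/
theorem trace_exp_add_le {A B : Matrix ι ι ℝ} (hA : A.IsHermitian) (hB : B.IsHermitian) :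
    (exp (A + B)).trace ≤ (exp A * exp B).trace := by
  -- The limit is taken along `N = 2 ^ k` only, where Lieb-Thirring is available: it bounds each
  -- term by `tr (exp A * exp B)`.
  have ht : Tendsto (fun k : ℕ => 2 ^ k) atTop (atTop : Filter ℕ) :=
    tendsto_pow_atTop_atTop_of_one_lt (by norm_num)
  have h := (tendsto_matrix_exp_mul_exp_pow A B).comp ht
  have h2 := ((continuous_id.matrix_trace (n := ι) (R := ℝ)).tendsto (exp (A + B))).comp h
  refine le_of_tendsto h2 (Eventually.of_forall fun k => ?_)
  have hc : ((2 ^ k : ℕ) : ℝ) ≠ 0 := by positivity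
  have e : ∀ X : Matrix ι ι ℝ, exp (((2 ^ k : ℕ) : ℝ)⁻¹ • X) ^ 2 ^ k = exp X := fun X => by
    rw [← Matrix.exp_nsmul, ← Nat.cast_smul_eq_nsmul ℝ, smul_smul, mul_inv_cancel₀ hc, one_smul]
  have hs : ∀ {X : Matrix ι ι ℝ}, X.IsHermitian → (((2 ^ k : ℕ) : ℝ)⁻¹ • X).IsHermitian :=
    fun hX => by
      rw [Matrix.IsHermitian, conjTranspose_smul, hX.eq, star_trivial]
  have := (trace_pow_le_and_trace_mul_pow_le k).2 _ _ (hs hA).exp (hs hB).exp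
  rw [e, e] at this
  exact this

end GoldenThompson


/-! ### The lower tail of a sum of independent random matrices -/

section Chernoff

open NormedSpace

variable {ι : Type*} [Fintype ι] [DecidableEq ι]

theorem exists_orthogonal_diagonalization {X : Matrix ι ι ℝ} (hX : X.IsHermitian) :
    ∃ (W : Matrix ι ι ℝ) (e : ι → ℝ), Wᵀ * W = 1 ∧ W * Wᵀ = 1 ∧ X = W * diagonal e * Wᵀ := by
  have h1 : (hX.eigenvectorUnitary.1)ᵀ * hX.eigenvectorUnitary.1 = 1 := by
    have := (mem_unitaryGroup_iff').1 hX.eigenvectorUnitary.2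
    simpa [star_eq_conjTranspose, conjTranspose_eq_transpose_of_trivial] using this
  refine ⟨hX.eigenvectorUnitary.1, hX.eigenvalues, h1, mul_eq_one_comm.1 h1, ?_⟩
  have := hX.spectral_theorem
  rw [Unitary.conjStarAlgAut_apply] at this
  simpa [star_eq_conjTranspose, conjTranspose_eq_transpose_of_trivial, Function.comp_def] using this

theorem exp_smul_conj_diagonal {W : Matrix ι ι ℝ} (hW : W * Wᵀ = 1) (e : ι → ℝ) (t : ℝ) :
    exp (t • (W * diagonal e * Wᵀ)) = W * diagonal (fun i => Real.exp (t * e i)) * Wᵀ := by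
  have hi : W⁻¹ = Wᵀ := inv_eq_right_inv hW
  have hu : IsUnit W := IsUnit.of_mul_eq_one _ hW
  have e1 : t • (W * diagonal e * Wᵀ) = W * diagonal (fun i => t * e i) * W⁻¹ := by
    rw [hi, show (fun i => t * e i) = t • e from rfl, diagonal_smul]
    simp
  have e2 : exp (fun i => t * e i) = fun i => Real.exp (t * e i) := by
    funext i
    rw [Pi.coe_exp, Real.exp_eq_exp_ℝ]
  rw [e1, Matrix.exp_conj _ _ hu, Matrix.exp_diagonal, hi, e2]

theorem posSemidef_conj_diagonal (W : Matrix ι ι ℝ) {e : ι → ℝ} (he : ∀ i, 0 ≤ e i) :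
    (W * diagonal e * Wᵀ).PosSemidef := by
  have := (PosSemidef.diagonal (n := ι) (R := ℝ) (d := e) he).mul_mul_conjTranspose_same W
  simpa [conjTranspose_eq_transpose_of_trivial] using this

theorem nonneg_of_posSemidef_conj_diagonal {W : Matrix ι ι ℝ} (hW : Wᵀ * W = 1) {e : ι → ℝ}
    (h : (W * diagonal e * Wᵀ).PosSemidef) (i : ι) : 0 ≤ e i := by
  have h2 := h.conjTranspose_mul_mul_same W
  rw [conjTranspose_eq_transpose_of_trivial,
    show Wᵀ * (W * diagonal e * Wᵀ) * W = (Wᵀ * W) * diagonal e * (Wᵀ * W) by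
      simp only [Matrix.mul_assoc], hW, Matrix.one_mul, Matrix.mul_one] at h2
  exact posSemidef_diagonal_iff.1 h2 i

theorem trace_mul_nonneg {P Q : Matrix ι ι ℝ} (hP : P.PosSemidef) (hQ : Q.PosSemidef) :
    0 ≤ (P * Q).trace := by
  obtain ⟨W, e, h1, h2, rfl⟩ := exists_orthogonal_diagonalization hP.1
  have he := nonneg_of_posSemidef_conj_diagonal h1 hP
  rw [show W * diagonal e * Wᵀ * Q = W * (diagonal e * Wᵀ * Q) by simp only [Matrix.mul_assoc],
    Matrix.trace_mul_comm, Matrix.mul_assoc, Matrix.mul_assoc, Matrix.trace]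
  have hQ' := hQ.conjTranspose_mul_mul_same W
  refine Finset.sum_nonneg fun i _ => ?_
  rw [diag_apply, diagonal_mul, ← Matrix.mul_assoc]
  refine mul_nonneg (he i) ?_
  simpa [conjTranspose_eq_transpose_of_trivial] using hQ'.diag_nonneg (i := i)

theorem exp_posSemidef {X : Matrix ι ι ℝ} (hX : X.IsHermitian) (t : ℝ) :
    (exp (t • X)).PosSemidef := by
  obtain ⟨W, e, h1, h2, rfl⟩ := exists_orthogonal_diagonalization hX
  rw [exp_smul_conj_diagonal h2]
  exact posSemidef_conj_diagonal W fun i => (Real.exp_pos _).le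

/-- By convexity, `exp (-θ x)` lies below its chord over `[0, M]`. -/
theorem exp_neg_mul_le_one_sub {θ M x : ℝ} (hM : 0 < M) (h0 : 0 ≤ x) (hx : x ≤ M) :
    Real.exp (-θ * x) ≤ 1 - (1 - Real.exp (-θ * M)) / M * x := by
  have h := convexOn_exp.2 (Set.mem_univ 0) (Set.mem_univ (-θ * M))
    (sub_nonneg.2 ((div_le_one hM).2 hx)) (div_nonneg h0 hM.le) (by ring)
  simp only [smul_eq_mul, Real.exp_zero, mul_zero, zero_add, mul_one] at h
  rw [show x / M * (-θ * M) = -θ * x by field_simp] at h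
  refine h.trans (le_of_eq ?_)
  field_simp
  ring

/-- The chord bound holds for each eigenvalue, and all matrices involved are diagonal in the same
basis. -/
theorem posSemidef_sub_exp {X : Matrix ι ι ℝ} {θ M : ℝ} (hM : 0 < M) (hX : X.PosSemidef)
    (hXM : (M • (1 : Matrix ι ι ℝ) - X).PosSemidef) :
    ((1 : Matrix ι ι ℝ) - ((1 - Real.exp (-θ * M)) / M) • X - exp (-θ • X)).PosSemidef := by
  obtain ⟨W, e, h1, h2, rfl⟩ := exists_orthogonal_diagonalization hX.1
  have e1 : (1 : Matrix ι ι ℝ) = W * diagonal (fun _ => 1) * Wᵀ := by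
    rw [diagonal_one, Matrix.mul_one, h2]
  have lin : ∀ (a : ℝ) (f : ι → ℝ),
      a • (W * diagonal f * Wᵀ) = W * diagonal (fun i => a * f i) * Wᵀ := fun a f => by
    rw [show (fun i => a * f i) = a • f from rfl, diagonal_smul]; simp
  have sub : ∀ f g : ι → ℝ, W * diagonal f * Wᵀ - W * diagonal g * Wᵀ =
      W * diagonal (fun i => f i - g i) * Wᵀ := fun f g => by
    rw [← Matrix.sub_mul, ← Matrix.mul_sub, diagonal_sub]
  have hle : ∀ i, 0 ≤ M * 1 - e i := by
    refine nonneg_of_posSemidef_conj_diagonal h1 ?_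
    rwa [e1, lin, sub] at hXM
  have h0 := nonneg_of_posSemidef_conj_diagonal h1 hX
  rw [exp_smul_conj_diagonal h2, e1, lin, sub, sub]
  refine posSemidef_conj_diagonal W fun i => ?_
  have := exp_neg_mul_le_one_sub (θ := θ) hM (h0 i) (by linarith [hle i])
  linarith

variable {κ : Type*} [Fintype κ]

/-- Unnormalized bound for the expected trace of the exponential. Golden-Thompson separates the
first sample from the others; the chord bound is linear in `X i`, so averaging over that sample
leaves the scalar `1 - c ≤ exp (-c)`. -/
theorem sum_trace_exp_le [Nonempty κ] {X : κ → Matrix ι ι ℝ} {θ M : ℝ} (hM : 0 < M)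
    (hX : ∀ i, (X i).PosSemidef) (hXM : ∀ i, (M • (1 : Matrix ι ι ℝ) - X i).PosSemidef)
    (hmean : ∑ i, X i = (Fintype.card κ : ℝ) • (1 : Matrix ι ι ℝ)) (r : ℕ) :
    ∑ f : Fin r → κ, (exp (-θ • ∑ t, X (f t))).trace ≤
      (Fintype.card κ * Real.exp (-((1 - Real.exp (-θ * M)) / M))) ^ r * Fintype.card ι := by
  set c := (1 - Real.exp (-θ * M)) / M with hc
  induction r with
  | zero => simp
  | succ r ih =>
    rw [← (Fin.consEquiv fun _ => κ).sum_comp, Fintype.sum_prod_type, Finset.sum_comm]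
    have step : ∀ f : Fin r → κ,
        ∑ i, (exp (-θ • ∑ t, X ((Fin.consEquiv fun _ => κ) (i, f) t))).trace ≤
          Fintype.card κ * Real.exp (-c) * (exp (-θ • ∑ t, X (f t))).trace := by
      intro f
      have hS : (∑ t, X (f t)).PosSemidef := posSemidef_sum _ fun t _ => hX _
      have hherm : ∀ {Y : Matrix ι ι ℝ}, Y.PosSemidef → (-θ • Y).IsHermitian := fun hY => by
        rw [Matrix.IsHermitian, conjTranspose_smul, hY.1.eq, star_trivial]
      have hE := exp_posSemidef hS.1 (-θ)
      have h1 : ∀ i, (exp (-θ • ∑ t, X ((Fin.consEquiv fun _ => κ) (i, f) t))).trace ≤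
          ((1 - c • X i) * exp (-θ • ∑ t, X (f t))).trace := by
        intro i
        have e1 : ∑ t, X ((Fin.consEquiv fun _ => κ) (i, f) t) = X i + ∑ t, X (f t) := by
          rw [Fin.sum_univ_succ]; simp [Fin.consEquiv]
        rw [e1, smul_add]
        refine (trace_exp_add_le (hherm (hX i)) (hherm hS)).trans ?_
        have := trace_mul_nonneg (posSemidef_sub_exp (θ := θ) hM (hX i) (hXM i)) hE
        rw [Matrix.sub_mul, trace_sub] at this
        linarith
      refine (Finset.sum_le_sum fun i _ => h1 i).trans ?_
      rw [← trace_sum, ← Finset.sum_mul, Finset.sum_sub_distrib, ← Finset.smul_sum, hmean]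
      have h2 : ((∑ _i : κ, (1 : Matrix ι ι ℝ)) - c • (Fintype.card κ : ℝ) • (1 : Matrix ι ι ℝ)) =
          (Fintype.card κ * (1 - c)) • (1 : Matrix ι ι ℝ) := by
        rw [Finset.sum_const, Finset.card_univ, ← Nat.cast_smul_eq_nsmul ℝ, smul_smul, ← sub_smul]
        congr 1; ring
      rw [h2, smul_mul, Matrix.one_mul, trace_smul, smul_eq_mul]
      refine mul_le_mul_of_nonneg_right ?_ hE.trace_nonneg
      refine mul_le_mul_of_nonneg_left ?_ (by positivity)
      have := Real.add_one_le_exp (-c)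
      linarith
    refine (Finset.sum_le_sum fun f _ => step f).trans ?_
    rw [← Finset.mul_sum, pow_succ']
    refine (mul_le_mul_of_nonneg_left ih (by positivity)).trans (le_of_eq (by ring))

/-- A failing quadratic form has an eigenvalue below `a`, and its exponential is one of the positive
terms of the trace. This is the Markov half of the tail bound. -/
theorem exp_le_trace_exp {S : Matrix ι ι ℝ} {θ a : ℝ} (hθ : 0 ≤ θ) (hS : S.IsHermitian)
    (h : ¬ ∀ v : ι → ℝ, a * (v ⬝ᵥ v) ≤ v ⬝ᵥ (S *ᵥ v)) :
    Real.exp (-θ * a) ≤ (exp (-θ • S)).trace := by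
  obtain ⟨W, e, h1, h2, rfl⟩ := exists_orthogonal_diagonalization hS
  have hex : ∃ i, e i < a := by
    by_contra! hcon
    refine h fun v => ?_
    have q : ∀ f : ι → ℝ, v ⬝ᵥ ((W * diagonal f * Wᵀ) *ᵥ v) =
        ∑ i, f i * (Wᵀ *ᵥ v) i ^ 2 := fun f => by
      rw [← mulVec_mulVec, ← mulVec_mulVec, dotProduct_mulVec, ← mulVec_transpose, dotProduct]
      refine Finset.sum_congr rfl fun i _ => ?_
      rw [mulVec_diagonal]; ring
    have q1 : v ⬝ᵥ v = ∑ i, 1 * (Wᵀ *ᵥ v) i ^ 2 := by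
      rw [← q, diagonal_one, Matrix.mul_one, h2, one_mulVec]
    rw [q1, q, Finset.mul_sum]
    refine Finset.sum_le_sum fun i _ => ?_
    rw [one_mul]
    exact mul_le_mul_of_nonneg_right (hcon i) (sq_nonneg _)
  obtain ⟨i, hi⟩ := hex
  rw [exp_smul_conj_diagonal h2, Matrix.trace_mul_comm, ← Matrix.mul_assoc, h1, Matrix.one_mul,
    trace_diagonal]
  refine le_trans ?_ (Finset.single_le_sum (fun j _ => (Real.exp_pos _).le) (Finset.mem_univ i))
  exact Real.exp_le_exp.2 (by nlinarith)

open Classical in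
/-- The lower tail of the smallest eigenvalue of a sum of independent random matrices `X i`, each
of mean `1` and with `0 ≤ X i ≤ M`. -/
theorem card_filter_eigenvalue_lt_le [Nonempty κ] {X : κ → Matrix ι ι ℝ} {M : ℝ} (hM : 0 < M)
    (hX : ∀ i, (X i).PosSemidef) (hXM : ∀ i, (M • (1 : Matrix ι ι ℝ) - X i).PosSemidef)
    (hmean : ∑ i, X i = (Fintype.card κ : ℝ) • (1 : Matrix ι ι ℝ)) (r : ℕ) :
    ((Finset.univ.filter fun f : Fin r → κ => ¬ ∀ v : ι → ℝ,
        (r / Real.sqrt 2) * (v ⬝ᵥ v) ≤ v ⬝ᵥ ((∑ t, X (f t)) *ᵥ v)).card : ℝ) ≤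
      (Fintype.card κ : ℝ) ^ r * (Fintype.card ι * Real.exp (-(r / M / 25))) := by
  -- In units of `r / M` the final exponent is `-(1 - exp (-1/4)) + 1 / (4√2)`. By `hexp` and `hs`
  -- it is at most `-7/32 + 71/400 = -0.04125`, which is below `-1/25`.
  set θ : ℝ := 1 / (4 * M) with hθ
  have hθ0 : 0 ≤ θ := by positivity
  have h1 := sum_trace_exp_le (θ := θ) hM hX hXM hmean r
  set bad := Finset.univ.filter fun f : Fin r → κ => ¬ ∀ v : ι → ℝ,
        (r / Real.sqrt 2) * (v ⬝ᵥ v) ≤ v ⬝ᵥ ((∑ t, X (f t)) *ᵥ v) with hbad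
  have hherm : ∀ f : Fin r → κ, (∑ t, X (f t)).IsHermitian := fun f =>
    (posSemidef_sum _ fun t _ => hX _).1
  have h2 : (bad.card : ℝ) * Real.exp (-θ * (r / Real.sqrt 2)) ≤
      ∑ f : Fin r → κ, (exp (-θ • ∑ t, X (f t))).trace := by
    rw [← nsmul_eq_mul]
    refine (Finset.card_nsmul_le_sum bad _ _ fun f hf => ?_).trans
      (Finset.sum_le_sum_of_subset_of_nonneg (Finset.subset_univ _)
        fun f _ _ => (exp_posSemidef (hherm f) _).trace_nonneg)
    exact exp_le_trace_exp hθ0 (hherm f) (Finset.mem_filter.1 hf).2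
  have h3 := h2.trans h1
  have hm : -θ * M = -(1 / 4) := by rw [hθ]; field_simp
  rw [hm] at h3
  have hexp : Real.exp (-(1 / 4)) ≤ 1 - 7 / 32 := by
    have h := Real.quadratic_le_exp_of_nonneg (show (0 : ℝ) ≤ 1 / 4 by norm_num)
    rw [Real.exp_neg, inv_le_comm₀ (Real.exp_pos _) (by norm_num)]
    refine le_trans ?_ h
    norm_num
  have hs : (1 / Real.sqrt 2 : ℝ) ≤ 71 / 100 := by
    rw [div_le_iff₀ (by positivity)]
    have : (100 / 71 : ℝ) ≤ Real.sqrt 2 := Real.le_sqrt_of_sq_le (by norm_num)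
    linarith
  have h4 : (bad.card : ℝ) ≤
      (Fintype.card κ * Real.exp (-((1 - Real.exp (-(1 / 4))) / M))) ^ r * Fintype.card ι
        * Real.exp (θ * (r / Real.sqrt 2)) := by
    have := mul_le_mul_of_nonneg_right h3 (Real.exp_pos (θ * (r / Real.sqrt 2))).le
    rwa [mul_assoc, ← Real.exp_add, neg_mul, neg_add_cancel, Real.exp_zero, mul_one] at this
  refine h4.trans ?_
  rw [mul_pow, ← Real.exp_nat_mul, mul_assoc, mul_assoc, mul_comm (Real.exp _), mul_assoc,
    ← Real.exp_add]
  gcongr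
  have hr : (0 : ℝ) ≤ r / M := by positivity
  have e1 : θ * (r / Real.sqrt 2) = (r / M) * (1 / Real.sqrt 2) / 4 := by rw [hθ]; field_simp
  have e2 : (r : ℝ) * -((1 - Real.exp (-(1 / 4))) / M) = -(r / M) * (1 - Real.exp (-(1 / 4))) := by
    ring
  rw [e1, e2]
  nlinarith [mul_le_mul_of_nonneg_left hs hr, mul_le_mul_of_nonneg_left hexp hr]

end Chernoff


/-! ### Random signs and random indices -/

section Signs

/-- The sign encoded by a bit. -/
def sgn (c : Bool) : ℝ := if c then 1 else -1

theorem sgn_sq (c : Bool) : sgn c ^ 2 = 1 := by cases c <;> simp [sgn]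

variable {ι : Type*} [Fintype ι] [DecidableEq ι]

/-- The sum over sign patterns factors into terms `2 cosh (a i)`, and `cosh x ≤ exp (x² / 2)`. -/
theorem sum_exp_sgn_le (a : ι → ℝ) :
    ∑ σ : ι → Bool, Real.exp (∑ i, a i * sgn (σ i)) ≤
      2 ^ Fintype.card ι * Real.exp ((∑ i, a i ^ 2) / 2) := by
  have h1 : ∑ σ : ι → Bool, Real.exp (∑ i, a i * sgn (σ i)) = ∏ i, (2 * Real.cosh (a i)) := by
    simp only [Real.exp_sum]
    rw [← Fintype.piFinset_univ, ← Finset.prod_univ_sum (fun _ => Finset.univ)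
      (fun i c => Real.exp (a i * sgn c))]
    refine Finset.prod_congr rfl fun i _ => ?_
    simp [sgn, Real.cosh_eq]
    ring
  rw [h1, Finset.prod_mul_distrib, Finset.prod_const, Finset.card_univ, Finset.sum_div,
    Real.exp_sum]
  gcongr with i
  exact Real.cosh_le_exp_half_sq _

open Classical in
-- Chernoff's method with the optimal parameter `t / v`.
theorem card_filter_le_sum_sgn_le {a : ι → ℝ} {v t : ℝ} (hv : 0 < v) (ht : 0 ≤ t)
    (ha : ∑ i, a i ^ 2 ≤ v) :
    ((Finset.univ.filter fun σ : ι → Bool => t ≤ ∑ i, a i * sgn (σ i)).card : ℝ) ≤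
      2 ^ Fintype.card ι * Real.exp (-(t ^ 2 / (2 * v))) := by
  set bad := Finset.univ.filter fun σ : ι → Bool => t ≤ ∑ i, a i * sgn (σ i) with hbad
  have h1 := sum_exp_sgn_le fun i => t / v * a i
  have h2 : (bad.card : ℝ) * Real.exp (t / v * t) ≤
      ∑ σ : ι → Bool, Real.exp (∑ i, t / v * a i * sgn (σ i)) := by
    rw [← nsmul_eq_mul]
    refine (Finset.card_nsmul_le_sum bad _ _ fun σ hσ => ?_).trans
      (Finset.sum_le_sum_of_subset_of_nonneg (Finset.subset_univ _)
        fun f _ _ => (Real.exp_pos _).le)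
    rw [Real.exp_le_exp]
    simp only [mul_assoc, ← Finset.mul_sum] at *
    exact mul_le_mul_of_nonneg_left (Finset.mem_filter.1 hσ).2 (by positivity)
  have h3 := h2.trans h1
  rw [← le_div_iff₀ (Real.exp_pos _), mul_div_assoc, ← Real.exp_sub] at h3
  refine h3.trans ?_
  gcongr
  have h4 : (∑ i, (t / v * a i) ^ 2) ≤ (t / v) ^ 2 * v := by
    simp only [mul_pow, ← Finset.mul_sum]
    gcongr
  have e : (t / v) ^ 2 * v / 2 - t / v * t = -(t ^ 2 / (2 * v)) := by
    field_simp; ring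
  linarith

open Classical in
/-- Hoeffding's inequality for a sum with random signs. -/
theorem card_filter_le_abs_sum_sgn_le {a : ι → ℝ} {v t : ℝ} (hv : 0 < v) (ht : 0 ≤ t)
    (ha : ∑ i, a i ^ 2 ≤ v) :
    ((Finset.univ.filter fun σ : ι → Bool => t ≤ |∑ i, a i * sgn (σ i)|).card : ℝ) ≤
      2 ^ Fintype.card ι * (2 * Real.exp (-(t ^ 2 / (2 * v)))) := by
  have h1 := card_filter_le_sum_sgn_le hv ht ha
  have h2 := card_filter_le_sum_sgn_le (a := fun i => - a i) hv ht (by simpa using ha)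
  have h3 : (Finset.univ.filter fun σ : ι → Bool => t ≤ |∑ i, a i * sgn (σ i)|) ⊆
      (Finset.univ.filter fun σ : ι → Bool => t ≤ ∑ i, a i * sgn (σ i)) ∪
      (Finset.univ.filter fun σ : ι → Bool => t ≤ ∑ i, -a i * sgn (σ i)) := by
    intro σ hσ
    simp only [Finset.mem_filter, Finset.mem_univ, true_and, Finset.mem_union] at hσ ⊢
    simp only [neg_mul, Finset.sum_neg_distrib]
    exact le_abs.1 hσ
  have h4 : ((Finset.univ.filter fun σ : ι → Bool => t ≤ |∑ i, a i * sgn (σ i)|).card : ℝ) ≤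
      (Finset.univ.filter fun σ : ι → Bool => t ≤ ∑ i, a i * sgn (σ i)).card +
      (Finset.univ.filter fun σ : ι → Bool => t ≤ ∑ i, -a i * sgn (σ i)).card := by
    exact_mod_cast (Finset.card_le_card h3).trans (Finset.card_union_le _ _)
  linarith

open Classical in
/-- With random signs, the rows of a randomized Hadamard transform of a matrix with orthonormal
columns all have nearly the same norm. -/
theorem card_filter_row_norm_gt_le {n d : ℕ} (hn : 0 < n) (hd : 0 < d)
    {H : Matrix (Fin n) (Fin n) ℝ} (hH : ∀ i l, H i l ^ 2 = 1 / n)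
    {U : Matrix (Fin n) (Fin d) ℝ} (hU : Uᵀ * U = 1) :
    ((Finset.univ.filter fun σ : Fin n → Bool => ∃ i, 2 * d * Real.log (40 * n * d) <
        n * ∑ j, (H * diagonal (fun l => sgn (σ l)) * U) i j ^ 2).card : ℝ) ≤
      2 ^ n * (1 / 20) := by
  set L := Real.log (40 * n * d) with hL
  have hn' : (1 : ℝ) ≤ n := by exact_mod_cast hn
  have hd' : (1 : ℝ) ≤ d := by exact_mod_cast hd
  have hnd : (1 : ℝ) ≤ n * d := by nlinarith
  have hL0 : 0 ≤ L := Real.log_nonneg (by nlinarith)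
  -- Each entry of `H D U` is a signed sum with squares adding up to `1 / n`. At this threshold its
  -- failure rate is `2 / (40 n d)`, so a union bound over the `n d` entries gives `1/20`.
  set t := Real.sqrt (2 * L / n) with ht
  have ht2 : t ^ 2 = 2 * L / n := Real.sq_sqrt (by positivity)
  have hW : ∀ (σ : Fin n → Bool) i j, (H * diagonal (fun l => sgn (σ l)) * U) i j =
      ∑ l, H i l * U l j * sgn (σ l) := fun σ i j => by
    rw [mul_apply]
    simp only [mul_diagonal]
    exact Finset.sum_congr rfl fun l _ => by ring
  have ha : ∀ i j, ∑ l, (H i l * U l j) ^ 2 ≤ 1 / n := fun i j => by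
    have h1 : (Uᵀ * U) j j = 1 := by rw [hU, one_apply_eq]
    rw [mul_apply] at h1
    simp only [mul_pow, hH, ← Finset.mul_sum]
    simp only [transpose_apply, ← pow_two] at h1
    rw [h1, mul_one]
  have hsub : (Finset.univ.filter fun σ : Fin n → Bool => ∃ i, 2 * d * L <
        n * ∑ j, (H * diagonal (fun l => sgn (σ l)) * U) i j ^ 2) ⊆
      (Finset.univ : Finset (Fin n × Fin d)).biUnion fun p =>
        Finset.univ.filter fun σ : Fin n → Bool =>
          t ≤ |∑ l, H p.1 l * U l p.2 * sgn (σ l)| := by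
    intro σ hσ
    simp only [Finset.mem_filter, Finset.mem_univ, true_and, Finset.mem_biUnion,
      Prod.exists] at hσ ⊢
    obtain ⟨i, hi⟩ := hσ
    by_contra! hcon
    refine absurd hi (not_lt.2 ?_)
    have h1 : ∀ j, (H * diagonal (fun l => sgn (σ l)) * U) i j ^ 2 ≤ 2 * L / n := fun j => by
      rw [hW, ← ht2, ← sq_abs]
      exact pow_le_pow_left₀ (abs_nonneg _) (hcon i j).le 2
    have h2 := Finset.sum_le_sum fun (j : Fin d) (_ : j ∈ Finset.univ) => h1 j
    rw [Finset.sum_const, Finset.card_univ, Fintype.card_fin, nsmul_eq_mul] at h2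
    calc _ ≤ (n : ℝ) * (d * (2 * L / n)) := by gcongr
      _ = _ := by field_simp
  have hcard := (Finset.card_le_card hsub).trans Finset.card_biUnion_le
  have hcard' : ((Finset.univ.filter fun σ : Fin n → Bool => ∃ i, 2 * d * L <
        n * ∑ j, (H * diagonal (fun l => sgn (σ l)) * U) i j ^ 2).card : ℝ) ≤
      ∑ p : Fin n × Fin d, ((Finset.univ.filter fun σ : Fin n → Bool =>
          t ≤ |∑ l, H p.1 l * U l p.2 * sgn (σ l)|).card : ℝ) := by
    exact_mod_cast hcard
  refine hcard'.trans ((Finset.sum_le_sum fun p _ => card_filter_le_abs_sum_sgn_le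
    (v := 1 / n) (by positivity) (Real.sqrt_nonneg _) (ha p.1 p.2)).trans (le_of_eq ?_))
  have hexp : Real.exp (-(t ^ 2 / (2 * (1 / n)))) = 1 / (40 * n * d) := by
    rw [ht2, show (2 * L / n / (2 * (1 / n)) : ℝ) = L by field_simp, Real.exp_neg, hL,
      Real.exp_log (by positivity), one_div]
  rw [hexp, Finset.sum_const, Finset.card_univ, Fintype.card_prod, Fintype.card_fin,
    Fintype.card_fin, nsmul_eq_mul]
  push_cast
  field_simp
  norm_num

end Signs

/-! ### Second moments of sums over uniformly drawn indices -/

section Indices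

variable {κ : Type*} [Fintype κ]

/-- The variance of a sum of independent centred samples: the cross terms vanish because `y` sums to
zero. -/
theorem card_mul_sum_sum_sq {y : κ → ℝ} (hy : ∑ i, y i = 0) (r : ℕ) :
    Fintype.card κ * ∑ f : Fin r → κ, (∑ t, y (f t)) ^ 2 =
      r * (Fintype.card κ : ℝ) ^ r * ∑ i, y i ^ 2 := by
  induction r with
  | zero => simp
  | succ r ih =>
    rw [← (Fin.consEquiv fun _ => κ).sum_comp, Fintype.sum_prod_type]
    have e : ∀ i (f : Fin r → κ), (∑ t, y ((Fin.consEquiv fun _ => κ) (i, f) t)) ^ 2 =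
        y i ^ 2 + 2 * (y i * ∑ t, y (f t)) + (∑ t, y (f t)) ^ 2 := fun i f => by
      rw [Fin.sum_univ_succ]
      simp only [Fin.consEquiv_apply, Fin.cons_zero, Fin.cons_succ]
      ring
    simp only [e, Finset.sum_add_distrib, ← Finset.mul_sum, Finset.sum_const, Finset.card_univ,
      ← Finset.sum_mul, hy, nsmul_eq_mul, Fintype.card_fun, Fintype.card_fin, zero_mul, mul_zero]
    push_cast
    rw [mul_add, ih]
    ring

open Classical in
/-- Sampling rows approximates a matrix-vector product that vanishes. -/
theorem card_filter_sampled_product_gt_le {n d r : ℕ} (hn : 0 < n) {W : Matrix (Fin n) (Fin d) ℝ}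
    {w : Fin n → ℝ} {M a : ℝ} (hM : ∀ i, n * ∑ j, W i j ^ 2 ≤ M) (hWw : Wᵀ *ᵥ w = 0)
    (ha : 0 < a) :
    ((Finset.univ.filter fun f : Fin r → Fin n =>
        a * (w ⬝ᵥ w) < ∑ j, (∑ t, n * (w (f t) * W (f t) j)) ^ 2).card : ℝ) ≤
      n ^ r * (r * M / a) := by
  set bad := Finset.univ.filter fun f : Fin r → Fin n =>
        a * (w ⬝ᵥ w) < ∑ j, (∑ t, n * (w (f t) * W (f t) j)) ^ 2 with hbad
  have hn' : (0 : ℝ) < n := by exact_mod_cast hn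
  have hM0 : 0 ≤ M := le_trans (by positivity) (hM ⟨0, hn⟩)
  have hsum : ∑ f : Fin r → Fin n, ∑ j, (∑ t, n * (w (f t) * W (f t) j)) ^ 2 ≤
      n ^ r * (r * M * (w ⬝ᵥ w)) := by
    rw [Finset.sum_comm]
    have h1 : ∀ j, ∑ f : Fin r → Fin n, (∑ t, n * (w (f t) * W (f t) j)) ^ 2 =
        (1 / n) * (r * (n : ℝ) ^ r * ∑ i, (n * (w i * W i j)) ^ 2) := fun j => by
      have h0 : ∑ i, (n : ℝ) * (w i * W i j) = 0 := by
        have := congrFun hWw j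
        simp only [mulVec, dotProduct, transpose_apply, Pi.zero_apply] at this
        rw [← Finset.mul_sum]
        simp only [mul_comm (w _)]
        rw [this, mul_zero]
      have := card_mul_sum_sum_sq h0 r
      rw [Fintype.card_fin] at this
      rw [← this]; field_simp
    rw [Finset.sum_congr rfl fun j _ => h1 j, ← Finset.mul_sum, ← Finset.mul_sum,
      Finset.sum_comm]
    have h2 : ∀ i, ∑ j, ((n : ℝ) * (w i * W i j)) ^ 2 ≤ n * (w i ^ 2 * M) := fun i => by
      have : ∑ j, ((n : ℝ) * (w i * W i j)) ^ 2 = n * (w i ^ 2 * (n * ∑ j, W i j ^ 2)) := by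
        simp only [Finset.mul_sum]
        exact Finset.sum_congr rfl fun j _ => by ring
      rw [this]
      gcongr
      exact hM i
    calc _ ≤ (1 / n : ℝ) * (r * (n : ℝ) ^ r * ∑ i, n * (w i ^ 2 * M)) := by
          gcongr with i; exact h2 i
      _ = _ := by
          rw [← Finset.mul_sum, ← Finset.sum_mul, dotProduct]
          simp only [pow_two]
          field_simp
  -- Markov divides by `w ⬝ᵥ w`. If it is zero, the strict inequality makes the bad set empty.
  rcases (show 0 ≤ w ⬝ᵥ w from Finset.sum_nonneg fun i _ => mul_self_nonneg _).eq_or_lt with h0 | h0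
  · have : w = 0 := dotProduct_self_eq_zero.1 h0.symm
    have hb : bad = ∅ := by
      rw [hbad, Finset.filter_eq_empty_iff]
      intro f _
      simp [this]
    rw [hb, Finset.card_empty, Nat.cast_zero]
    positivity
  · have h3 : (bad.card : ℝ) * (a * (w ⬝ᵥ w)) ≤ n ^ r * (r * M * (w ⬝ᵥ w)) := by
      refine le_trans ?_ hsum
      rw [← nsmul_eq_mul]
      refine (Finset.card_nsmul_le_sum bad _ _ fun f hf => (Finset.mem_filter.1 hf).2.le).trans
        (Finset.sum_le_sum_of_subset_of_nonneg (Finset.subset_univ _)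
          fun f _ _ => Finset.sum_nonneg fun _ _ => sq_nonneg _)
    rw [← le_div_iff₀ (by positivity)] at h3
    refine h3.trans (le_of_eq ?_)
    field_simp

end Indices


/-! ### The Hadamard transform and the sketch -/

section Hadamard

theorem hadamardPM_sq (k : ℕ) (i j : Fin (2 ^ k)) : hadamardPM k i j ^ 2 = 1 := by
  induction k with
  | zero => simp [hadamardPM]
  | succ k ih =>
    obtain ⟨i, rfl⟩ := (halves k).surjective i
    obtain ⟨j, rfl⟩ := (halves k).surjective j
    rcases i with i | i <;> rcases j with j | j <;> simp [hadamardPM, ih]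

theorem hadamardPM_transpose_mul_self (k : ℕ) :
    (hadamardPM k)ᵀ * hadamardPM k = (2 ^ k : ℝ) • (1 : Matrix (Fin (2 ^ k)) (Fin (2 ^ k)) ℝ) := by
  induction k with
  | zero =>
    ext i j
    have : i = j := Subsingleton.elim (α := Fin 1) i j
    simp [hadamardPM, mul_apply, this]
  | succ k ih =>
    rw [hadamardPM, transpose_reindex, reindex_apply, reindex_apply, submatrix_mul_equiv,
      fromBlocks_transpose, fromBlocks_multiply, transpose_neg, Matrix.neg_mul, Matrix.mul_neg,
      Matrix.mul_neg, Matrix.neg_mul, neg_neg, ih, ← sub_eq_add_neg, sub_self, ← add_smul]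
    have : (2 ^ k + 2 ^ k : ℝ) = 2 ^ (k + 1) := by ring
    rw [this]
    ext i j
    obtain ⟨i, rfl⟩ := (halves k).surjective i
    obtain ⟨j, rfl⟩ := (halves k).surjective j
    rcases i with i | i <;> rcases j with j | j <;> simp [one_apply]

theorem hadamard_sq (k : ℕ) (i j : Fin (2 ^ k)) : hadamard k i j ^ 2 = 1 / (2 ^ k : ℕ) := by
  rw [hadamard, Matrix.smul_apply, smul_eq_mul, mul_pow, hadamardPM_sq, div_pow, Real.sq_sqrt (by positivity)]
  simp

theorem hadamard_transpose_mul_self (k : ℕ) : (hadamard k)ᵀ * hadamard k = 1 := by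
  have h : (1 / Real.sqrt ((2 ^ k : ℕ) : ℝ)) * (1 / Real.sqrt ((2 ^ k : ℕ) : ℝ)) * (2 ^ k : ℝ) = 1 := by
    rw [← pow_two, div_pow, Real.sq_sqrt (by positivity)]
    push_cast
    field_simp
  rw [hadamard, transpose_smul, smul_mul, Matrix.mul_smul, hadamardPM_transpose_mul_self,
    smul_smul, smul_smul, h, one_smul]

theorem signMatrix_eq {n r : ℕ} (ω : Sample n r) :
    signMatrix ω = diagonal fun i => sgn (ω.1 i) := rfl

theorem diagonal_sgn_mul_self {n : ℕ} (σ : Fin n → Bool) :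
    (diagonal fun i => sgn (σ i)) * (diagonal fun i => sgn (σ i)) = 1 := by
  rw [diagonal_mul_diagonal, ← diagonal_one]
  congr 1; ext i; rw [← pow_two, sgn_sq]

theorem samplingMatrix_transpose_mul_apply {n r : ℕ} {m : Type*} (ω : Sample n r)
    (B : Matrix (Fin n) m ℝ) (t : Fin r) (j : m) :
    ((samplingMatrix ω)ᵀ * B) t j = Real.sqrt (n / r) * B (ω.2 t) j := by
  simp [samplingMatrix, mul_apply, ite_mul]

theorem sketch_mul_apply {k r : ℕ} {m : Type*} (ω : Sample (2 ^ k) r)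
    (B : Matrix (Fin (2 ^ k)) m ℝ) (t : Fin r) (j : m) :
    (sketch ω * B) t j = Real.sqrt ((2 ^ k : ℕ) / r) *
      (hadamard k * (diagonal fun i => sgn (ω.1 i)) * B) (ω.2 t) j := by
  rw [sketch, signMatrix_eq, Matrix.mul_assoc, Matrix.mul_assoc,
    samplingMatrix_transpose_mul_apply, Matrix.mul_assoc]

theorem sketch_mulVec_apply {k r : ℕ} (ω : Sample (2 ^ k) r) (v : Fin (2 ^ k) → ℝ) (t : Fin r) :
    (sketch ω *ᵥ v) t = Real.sqrt ((2 ^ k : ℕ) / r) *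
      ((hadamard k * (diagonal fun i => sgn (ω.1 i))) *ᵥ v) (ω.2 t) := by
  have h := sketch_mul_apply ω (replicateCol Unit v) t ()
  simpa [← replicateCol_mulVec] using h

end Hadamard

/-! ### Least squares -/

section LeastSquares

theorem norm2_nonneg {m : ℕ} (v : Fin m → ℝ) : 0 ≤ norm2 v := norm_nonneg _

theorem norm2_sq {m : ℕ} (v : Fin m → ℝ) : norm2 v ^ 2 = v ⬝ᵥ v := by
  rw [norm2, EuclideanSpace.norm_sq_eq]
  simp [dotProduct, pow_two]

theorem dotProduct_self_nonneg_real {m : ℕ} (v : Fin m → ℝ) : 0 ≤ v ⬝ᵥ v := by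
  rw [← norm2_sq]; positivity

theorem dotProduct_sq_le {m : ℕ} (v w : Fin m → ℝ) : (v ⬝ᵥ w) ^ 2 ≤ (v ⬝ᵥ v) * (w ⬝ᵥ w) := by
  have := Finset.sum_mul_sq_le_sq_mul_sq Finset.univ v w
  simpa [dotProduct, pow_two] using this

theorem mulVec_dotProduct_mulVec {m n : ℕ} (B : Matrix (Fin m) (Fin n) ℝ) (v : Fin n → ℝ)
    (w : Fin m → ℝ) : (B *ᵥ v) ⬝ᵥ w = v ⬝ᵥ (Bᵀ *ᵥ w) := by
  rw [mulVec_transpose, dotProduct_comm, dotProduct_mulVec, dotProduct_comm]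

theorem mulVec_dotProduct_self_of_transpose_mul {m n : ℕ} {Q : Matrix (Fin m) (Fin n) ℝ}
    (hQ : Qᵀ * Q = 1) (v : Fin n → ℝ) : (Q *ᵥ v) ⬝ᵥ (Q *ᵥ v) = v ⬝ᵥ v := by
  rw [mulVec_dotProduct_mulVec, mulVec_mulVec, hQ, one_mulVec]

/-- The normal equations. They hold for every rank, so the sketched matrix need not be shown to have
full rank. -/
theorem transpose_mulVec_pinv {m n : ℕ} (B : Matrix (Fin m) (Fin n) ℝ) (c : Fin m → ℝ) :
    Bᵀ *ᵥ (B *ᵥ (pinv B *ᵥ c)) = Bᵀ *ᵥ c := by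
  have h := pinv_spec B
  rw [mulVec_mulVec _ B, mulVec_mulVec, ← h.symm_left, ← transpose_mul, h.mul_mul_left]

theorem transpose_mulVec_residual {n d : ℕ} (A : Matrix (Fin n) (Fin d) ℝ) (b : Fin n → ℝ) :
    Aᵀ *ᵥ (b - A *ᵥ lsSolution A b) = 0 := by
  rw [mulVec_sub, lsSolution, transpose_mulVec_pinv, sub_self]

/-- Pythagoras: the optimal residual is orthogonal to the column space of `A`. -/
theorem mulVec_sub_dotProduct_self {n d : ℕ} (A : Matrix (Fin n) (Fin d) ℝ) (b : Fin n → ℝ)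
    (x : Fin d → ℝ) : (A *ᵥ x - b) ⬝ᵥ (A *ᵥ x - b) =
      (A *ᵥ (x - lsSolution A b)) ⬝ᵥ (A *ᵥ (x - lsSolution A b)) +
        (b - A *ᵥ lsSolution A b) ⬝ᵥ (b - A *ᵥ lsSolution A b) := by
  have e : A *ᵥ x - b = A *ᵥ (x - lsSolution A b) - (b - A *ᵥ lsSolution A b) := by
    rw [mulVec_sub]; abel
  have h0 : (A *ᵥ (x - lsSolution A b)) ⬝ᵥ (b - A *ᵥ lsSolution A b) = 0 := by
    rw [mulVec_dotProduct_mulVec, transpose_mulVec_residual, dotProduct_zero]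
  rw [e]
  generalize A *ᵥ (x - lsSolution A b) = p at *
  generalize b - A *ᵥ lsSolution A b = q at *
  rw [sub_dotProduct, dotProduct_sub, dotProduct_sub, dotProduct_comm q p, h0]
  ring

theorem norm2_residual_le_lsValue {n d : ℕ} (A : Matrix (Fin n) (Fin d) ℝ) (b : Fin n → ℝ) :
    norm2 (b - A *ᵥ lsSolution A b) ≤ lsValue A b := by
  refine le_ciInf fun x => ?_
  refine le_of_sq_le_sq ?_ (norm2_nonneg _)
  rw [norm2_sq, norm2_sq, mulVec_sub_dotProduct_self A b x]
  linarith [dotProduct_self_nonneg_real (A *ᵥ (x - lsSolution A b))]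

/-! ### Geometry of a thin singular value decomposition -/

namespace IsThinSVD

variable {n d : ℕ} {A U : Matrix (Fin n) (Fin d) ℝ} {V : Matrix (Fin d) (Fin d) ℝ}

theorem mulVec_eq (h : IsThinSVD A U V) (y : Fin d → ℝ) :
    A *ᵥ y = U *ᵥ fun i => singVal A i * (Vᵀ *ᵥ y) i := by
  conv_lhs => rw [h.eq_mul]
  rw [← mulVec_mulVec, ← mulVec_mulVec]
  congr 1; ext i; rw [mulVec_diagonal]

/-- At full rank the singular values are positive, so `Σ` can be cancelled. -/
theorem transpose_mulVec_eq_zero (h : IsThinSVD A U V) (hA : A.rank = d) {w : Fin n → ℝ}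
    (hw : Aᵀ *ᵥ w = 0) : Uᵀ *ᵥ w = 0 := by
  have e : Aᵀ = V * (diagonal (fun i : Fin d => singVal A i) * Uᵀ) := by
    conv_lhs => rw [h.eq_mul]
    rw [transpose_mul, transpose_mul, transpose_transpose, diagonal_transpose]
  have h1 : Vᵀ *ᵥ (Aᵀ *ᵥ w) = diagonal (fun i : Fin d => singVal A i) *ᵥ (Uᵀ *ᵥ w) := by
    rw [e, ← mulVec_mulVec, mulVec_mulVec, h.orth_right, one_mulVec, mulVec_mulVec]
  rw [hw, mulVec_zero] at h1
  ext i
  have h2 := congrFun h1 i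
  rw [mulVec_diagonal, Pi.zero_apply, zero_eq_mul] at h2
  exact h2.resolve_left (singVal_pos hA i).ne'

theorem mulVec_dotProduct_self (h : IsThinSVD A U V) (y : Fin d → ℝ) :
    (A *ᵥ y) ⬝ᵥ (A *ᵥ y) = ∑ i : Fin d, singVal A i ^ 2 * (Vᵀ *ᵥ y) i ^ 2 := by
  rw [h.mulVec_eq, mulVec_dotProduct_self_of_transpose_mul h.orth_left, dotProduct]
  exact Finset.sum_congr rfl fun i _ => by ring

theorem dotProduct_self (h : IsThinSVD A U V) (y : Fin d → ℝ) :
    y ⬝ᵥ y = ∑ i : Fin d, (Vᵀ *ᵥ y) i ^ 2 := by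
  have := mulVec_dotProduct_self_of_transpose_mul (Q := Vᵀ)
    (by rw [transpose_transpose]; exact mul_eq_one_comm.1 h.orth_right) y
  rw [← this, dotProduct]
  exact Finset.sum_congr rfl fun i _ => by ring

theorem le_mulVec_dotProduct_self (h : IsThinSVD A U V) (y : Fin d → ℝ) :
    singVal A (d - 1) ^ 2 * (y ⬝ᵥ y) ≤ (A *ᵥ y) ⬝ᵥ (A *ᵥ y) := by
  rw [h.mulVec_dotProduct_self, h.dotProduct_self, Finset.mul_sum]
  refine Finset.sum_le_sum fun i _ => ?_
  gcongr
  · exact LinearMap.singularValues_nonneg _ _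
  · exact LinearMap.singularValues_antitone _ (by omega)

theorem mulVec_dotProduct_self_le (h : IsThinSVD A U V) (y : Fin d → ℝ) :
    (A *ᵥ y) ⬝ᵥ (A *ᵥ y) ≤ singVal A 0 ^ 2 * (y ⬝ᵥ y) := by
  rw [h.mulVec_dotProduct_self, h.dotProduct_self, Finset.mul_sum]
  refine Finset.sum_le_sum fun i _ => ?_
  gcongr
  · exact LinearMap.singularValues_nonneg _ _
  · exact LinearMap.singularValues_antitone _ (Nat.zero_le _)

/-- Both sides are the orthogonal projection of `b` onto the column space of `A`. -/
theorem mul_transpose_mulVec (h : IsThinSVD A U V) (hA : A.rank = d) (b : Fin n → ℝ) :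
    (U * Uᵀ) *ᵥ b = A *ᵥ lsSolution A b := by
  have h1 := h.transpose_mulVec_eq_zero hA (transpose_mulVec_residual A b)
  rw [mulVec_sub, sub_eq_zero] at h1
  rw [← mulVec_mulVec, h1, h.mulVec_eq, mulVec_mulVec _ Uᵀ U, h.orth_left, one_mulVec]

end IsThinSVD

/-- A sketching matrix that nearly preserves lengths in the column space of `A`, and the
orthogonality of the residual to it, gives a good approximate solution. -/
theorem sketched_error_le {n d r : ℕ} {A U : Matrix (Fin n) (Fin d) ℝ}
    {V : Matrix (Fin d) (Fin d) ℝ} (h : IsThinSVD A U V) (hA : A.rank = d)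
    {X : Matrix (Fin r) (Fin n) ℝ} {b β : Fin n → ℝ} {ε : ℝ}
    (hβ : β = b - A *ᵥ lsSolution A b)
    (h1 : ∀ v : Fin d → ℝ, 1 / Real.sqrt 2 * (v ⬝ᵥ v) ≤ ((X * U) *ᵥ v) ⬝ᵥ ((X * U) *ᵥ v))
    (h2 : ((X * U)ᵀ *ᵥ (X *ᵥ β)) ⬝ᵥ ((X * U)ᵀ *ᵥ (X *ᵥ β)) ≤ ε / 2 * (β ⬝ᵥ β)) :
    (A *ᵥ (pinv (X * A) *ᵥ (X *ᵥ b) - lsSolution A b)) ⬝ᵥ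
      (A *ᵥ (pinv (X * A) *ᵥ (X *ᵥ b) - lsSolution A b)) ≤ ε * (β ⬝ᵥ β) := by
  set x := pinv (X * A) *ᵥ (X *ᵥ b) with hx
  set xo := lsSolution A b with hxo
  -- In the coordinate `z` the sketched normal equations become `(X U)ᵀ (X U) z = g`. Hence `‖z‖² /
  -- √2 ≤ ⟨z, g⟩ ≤ ‖z‖ ‖g‖`, so that `‖z‖² ≤ 2 ‖g‖²`.
  obtain ⟨z, hz⟩ : ∃ z, A *ᵥ (x - xo) = U *ᵥ z := ⟨_, h.mulVec_eq _⟩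
  have hn : (X * A)ᵀ *ᵥ ((X * A) *ᵥ x - X *ᵥ b) = 0 := by
    rw [mulVec_sub, hx, transpose_mulVec_pinv, sub_self]
  have e : (X * A) *ᵥ x - X *ᵥ b = (X * U) *ᵥ z - X *ᵥ β := by
    have e0 : A *ᵥ x - b = U *ᵥ z - β := by rw [← hz, hβ, mulVec_sub]; abel
    rw [← mulVec_mulVec, ← mulVec_mulVec, ← mulVec_sub, ← mulVec_sub, e0]
  rw [e, transpose_mul, ← mulVec_mulVec] at hn
  have hn2 := h.transpose_mulVec_eq_zero hA hn
  rw [mulVec_mulVec, ← transpose_mul, mulVec_sub, sub_eq_zero] at hn2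
  set g := (X * U)ᵀ *ᵥ (X *ᵥ β) with hg
  rw [hz, mulVec_dotProduct_self_of_transpose_mul h.orth_left]
  have h3 := h1 z
  rw [mulVec_dotProduct_mulVec, hn2] at h3
  have h4 := dotProduct_sq_le z g
  have hz0 := dotProduct_self_nonneg_real z
  have h5 : (1 / Real.sqrt 2 * (z ⬝ᵥ z)) ^ 2 ≤ (z ⬝ᵥ g) ^ 2 := by gcongr
  rw [mul_pow, div_pow, Real.sq_sqrt (by norm_num)] at h5
  rcases hz0.eq_or_lt with h0 | h0
  · rw [← h0]
    have := dotProduct_self_nonneg_real g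
    linarith
  · have : (z ⬝ᵥ z) * (z ⬝ᵥ z) ≤ (z ⬝ᵥ z) * (2 * (g ⬝ᵥ g)) := by nlinarith
    have := le_of_mul_le_mul_left this h0
    linarith

/-- By Pythagoras the squared residual is at most `(1 + ε) ‖β‖²`, a fortiori at most `(1 + ε)²
‖β‖²`. -/
theorem norm2_mulVec_sub_le {n d : ℕ} {A : Matrix (Fin n) (Fin d) ℝ} {b : Fin n → ℝ}
    {x : Fin d → ℝ} {ε : ℝ} (hε : 0 < ε)
    (hx : (A *ᵥ (x - lsSolution A b)) ⬝ᵥ (A *ᵥ (x - lsSolution A b)) ≤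
      ε * ((b - A *ᵥ lsSolution A b) ⬝ᵥ (b - A *ᵥ lsSolution A b))) :
    norm2 (A *ᵥ x - b) ≤ (1 + ε) * lsValue A b := by
  refine le_trans ?_ (mul_le_mul_of_nonneg_left (norm2_residual_le_lsValue A b) (by positivity))
  refine le_of_sq_le_sq ?_ (mul_nonneg (by positivity) (norm2_nonneg _))
  rw [mul_pow, norm2_sq, norm2_sq, mulVec_sub_dotProduct_self]
  have := dotProduct_self_nonneg_real (b - A *ᵥ lsSolution A b)
  nlinarith [mul_nonneg hε.le this, mul_nonneg (sq_nonneg ε) this]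

/-- The chain is `σ_min² ‖x - x_opt‖² ≤ ε ‖β‖² ≤ ε (γ⁻² - 1) ‖A x_opt‖² ≤ ε (γ⁻² - 1) σ_max²
‖x_opt‖²`. Its middle step is Pythagoras at `x = 0`, that is `‖b‖² = ‖A x_opt‖² + ‖β‖²`. -/
theorem norm2_lsSolution_sub_le {n d : ℕ} {A U : Matrix (Fin n) (Fin d) ℝ}
    {V : Matrix (Fin d) (Fin d) ℝ} (h : IsThinSVD A U V) (hA : A.rank = d) (hd : 0 < d)
    {b : Fin n → ℝ} {x : Fin d → ℝ} {ε γ : ℝ} (hε : 0 < ε)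
    (hx : (A *ᵥ (x - lsSolution A b)) ⬝ᵥ (A *ᵥ (x - lsSolution A b)) ≤
      ε * ((b - A *ᵥ lsSolution A b) ⬝ᵥ (b - A *ᵥ lsSolution A b)))
    (hγ : 0 < γ) (hγ1 : γ ≤ 1) (hb : γ * norm2 b ≤ norm2 ((U * Uᵀ) *ᵥ b)) :
    norm2 (lsSolution A b - x) ≤
      Real.sqrt ε * (condNum A * Real.sqrt (γ⁻¹ ^ 2 - 1)) * norm2 (lsSolution A b) := by
  have hs0 : 0 < singVal A (d - 1) := singVal_pos hA ⟨d - 1, by omega⟩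
  have hs1 : 0 ≤ singVal A 0 := LinearMap.singularValues_nonneg _ _
  have hg : 0 ≤ γ⁻¹ ^ 2 - 1 := by
    have : 1 ≤ γ⁻¹ := (one_le_inv₀ hγ).2 hγ1
    nlinarith
  rw [h.mul_transpose_mulVec hA] at hb
  have hbb := mulVec_sub_dotProduct_self A b 0
  rw [mulVec_zero, zero_sub, zero_sub, mulVec_neg, neg_dotProduct_neg, neg_dotProduct_neg] at hbb
  set xo := lsSolution A b with hxo
  set β := b - A *ᵥ xo with hβ
  have hb2 : γ ^ 2 * (b ⬝ᵥ b) ≤ (A *ᵥ xo) ⬝ᵥ (A *ᵥ xo) := by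
    rw [← norm2_sq, ← norm2_sq, ← mul_pow]
    exact pow_le_pow_left₀ (mul_nonneg hγ.le (norm2_nonneg _)) hb 2
  have hββ : β ⬝ᵥ β ≤ (γ⁻¹ ^ 2 - 1) * ((A *ᵥ xo) ⬝ᵥ (A *ᵥ xo)) := by
    have : b ⬝ᵥ b ≤ γ⁻¹ ^ 2 * ((A *ᵥ xo) ⬝ᵥ (A *ᵥ xo)) := by
      rw [inv_pow, inv_mul_eq_div, le_div_iff₀ (by positivity)]
      linarith
    linarith
  refine le_of_sq_le_sq ?_ (mul_nonneg (mul_nonneg (Real.sqrt_nonneg _) (mul_nonneg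
    (div_nonneg hs1 hs0.le) (Real.sqrt_nonneg _))) (norm2_nonneg _))
  have hl := h.le_mulVec_dotProduct_self (x - xo)
  have hu := h.mulVec_dotProduct_self_le xo
  have e : norm2 (xo - x) ^ 2 = (x - xo) ⬝ᵥ (x - xo) := by
    rw [norm2_sq, ← neg_sub x xo, neg_dotProduct_neg]
  rw [e, mul_pow, mul_pow, mul_pow, Real.sq_sqrt hε.le, Real.sq_sqrt hg, norm2_sq, condNum,
    div_pow]
  have : singVal A (d - 1) ^ 2 * ((x - xo) ⬝ᵥ (x - xo)) ≤
      ε * ((γ⁻¹ ^ 2 - 1) * (singVal A 0 ^ 2 * (xo ⬝ᵥ xo))) := by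
    refine hl.trans (hx.trans ?_)
    gcongr
    exact hββ.trans (by gcongr)
  rw [← le_div_iff₀' (by positivity)] at this
  refine this.trans (le_of_eq ?_)
  field_simp

end LeastSquares


/-! ### The success probability -/

section Probability

/-- The numerical bounds rest on `e³ ≤ 40` and `e⁹ ≤ 3 * 100²`. -/
theorem sampleSize_bounds {n d : ℕ} {ε : ℝ} (hn : 1 ≤ n) (hd : 1 ≤ d) :
    3 ≤ Real.log (40 * n * d) ∧
    48 ^ 2 * d * Real.log (40 * n * d) * Real.log (100 ^ 2 * d * Real.log (40 * n * d)) ≤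
      sampleSize n d ε ∧
    40 * d * Real.log (40 * n * d) / ε ≤ sampleSize n d ε ∧
    9 ≤ Real.log (100 ^ 2 * d * Real.log (40 * n * d)) := by
  have hn' : (1 : ℝ) ≤ n := by exact_mod_cast hn
  have hd' : (1 : ℝ) ≤ d := by exact_mod_cast hd
  have hnd : (1 : ℝ) ≤ n * d := by nlinarith
  have h1 : 3 ≤ Real.log (40 * n * d) := by
    rw [Real.le_log_iff_exp_le (by positivity)]
    have h := Real.exp_one_lt_d9.le
    have : Real.exp 3 = Real.exp 1 ^ 3 := by rw [← Real.exp_nat_mul]; norm_num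
    rw [this]
    calc Real.exp 1 ^ 3 ≤ 2.7182818286 ^ 3 := by gcongr
      _ ≤ 40 := by norm_num
      _ ≤ 40 * n * d := by linarith
  refine ⟨h1, (le_max_left _ _).trans (Nat.le_ceil _), (le_max_right _ _).trans (Nat.le_ceil _), ?_⟩
  rw [Real.le_log_iff_exp_le (by positivity)]
  have h := Real.exp_one_lt_d9.le
  have : Real.exp 9 = Real.exp 1 ^ 9 := by rw [← Real.exp_nat_mul]; norm_num
  rw [this]
  calc Real.exp 1 ^ 9 ≤ 2.7182818286 ^ 9 := by gcongr
    _ ≤ 100 ^ 2 * 1 * 3 := by norm_num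
    _ ≤ _ := by gcongr

theorem le_toMeasure_real_of_card_compl_le {Ω : Type*} [Fintype Ω] [Nonempty Ω]
    [MeasurableSpace Ω] [MeasurableSingletonClass Ω] {S : Set Ω} {bad : Finset Ω}
    (hS : ∀ ω, ω ∉ bad → ω ∈ S) (hbad : (bad.card : ℝ) ≤ 0.2 * Fintype.card Ω) :
    0.8 ≤ (PMF.uniformOfFintype Ω).toMeasure.real S := by
  classical
  have hc : (0 : ℝ) < Fintype.card Ω := by exact_mod_cast Fintype.card_pos
  have hm : MeasurableSet (↑badᶜ : Set Ω) := (Set.toFinite _).measurableSet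
  have h1 : (PMF.uniformOfFintype Ω).toMeasure.real (↑badᶜ : Set Ω) ≤
      (PMF.uniformOfFintype Ω).toMeasure.real S :=
    measureReal_mono fun ω hω => hS ω (by simpa using hω)
  refine le_trans ?_ h1
  rw [measureReal_def, PMF.toMeasure_uniformOfFintype_apply _ hm, ENNReal.toReal_div,
    ENNReal.toReal_natCast, ENNReal.toReal_natCast, le_div_iff₀ hc]
  have h2 : Fintype.card (↑(↑badᶜ : Set Ω)) = Fintype.card Ω - bad.card := by
    rw [← Finset.card_compl, ← Set.toFinset_card]
    congr 1; ext; simp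
  rw [h2, Nat.cast_sub (Finset.card_le_univ _)]
  linarith

open Classical in
-- A union bound conditional on the first component: `Q` and `R` are controlled only over those `a`
-- where `P` fails.
theorem card_filter_prod_le {α β : Type*} [Fintype α] [Fintype β] {P : α → Prop}
    {Q R : α → β → Prop} {p q s : ℝ} (hq : 0 ≤ q) (hs : 0 ≤ s)
    (hP : ((Finset.univ.filter P).card : ℝ) ≤ Fintype.card α * p)
    (hQ : ∀ a, ¬ P a → ((Finset.univ.filter (Q a)).card : ℝ) ≤ Fintype.card β * q)
    (hR : ∀ a, ¬ P a → ((Finset.univ.filter (R a)).card : ℝ) ≤ Fintype.card β * s) :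
    ((Finset.univ.filter fun x : α × β => P x.1 ∨ Q x.1 x.2 ∨ R x.1 x.2).card : ℝ) ≤
      (p + q + s) * Fintype.card (α × β) := by
  have h1 : ((Finset.univ.filter fun x : α × β => P x.1 ∨ Q x.1 x.2 ∨ R x.1 x.2).card : ℝ) =
      ∑ a, ((Finset.univ.filter fun b => P a ∨ Q a b ∨ R a b).card : ℝ) := by
    simp only [Finset.card_filter]
    push_cast
    rw [Fintype.sum_prod_type]
  have h2 : ∀ a, ((Finset.univ.filter fun b => P a ∨ Q a b ∨ R a b).card : ℝ) ≤
      (if P a then (Fintype.card β : ℝ) else 0) + Fintype.card β * (q + s) := by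
    intro a
    by_cases ha : P a
    · have : ((Finset.univ.filter fun b => P a ∨ Q a b ∨ R a b).card : ℝ) ≤ Fintype.card β := by
        exact_mod_cast Finset.card_le_univ _
      rw [if_pos ha]
      have : 0 ≤ (Fintype.card β : ℝ) * (q + s) := by positivity
      linarith
    · simp only [ha, false_or, if_false, zero_add]
      rw [Finset.filter_or, mul_add]
      refine le_trans ?_ (add_le_add (hQ a ha) (hR a ha))
      exact_mod_cast Finset.card_union_le _ _
  rw [h1]
  refine (Finset.sum_le_sum fun a _ => h2 a).trans ?_
  rw [Finset.sum_add_distrib, ← Finset.sum_filter, Finset.sum_const, Finset.sum_const,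
    nsmul_eq_mul, nsmul_eq_mul, Finset.card_univ, Fintype.card_prod]
  push_cast
  have : ((Finset.univ.filter P).card : ℝ) * Fintype.card β ≤ Fintype.card α * p * Fintype.card β :=
    by gcongr
  linarith

variable {n d : ℕ}

/-- The rank one matrix given by a row of a matrix, scaled so that its mean is the Gram matrix. -/
def rowGram (W : Matrix (Fin n) (Fin d) ℝ) (i : Fin n) : Matrix (Fin d) (Fin d) ℝ :=
  (n : ℝ) • vecMulVec (W i) (W i)

theorem rowGram_quadratic (W : Matrix (Fin n) (Fin d) ℝ) (i : Fin n) (v : Fin d → ℝ) :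
    v ⬝ᵥ (rowGram W i *ᵥ v) = n * (W i ⬝ᵥ v) ^ 2 := by
  have : rowGram W i *ᵥ v = (n * (W i ⬝ᵥ v)) • W i := by
    ext j
    simp only [rowGram, mulVec, dotProduct, Matrix.smul_apply, vecMulVec_apply, Pi.smul_apply,
      smul_eq_mul, Finset.mul_sum, Finset.sum_mul]
    exact Finset.sum_congr rfl fun l _ => by ring
  rw [this, dotProduct_smul, smul_eq_mul, dotProduct_comm v]
  ring

theorem rowGram_isHermitian (W : Matrix (Fin n) (Fin d) ℝ) (i : Fin n) :
    (rowGram W i).IsHermitian := by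
  ext a b
  simp [rowGram, vecMulVec_apply, mul_comm]

theorem rowGram_posSemidef (W : Matrix (Fin n) (Fin d) ℝ) (i : Fin n) :
    (rowGram W i).PosSemidef := by
  refine .of_dotProduct_mulVec_nonneg (rowGram_isHermitian W i) fun v => ?_
  rw [star_trivial, rowGram_quadratic]
  positivity

/-- By Cauchy-Schwarz, the norm of a rank one matrix is the squared length of its row. -/
theorem posSemidef_smul_one_sub_rowGram {W : Matrix (Fin n) (Fin d) ℝ} {M : ℝ} {i : Fin n}
    (hM : n * ∑ j, W i j ^ 2 ≤ M) :
    (M • (1 : Matrix (Fin d) (Fin d) ℝ) - rowGram W i).PosSemidef := by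
  refine .of_dotProduct_mulVec_nonneg ?_ fun v => ?_
  · have : (M • (1 : Matrix (Fin d) (Fin d) ℝ)).IsHermitian := by
      rw [Matrix.IsHermitian, conjTranspose_smul, conjTranspose_one, star_trivial]
    exact this.sub (rowGram_isHermitian W i)
  · rw [star_trivial, sub_mulVec, dotProduct_sub, rowGram_quadratic, smul_mulVec, one_mulVec,
      dotProduct_smul, smul_eq_mul]
    have h1 := dotProduct_sq_le (W i) v
    have h2 : W i ⬝ᵥ W i = ∑ j, W i j ^ 2 := by simp [dotProduct, pow_two]
    have h3 := dotProduct_self_nonneg_real v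
    calc (0 : ℝ) ≤ M * (v ⬝ᵥ v) - n * ((W i ⬝ᵥ W i) * (v ⬝ᵥ v)) := by
          rw [h2]; nlinarith
      _ ≤ _ := by gcongr

theorem sum_rowGram {W : Matrix (Fin n) (Fin d) ℝ} (hW : Wᵀ * W = 1) :
    ∑ i, rowGram W i = (Fintype.card (Fin n) : ℝ) • (1 : Matrix (Fin d) (Fin d) ℝ) := by
  rw [← hW, Fintype.card_fin]
  simp only [rowGram, ← Finset.smul_sum]
  congr 1
  ext a b
  simp [Matrix.sum_apply, vecMulVec_apply, mul_apply]

/-- The quadratic form of `X U` is the sampled sum of `rowGram` divided by `r`, and `(X U)ᵀ X β` is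
the sampled product divided by `r`. So `hq` and `hr` are the two conditions on the sketch. -/
theorem sketched_error_le_of_sampled {k d r : ℕ} {A U : Matrix (Fin (2 ^ k)) (Fin d) ℝ}
    {V : Matrix (Fin d) (Fin d) ℝ} (hUV : IsThinSVD A U V) (hA : A.rank = d)
    (ω : Sample (2 ^ k) r) (hr0 : (0 : ℝ) < r) {b β : Fin (2 ^ k) → ℝ} {ε : ℝ}
    (hβ : β = b - A *ᵥ lsSolution A b)
    {W : Matrix (Fin (2 ^ k)) (Fin d) ℝ} {w : Fin (2 ^ k) → ℝ}
    (hW : W = hadamard k * (diagonal fun l => sgn (ω.1 l)) * U)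
    (hw : w = (hadamard k * (diagonal fun l => sgn (ω.1 l))) *ᵥ β)
    (hq : ∀ v : Fin d → ℝ,
      (r / Real.sqrt 2) * (v ⬝ᵥ v) ≤ v ⬝ᵥ ((∑ t, rowGram W (ω.2 t)) *ᵥ v))
    (hr : ∑ j, (∑ t, (2 ^ k : ℕ) * (w (ω.2 t) * W (ω.2 t) j)) ^ 2 ≤
      r ^ 2 * (ε / 2) * (β ⬝ᵥ β)) :
    (A *ᵥ (sketchedSolution A b ω - lsSolution A b)) ⬝ᵥ
        (A *ᵥ (sketchedSolution A b ω - lsSolution A b)) ≤ ε * (β ⬝ᵥ β) := by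
  have hs2 : Real.sqrt ((2 ^ k : ℕ) / r) * Real.sqrt ((2 ^ k : ℕ) / r) = (2 ^ k : ℕ) / r :=
    Real.mul_self_sqrt (by positivity)
  refine sketched_error_le hUV hA hβ (fun v => ?_) ?_
  · have e : ∀ t, ((sketch ω * U) *ᵥ v) t =
        Real.sqrt ((2 ^ k : ℕ) / r) * (W (ω.2 t) ⬝ᵥ v) := fun t => by
      simp only [mulVec, dotProduct, sketch_mul_apply, Finset.mul_sum, hW]
      exact Finset.sum_congr rfl fun j _ => by ring
    have e2 : ((sketch ω * U) *ᵥ v) ⬝ᵥ ((sketch ω * U) *ᵥ v) =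
        1 / r * (v ⬝ᵥ ((∑ t, rowGram (W) (ω.2 t)) *ᵥ v)) := by
      rw [sum_mulVec, dotProduct_sum, dotProduct, Finset.mul_sum]
      refine Finset.sum_congr rfl fun t _ => ?_
      rw [e, rowGram_quadratic, mul_mul_mul_comm, hs2]
      ring
    rw [e2]
    calc 1 / Real.sqrt 2 * (v ⬝ᵥ v) = 1 / r * (r / Real.sqrt 2 * (v ⬝ᵥ v)) := by field_simp
      _ ≤ _ := by gcongr; exact hq v
  · have e : ∀ j, ((sketch ω * U)ᵀ *ᵥ (sketch ω *ᵥ β)) j =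
        1 / r * ∑ t, (2 ^ k : ℕ) * (w (ω.2 t) * W (ω.2 t) j) := fun j => by
      simp only [mulVec, dotProduct, transpose_apply, sketch_mul_apply]
      rw [Finset.mul_sum]
      refine Finset.sum_congr rfl fun t _ => ?_
      have h3 := sketch_mulVec_apply ω β t
      simp only [mulVec, dotProduct] at h3
      rw [h3, mul_mul_mul_comm, hs2]
      simp only [hW, hw, mulVec, dotProduct]
      ring
    rw [dotProduct]
    simp only [e]
    have e3 : ∑ j, (1 / r * ∑ t, (2 ^ k : ℕ) * (w (ω.2 t) * W (ω.2 t) j)) *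
        (1 / r * ∑ t, (2 ^ k : ℕ) * (w (ω.2 t) * W (ω.2 t) j)) =
        1 / (r : ℝ) ^ 2 * ∑ j, (∑ t, (2 ^ k : ℕ) * (w (ω.2 t) * W (ω.2 t) j)) ^ 2 := by
      rw [Finset.mul_sum]
      refine Finset.sum_congr rfl fun j _ => ?_
      rw [mul_mul_mul_comm, ← pow_two, ← pow_two, div_pow, one_pow]
    rw [e3]
    calc _ ≤ 1 / (r : ℝ) ^ 2 * (r ^ 2 * (ε / 2) * (β ⬝ᵥ β)) := by gcongr
      _ = _ := by field_simp

open Classical in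
theorem le_success_probability (k : ℕ) (hd : 1 ≤ d) {ε : ℝ} (hε : 0 < ε)
    {A : Matrix (Fin (2 ^ k)) (Fin d) ℝ} (b : Fin (2 ^ k) → ℝ) (hA : A.rank = d)
    {S : Set (Sample (2 ^ k) (sampleSize (2 ^ k) d ε))}
    (hS : ∀ ω : Sample (2 ^ k) (sampleSize (2 ^ k) d ε),
      (A *ᵥ (sketchedSolution A b ω - lsSolution A b)) ⬝ᵥ
        (A *ᵥ (sketchedSolution A b ω - lsSolution A b)) ≤
      ε * ((b - A *ᵥ lsSolution A b) ⬝ᵥ (b - A *ᵥ lsSolution A b)) → ω ∈ S) :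
    0.8 ≤ (sampleLaw (2 ^ k) (sampleSize (2 ^ k) d ε)).toMeasure.real S := by
  obtain ⟨U, V, hUV⟩ := exists_isThinSVD hA
  have hn : 0 < 2 ^ k := by positivity
  obtain ⟨hL, hr1, hr2, hl9⟩ := sampleSize_bounds (n := 2 ^ k) (ε := ε) hn hd
  set r := sampleSize (2 ^ k) d ε with hr
  set L := Real.log (40 * (2 ^ k : ℕ) * d) with hLdef
  set l := Real.log (100 ^ 2 * d * L) with hldef
  have hd' : (1 : ℝ) ≤ d := by exact_mod_cast hd
  set β := b - A *ᵥ lsSolution A b with hβ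
  set M := 2 * d * L with hM
  have hM0 : 0 < M := by positivity
  have hr0 : (0 : ℝ) < r := lt_of_lt_of_le (by positivity) hr1
  let HD : (Fin (2 ^ k) → Bool) → Matrix (Fin (2 ^ k)) (Fin (2 ^ k)) ℝ :=
    fun σ => hadamard k * diagonal fun l => sgn (σ l)
  have hHD : ∀ σ, (HD σ)ᵀ * HD σ = 1 := fun σ => by
    simp only [HD]
    rw [transpose_mul, Matrix.mul_assoc, ← Matrix.mul_assoc _ (hadamard k),
      hadamard_transpose_mul_self, Matrix.one_mul, diagonal_transpose, diagonal_sgn_mul_self]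
  let W := fun σ => HD σ * U
  let w := fun σ => HD σ *ᵥ β
  have hWW : ∀ σ, (W σ)ᵀ * W σ = 1 := fun σ => by
    simp only [W]
    rw [transpose_mul, Matrix.mul_assoc, ← Matrix.mul_assoc _ (HD σ), hHD, Matrix.one_mul,
      hUV.orth_left]
  have hWw : ∀ σ, (W σ)ᵀ *ᵥ w σ = 0 := fun σ => by
    simp only [W, w]
    rw [transpose_mul, mulVec_mulVec, Matrix.mul_assoc, hHD, Matrix.mul_one]
    exact hUV.transpose_mulVec_eq_zero hA (transpose_mulVec_residual A b)
  have hww : ∀ σ, w σ ⬝ᵥ w σ = β ⬝ᵥ β := fun σ =>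
    mulVec_dotProduct_self_of_transpose_mul (hHD σ) β
  -- The three failures: `P`, a long row of `H D U`; `Q`, a small eigenvalue of the sampled Gram
  -- matrix; `R`, a large sampled product with the residual. Only the signs enter `P`.
  obtain ⟨P, hPdef⟩ : ∃ P : (Fin (2 ^ k) → Bool) → Prop, ∀ σ, P σ ↔
      ∃ i, 2 * d * L < (2 ^ k : ℕ) * ∑ j, W σ i j ^ 2 := ⟨_, fun _ => Iff.rfl⟩
  obtain ⟨Q, hQdef⟩ : ∃ Q : (Fin (2 ^ k) → Bool) → (Fin r → Fin (2 ^ k)) → Prop, ∀ σ f, Q σ f ↔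
      ¬ ∀ v : Fin d → ℝ, (r / Real.sqrt 2) * (v ⬝ᵥ v) ≤
        v ⬝ᵥ ((∑ t, rowGram (W σ) (f t)) *ᵥ v) := ⟨_, fun _ _ => Iff.rfl⟩
  obtain ⟨R, hRdef⟩ : ∃ R : (Fin (2 ^ k) → Bool) → (Fin r → Fin (2 ^ k)) → Prop, ∀ σ f, R σ f ↔
      r ^ 2 * (ε / 2) * (w σ ⬝ᵥ w σ) <
        ∑ j, (∑ t, (2 ^ k : ℕ) * (w σ (f t) * W σ (f t) j)) ^ 2 := ⟨_, fun _ _ => Iff.rfl⟩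
  have hP : ((Finset.univ.filter P).card : ℝ) ≤ Fintype.card (Fin (2 ^ k) → Bool) * (1 / 20) := by
    have := card_filter_row_norm_gt_le hn hd (hadamard_sq k) hUV.orth_left
    simp only [Fintype.card_fun, Fintype.card_bool, Fintype.card_fin]
    push_cast
    refine le_trans (Nat.cast_le.2 (Finset.card_le_card fun σ hσ => ?_)) this
    simpa only [Finset.mem_filter, hPdef] using hσ
  have hb : ∀ σ, ¬ P σ → ∀ i, (2 ^ k : ℕ) * ∑ j, W σ i j ^ 2 ≤ M := fun σ hσ i => by
    by_contra! hcon
    exact hσ ((hPdef σ).2 ⟨i, hcon⟩)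
  have hQ : ∀ σ, ¬ P σ → ((Finset.univ.filter (Q σ)).card : ℝ) ≤
      Fintype.card (Fin r → Fin (2 ^ k)) * (1 / 20) := fun σ hσ => by
    have h := card_filter_eigenvalue_lt_le hM0 (rowGram_posSemidef (W σ))
      (fun i => posSemidef_smul_one_sub_rowGram (hb σ hσ i)) (sum_rowGram (hWW σ)) r
    refine le_trans (Nat.cast_le.2 (Finset.card_le_card fun f hf => ?_)) (h.trans ?_)
    · simpa only [Finset.mem_filter, hQdef] using hf
    rw [Fintype.card_fun, Fintype.card_fin, Fintype.card_fin, Fintype.card_fin,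
      Nat.cast_pow (2 ^ k) r]
    refine mul_le_mul_of_nonneg_left ?_ (by positivity)
    -- This asks for `r ≥ 50 d L l`, and `r` is at least `48² d L l`. The union over `d` eigenvalues
    -- then costs `d exp (-l) = 1 / (100² L)`.
    have h2 : l ≤ r / M / 25 := by
      rw [div_div, le_div_iff₀ (by positivity)]
      refine le_trans ?_ hr1
      rw [hM]
      have : 0 ≤ d * L * l := by positivity
      nlinarith
    calc (d : ℝ) * Real.exp (-(r / M / 25)) ≤ d * Real.exp (-l) := by gcongr
      _ = d * (100 ^ 2 * d * L)⁻¹ := by rw [Real.exp_neg, hldef, Real.exp_log (by positivity)]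
      _ = 1 / (100 ^ 2 * L) := by field_simp
      _ ≤ 1 / 20 := by gcongr; linarith
  have hR : ∀ σ, ¬ P σ → ((Finset.univ.filter (R σ)).card : ℝ) ≤
      Fintype.card (Fin r → Fin (2 ^ k)) * (1 / 10) := fun σ hσ => by
    have h := card_filter_sampled_product_gt_le (r := r) (a := r ^ 2 * (ε / 2)) hn (hb σ hσ)
      (hWw σ) (by positivity)
    refine le_trans (Nat.cast_le.2 (Finset.card_le_card fun f hf => ?_)) (h.trans ?_)
    · simpa only [Finset.mem_filter, hRdef] using hf
    rw [Fintype.card_fun, Fintype.card_fin, Fintype.card_fin, Nat.cast_pow (2 ^ k) r]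
    refine mul_le_mul_of_nonneg_left ?_ (by positivity)
    -- The failure rate is `r M / (r² ε / 2) = 4 d L / (r ε)`, which is at most `1/10` because `r ≥
    -- 40 d L / ε`.
    rw [div_le_iff₀ hε] at hr2
    rw [div_le_iff₀ (by positivity), hM]
    nlinarith
  have hcard := card_filter_prod_le (by norm_num) (by norm_num) hP hQ hR
  refine le_toMeasure_real_of_card_compl_le
    (bad := Finset.univ.filter fun x : Sample (2 ^ k) r => P x.1 ∨ Q x.1 x.2 ∨ R x.1 x.2)
    (fun ω hω => hS ω ?_) (hcard.trans (le_of_eq ?_))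
  swap
  · rw [show (1 / 20 + 1 / 20 + 1 / 10 : ℝ) = 0.2 by norm_num]
  simp only [Finset.mem_filter, Finset.mem_univ, true_and, not_or] at hω
  obtain ⟨-, hq, hr'⟩ := hω
  rw [hQdef, not_not] at hq
  rw [hRdef, not_lt] at hr'
  rw [hww] at hr'
  exact sketched_error_le_of_sampled hUV hA ω hr0 hβ rfl rfl hq hr'

end Probability


/-! ### Straight-line code -/

/-- The value of an arithmetic operation, with `x / 0 = 0`. -/
def ArithOp.total : ArithOp → ℝ → ℝ → ℝ
  | .add, x, y => x + y
  | .sub, x, y => x - y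
  | .mul, x, y => x * y
  | .div, x, y => x / y

/-- A node of a computation graph: a constant, or an operation on other nodes. -/
inductive Node (ι : Type) : Type
  | const (c : ℝ)
  | op (o : ArithOp) (i j : ι)

namespace Node

variable {ι : Type}

/-- The number of steps that evaluate the node. -/
def cost : Node ι → ℕ
  | const _ => 1
  -- `totalDiv` spends one constant, two comparisons and one division.
  | op .div _ _ => 4
  | op _ _ _ => 1

theorem cost_le (v : Node ι) : v.cost ≤ 4 := by
  rcases v with c | ⟨o, i, j⟩
  · simp [cost]
  · cases o <;> simp [cost]

/-- The value of the node, given the values of the other nodes. -/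
def eval (val : ι → ℝ) : Node ι → ℝ
  | const c => c
  | op o i j => o.total (val i) (val j)

/-- All the nodes that the node depends on have the property `p`. -/
def Sources (p : ι → Prop) : Node ι → Prop
  | const _ => True
  | op _ i j => p i ∧ p j

theorem Sources.mono {p q : ι → Prop} {v : Node ι} (h : v.Sources p) (hpq : ∀ i, p i → q i) :
    v.Sources q := by
  cases v with
  | const c => trivial
  | op o i j => exact ⟨hpq _ h.1, hpq _ h.2⟩

end Node

namespace Program

variable {n d : ℕ}

/-- Division with `x / 0 = 0`. -/
def totalDiv (dst i j : Cell n d) (next : Program n d) : Program n d :=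
  -- The cell `dst` holds `0` during the tests `mem j ≤ 0` and `0 ≤ mem j`. If both succeed it
  -- already contains the value of `x / 0`.
  const dst 0 (ifLE j dst (ifLE dst j next (arith .div dst i j next)) (arith .div dst i j next))

theorem run_totalDiv [NeZero n] {dst i j : Cell n d} (hi : i ≠ dst) (hj : j ≠ dst)
    (next : Program n d) (mem : Cell n d → ℝ) :
    run (totalDiv dst i j next) mem = run next (Function.update mem dst (mem i / mem j)) := by
  have hdiv : mem j ≠ 0 → run (arith .div dst i j next) (Function.update mem dst 0) =
      run next (Function.update mem dst (mem i / mem j)) := fun h => by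
    simp [run, ArithOp.eval, hi, hj, h]
  simp only [totalDiv, run.eq_2, run.eq_4, Function.update_self, Function.update_of_ne hj]
  by_cases h1 : mem j ≤ 0
  · rw [if_pos h1]
    by_cases h2 : 0 ≤ mem j
    · rw [if_pos h2, le_antisymm h1 h2, div_zero]
    · rw [if_neg h2, hdiv (fun h => h2 h.ge)]
  · rw [if_neg h1, hdiv (fun h => h1 h.le)]

/-- The code that evaluates a node of a computation graph. -/
def evalNode {ι : Type} (cell : ι → Cell n d) (dst : Cell n d) (next : Program n d) :
    Node ι → Program n d
  | .const c => const dst c next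
  | .op .div i j => totalDiv dst (cell i) (cell j) next
  | .op o i j => arith o dst (cell i) (cell j) next

theorem steps_evalNode_le {ι : Type} (cell : ι → Cell n d) (dst : Cell n d) (next : Program n d)
    (v : Node ι) : steps (evalNode cell dst next v) ≤ v.cost + steps next := by
  rcases v with c | ⟨o, i, j⟩
  · simp [evalNode, steps, Node.cost, add_comm]
  · cases o <;> (simp [evalNode, steps, Node.cost, totalDiv]; try omega)

theorem run_evalNode [NeZero n] {ι : Type} {cell : ι → Cell n d} {dst : Cell n d} {v : Node ι}
    (hv : v.Sources fun i => cell i ≠ dst) (next : Program n d) (mem : Cell n d → ℝ) :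
    run (evalNode cell dst next v) mem =
      run next (Function.update mem dst (v.eval fun i => mem (cell i))) := by
  rcases v with c | ⟨o, i, j⟩
  · rfl
  · cases o
    · rfl
    · rfl
    · rfl
    · exact run_totalDiv hv.1 hv.2 next mem

/-- The nodes of an acyclic computation graph can be evaluated one after the other. -/
theorem exists_straightLine [NeZero n] {ι T : Type} [LinearOrder T] {cell : ι → Cell n d}
    (hcell : Function.Injective cell) (node : ι → Node ι) (τ : ι → T) (inp : Set ι)
    (V : Finset ι)
    (hV : ∀ a ∈ V, (node a).Sources fun s => (s ∈ inp ∨ s ∈ V) ∧ τ s < τ a) :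
    ∃ F : Program n d → Program n d,
      (∀ P, steps (F P) ≤ ∑ a ∈ V, (node a).cost + steps P) ∧
      ∀ val : ι → ℝ, (∀ a ∈ V, val a = (node a).eval val) →
        ∀ mem : Cell n d → ℝ, (∀ a ∈ inp, mem (cell a) = val a) →
          ∃ mem' : Cell n d → ℝ, (∀ a, a ∈ inp ∨ a ∈ V → mem' (cell a) = val a) ∧
            ∀ P, run (F P) mem = run P mem' := by
  classical
  -- The node of largest `τ` is evaluated last. `F` takes the rest of the program as an argument, so
  -- this node's code becomes the continuation of the code for the others.
  induction V using Finset.induction_on_max_value τ with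
  | empty =>
    refine ⟨id, fun P => by simp, fun val _ mem hmem => ⟨mem, fun a ha => ?_, fun P => rfl⟩⟩
    exact hmem a (by simpa using ha)
  | insert a V ha hmax ih =>
    obtain ⟨F, hF, hrun⟩ := ih fun b hb => (hV b (Finset.mem_insert_of_mem hb)).mono
      fun s hs => ⟨hs.1.imp_right fun h => (Finset.mem_insert.1 h).resolve_left
        fun e => absurd (hmax b hb) (not_le.2 (by rw [← e]; exact hs.2)), hs.2⟩
    refine ⟨fun P => F (evalNode cell (cell a) P (node a)), fun P => ?_,
      fun val hval mem hmem => ?_⟩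
    · rw [Finset.sum_insert ha]
      have h1 := hF (evalNode cell (cell a) P (node a))
      have h2 := steps_evalNode_le cell (cell a) P (node a)
      show steps (F (evalNode cell (cell a) P (node a))) ≤ _
      omega
    · obtain ⟨mem', hmem', hrun'⟩ :=
        hrun val (fun b hb => hval b (Finset.mem_insert_of_mem hb)) mem hmem
      have hsrc := hV a (Finset.mem_insert_self a V)
      -- Sources have strictly smaller `τ`, so the node never overwrites a cell that it reads.
      have hne : (node a).Sources fun i => cell i ≠ cell a := hsrc.mono fun s hs h =>
        absurd hs.2 (by rw [hcell h]; exact lt_irrefl _)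
      have heval : (node a).eval (fun i => mem' (cell i)) = val a := by
        rw [hval a (Finset.mem_insert_self a V)]
        have h3 : (node a).Sources fun i => mem' (cell i) = val i := hsrc.mono fun s hs =>
          hmem' s (hs.1.imp_right fun h => (Finset.mem_insert.1 h).resolve_left
            fun e => absurd hs.2 (by rw [e]; exact lt_irrefl _))
        revert h3
        cases node a with
        | const c => exact fun _ => rfl
        | op o i j => exact fun h => by simp only [Node.eval, h.1, h.2]
      refine ⟨Function.update mem' (cell a) (val a), fun b hb => ?_, fun P => ?_⟩
      · by_cases hba : b = a
        · rw [hba, Function.update_self]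
        · rw [Function.update_of_ne (fun h => hba (hcell h))]
          exact hmem' b (hb.imp_right fun h => (Finset.mem_insert.1 h).resolve_left hba)
      · rw [hrun', run_evalNode hne, heval]

/-! ### Random bits and indices -/

/-- Toss `m` coins. -/
def coins : (m : ℕ) → ((Fin m → Bool) → Program n d) → Program n d
  | 0, f => f Fin.elim0
  | m + 1, f => coin fun c => coins m fun σ => f (Fin.cons c σ)

/-- Draw `r` indices. -/
def draws : (r : ℕ) → ((Fin r → Fin n) → Program n d) → Program n d
  | 0, f => f Fin.elim0
  | r + 1, f => draw fun i => draws r fun g => f (Fin.cons i g)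

theorem steps_coins_le {c : ℕ} (m : ℕ) (f : (Fin m → Bool) → Program n d)
    (hf : ∀ σ, steps (f σ) ≤ c) : steps (coins m f) ≤ m + c := by
  induction m with
  | zero => simpa [coins] using hf _
  | succ m ih =>
    have h1 := ih (fun σ => f (Fin.cons true σ)) fun σ => hf _
    have h2 := ih (fun σ => f (Fin.cons false σ)) fun σ => hf _
    simp only [coins, steps]
    omega

theorem steps_draws_le {c : ℕ} (r : ℕ) (f : (Fin r → Fin n) → Program n d)
    (hf : ∀ g, steps (f g) ≤ c) : steps (draws r f) ≤ r + c := by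
  induction r with
  | zero => simpa [draws] using hf _
  | succ r ih =>
    simp only [draws, steps]
    have : (Finset.univ.sup fun i => steps (draws r fun g => f (Fin.cons i g))) ≤ r + c :=
      Finset.sup_le fun i _ => ih _ fun g => hf _
    omega

theorem uniformOfFintype_prod_bind {α β γ : Type*} [Fintype α] [Fintype β] [Nonempty α]
    [Nonempty β] (f : α × β → PMF γ) :
    (PMF.uniformOfFintype (α × β)).bind f =
      (PMF.uniformOfFintype α).bind fun a => (PMF.uniformOfFintype β).bind fun b => f (a, b) := by
  ext c
  simp only [PMF.bind_apply, PMF.uniformOfFintype_apply, tsum_fintype, Fintype.sum_prod_type,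
    Finset.mul_sum, Fintype.card_prod, Nat.cast_mul]
  refine Finset.sum_congr rfl fun a _ => Finset.sum_congr rfl fun b _ => ?_
  rw [← mul_assoc, ENNReal.mul_inv (Or.inr (ENNReal.natCast_ne_top _))
    (Or.inl (ENNReal.natCast_ne_top _))]

theorem uniformOfFintype_bind_equiv {α β γ : Type*} [Fintype α] [Fintype β] [Nonempty α]
    [Nonempty β] (e : α ≃ β) (f : β → PMF γ) :
    (PMF.uniformOfFintype β).bind f = (PMF.uniformOfFintype α).bind fun a => f (e a) := by
  ext c
  simp only [PMF.bind_apply, PMF.uniformOfFintype_apply, tsum_fintype, Fintype.card_congr e]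
  exact (e.sum_comp fun b => _ * f b c).symm

theorem uniformOfFintype_cons_bind {α γ : Type*} [Fintype α] [Nonempty α] {m : ℕ}
    (f : (Fin (m + 1) → α) → PMF γ) :
    (PMF.uniformOfFintype (Fin (m + 1) → α)).bind f =
      (PMF.uniformOfFintype α).bind fun a =>
        (PMF.uniformOfFintype (Fin m → α)).bind fun g => f (Fin.cons a g) := by
  rw [uniformOfFintype_bind_equiv (Fin.consEquiv fun _ => α), uniformOfFintype_prod_bind]
  rfl

theorem uniformOfFintype_elim0_bind {α γ : Type*} [Fintype α] [Nonempty α]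
    (f : (Fin 0 → α) → PMF γ) :
    (PMF.uniformOfFintype (Fin 0 → α)).bind f = f Fin.elim0 := by
  ext c
  simp [PMF.bind_apply, tsum_fintype, Subsingleton.elim (default : Fin 0 → α) Fin.elim0]

theorem run_coins [NeZero n] (m : ℕ) (f : (Fin m → Bool) → Program n d) (mem : Cell n d → ℝ) :
    run (coins m f) mem = (PMF.uniformOfFintype (Fin m → Bool)).bind fun σ => run (f σ) mem := by
  induction m with
  | zero => rw [uniformOfFintype_elim0_bind]; rfl
  | succ m ih =>
    rw [uniformOfFintype_cons_bind]
    simp only [coins, run, ih]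

theorem run_draws [NeZero n] (r : ℕ) (f : (Fin r → Fin n) → Program n d) (mem : Cell n d → ℝ) :
    run (draws r f) mem = (PMF.uniformOfFintype (Fin r → Fin n)).bind fun g => run (f g) mem := by
  induction r with
  | zero => rw [uniformOfFintype_elim0_bind]; rfl
  | succ r ih =>
    rw [uniformOfFintype_cons_bind]
    simp only [draws, run, ih]

/-- A deterministic computation for each outcome of the random choices gives a program. -/
theorem exists_program_of_forall_sample [NeZero n] {r c : ℕ}
    {f : (Cell n d → ℝ) → Sample n r → Fin d → ℝ} {inputs : Set (Cell n d → ℝ)}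
    (h : ∀ ω, ∃ P : Program n d, steps P ≤ c ∧
      ∀ mem ∈ inputs, run P mem = PMF.pure (some (f mem ω))) :
    ∃ T : Program n d, steps T ≤ n + (r + c) ∧
      ∀ mem ∈ inputs, run T mem = (sampleLaw n r).map fun ω => some (f mem ω) := by
  choose P hP hrun using h
  -- The tree branches on the random outcomes, so signs and indices select the code and are never
  -- stored in memory.
  refine ⟨coins n fun σ => draws r fun g => P (σ, g),
    steps_coins_le _ _ fun σ => steps_draws_le _ _ fun g => hP _, fun mem hmem => ?_⟩
  rw [run_coins, sampleLaw, ← PMF.bind_pure_comp, uniformOfFintype_prod_bind]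
  simp only [run_draws, hrun _ _ hmem]
  rfl

end Program


/-! ### The fast Walsh-Hadamard transform -/

section Walsh

/-- The sign that the bit `b` of `i` and `j` contributes to an entry of the Hadamard matrix. -/
def bitSign (i j b : ℕ) : ℝ := if i.testBit b = true ∧ j.testBit b = true then -1 else 1

/-- The indicator of the event that `i` and `j` agree in the bit `b`. -/
def bitEq (i j b : ℕ) : ℝ := if i.testBit b = j.testBit b then 1 else 0

theorem halves_inl_val (k : ℕ) (i : Fin (2 ^ k)) : (halves k (Sum.inl i) : ℕ) = i := by
  simp [halves]

theorem halves_inr_val (k : ℕ) (i : Fin (2 ^ k)) : (halves k (Sum.inr i) : ℕ) = 2 ^ k + i := by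
  simp [halves, add_comm]

/-- The Hadamard matrix is a tensor power, with one factor for each bit; the recursion splits off
the highest bit. -/
theorem hadamardPM_eq_prod (k : ℕ) (i j : Fin (2 ^ k)) :
    hadamardPM k i j = ∏ b ∈ Finset.range k, bitSign i j b := by
  induction k with
  | zero => simp [hadamardPM]
  | succ k ih =>
    have hlow : ∀ (x : Fin (2 ^ k)), (x : ℕ).testBit k = false := fun x =>
      Nat.testBit_lt_two_pow x.2
    have hhigh : ∀ (x : Fin (2 ^ k)), (2 ^ k + (x : ℕ)).testBit k = true := fun x => by
      rw [Nat.testBit_two_pow_add_eq, hlow]; rfl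
    have hrest : ∀ (x : Fin (2 ^ k)) b, b < k → (2 ^ k + (x : ℕ)).testBit b = (x : ℕ).testBit b :=
      fun x b hb => Nat.testBit_two_pow_add_gt hb _
    have e1 : ∀ (x : Fin (2 ^ k)) (y : ℕ), ∏ b ∈ Finset.range k, bitSign (2 ^ k + x) y b =
        ∏ b ∈ Finset.range k, bitSign x y b := fun x y => Finset.prod_congr rfl fun b hb => by
      simp only [bitSign, hrest _ b (Finset.mem_range.1 hb)]
    have e2 : ∀ (x : ℕ) (y : Fin (2 ^ k)), ∏ b ∈ Finset.range k, bitSign x (2 ^ k + y) b =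
        ∏ b ∈ Finset.range k, bitSign x y b := fun x y => Finset.prod_congr rfl fun b hb => by
      simp only [bitSign, hrest _ b (Finset.mem_range.1 hb)]
    obtain ⟨i, rfl⟩ := (halves k).surjective i
    obtain ⟨j, rfl⟩ := (halves k).surjective j
    rw [Finset.prod_range_succ]
    rcases i with i | i <;> rcases j with j | j <;>
      simp only [hadamardPM, reindex_apply, submatrix_apply, Equiv.symm_apply_apply,
        fromBlocks_apply₁₁, fromBlocks_apply₁₂, fromBlocks_apply₂₁, fromBlocks_apply₂₂,
        Matrix.neg_apply, halves_inl_val, halves_inr_val, ih, e1, e2]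
    all_goals
      generalize ∏ b ∈ Finset.range k, bitSign i j b = p
      simp [bitSign, hlow, hhigh]

/-- The coefficients of the fast Walsh-Hadamard transform after `l` of its `k` levels. -/
def walshCoeff (k l i j : ℕ) : ℝ :=
  ∏ b ∈ Finset.range k, if b < l then bitSign i j b else bitEq i j b

theorem walshCoeff_zero {k i j : ℕ} (hi : i < 2 ^ k) (hj : j < 2 ^ k) :
    walshCoeff k 0 i j = if i = j then 1 else 0 := by
  by_cases h : i = j
  · simp [walshCoeff, h, bitEq]
  · rw [if_neg h]
    obtain ⟨b, hb⟩ : ∃ b, i.testBit b ≠ j.testBit b := by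
      by_contra! hcon
      exact h (Nat.eq_of_testBit_eq hcon)
    have hbk : b < k := by
      by_contra! hkb
      have hp : 2 ^ k ≤ 2 ^ b := Nat.pow_le_pow_right (by norm_num) hkb
      rw [Nat.testBit_lt_two_pow (hi.trans_le hp), Nat.testBit_lt_two_pow (hj.trans_le hp)] at hb
      exact hb rfl
    exact Finset.prod_eq_zero (Finset.mem_range.2 hbk) (by simp [bitEq, hb])

theorem walshCoeff_self (k : ℕ) (i j : Fin (2 ^ k)) : walshCoeff k k i j = hadamardPM k i j := by
  rw [hadamardPM_eq_prod]
  exact Finset.prod_congr rfl fun b hb => if_pos (Finset.mem_range.1 hb)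

theorem testBit_xor_two_pow (i l b : ℕ) :
    (i ^^^ 2 ^ l).testBit b = if b = l then !i.testBit b else i.testBit b := by
  rw [Nat.testBit_xor, Nat.testBit_two_pow]
  by_cases h : l = b
  · simp [h]
  · simp [h, Ne.symm h]

/-- One butterfly: level `l` replaces the identity factor at bit `l` by a `2 × 2` Hadamard factor
and leaves the other bits alone. -/
theorem walshCoeff_succ {k l : ℕ} (hl : l < k) (i j : ℕ) :
    walshCoeff k (l + 1) i j =
      if i.testBit l then walshCoeff k l (i ^^^ 2 ^ l) j - walshCoeff k l i j
      else walshCoeff k l i j + walshCoeff k l (i ^^^ 2 ^ l) j := by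
  have hm := Finset.mem_range.2 hl
  simp only [walshCoeff]
  rw [← Finset.mul_prod_erase _ _ hm, ← Finset.mul_prod_erase _ _ hm,
    ← Finset.mul_prod_erase _ _ hm]
  have h1 : ∏ b ∈ (Finset.range k).erase l, (if b < l + 1 then bitSign i j b else bitEq i j b) =
      ∏ b ∈ (Finset.range k).erase l, (if b < l then bitSign i j b else bitEq i j b) := by
    refine Finset.prod_congr rfl fun b hb => ?_
    have : b ≠ l := Finset.ne_of_mem_erase hb
    by_cases hbl : b < l
    · rw [if_pos hbl, if_pos (by omega)]
    · rw [if_neg hbl, if_neg (by omega)]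
  have h2 : ∏ b ∈ (Finset.range k).erase l,
        (if b < l then bitSign (i ^^^ 2 ^ l) j b else bitEq (i ^^^ 2 ^ l) j b) =
      ∏ b ∈ (Finset.range k).erase l, (if b < l then bitSign i j b else bitEq i j b) := by
    refine Finset.prod_congr rfl fun b hb => ?_
    have : b ≠ l := Finset.ne_of_mem_erase hb
    simp only [bitSign, bitEq, testBit_xor_two_pow, if_neg this]
  rw [h1, h2]
  generalize ∏ b ∈ (Finset.range k).erase l, (if b < l then bitSign i j b else bitEq i j b) = p
  simp only [lt_add_iff_pos_right, Nat.lt_one_iff, pos_of_gt, lt_self_iff_false, if_true, if_false,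
    bitSign, bitEq, testBit_xor_two_pow]
  cases i.testBit l <;> cases j.testBit l <;> simp

/-- The value of the fast Walsh-Hadamard transform of `x` after `l` levels. -/
def walsh (k l : ℕ) (x : Fin (2 ^ k) → ℝ) (i : ℕ) : ℝ := ∑ j : Fin (2 ^ k), walshCoeff k l i j * x j

theorem walsh_zero {k : ℕ} (x : Fin (2 ^ k) → ℝ) (i : Fin (2 ^ k)) : walsh k 0 x i = x i := by
  simp only [walsh, walshCoeff_zero i.2 (Fin.is_lt _), Fin.val_inj]
  simp

theorem walsh_self {k : ℕ} (x : Fin (2 ^ k) → ℝ) (i : Fin (2 ^ k)) :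
    walsh k k x i = (hadamardPM k *ᵥ x) i := by
  simp only [walsh, walshCoeff_self]
  rfl

theorem walsh_succ {k l : ℕ} (hl : l < k) (x : Fin (2 ^ k) → ℝ) (i : ℕ) :
    walsh k (l + 1) x i =
      if i.testBit l then walsh k l x (i ^^^ 2 ^ l) - walsh k l x i
      else walsh k l x i + walsh k l x (i ^^^ 2 ^ l) := by
  simp only [walsh, walshCoeff_succ hl]
  split_ifs
  · rw [← Finset.sum_sub_distrib]
    exact Finset.sum_congr rfl fun j _ => by ring
  · rw [← Finset.sum_add_distrib]
    exact Finset.sum_congr rfl fun j _ => by ring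

/-- The rows that have to be computed at the level `l`, for the sampled rows `g`. -/
def walshRows (k : ℕ) {r : ℕ} (g : Fin r → Fin (2 ^ k)) (l : ℕ) : Finset (Fin (2 ^ k)) :=
  Finset.univ.filter fun i => ∃ t, (i : ℕ) % 2 ^ l = (g t : ℕ) % 2 ^ l

theorem mem_walshRows {k r : ℕ} {g : Fin r → Fin (2 ^ k)} {l : ℕ} {i : Fin (2 ^ k)} :
    i ∈ walshRows k g l ↔ ∃ t, (i : ℕ) % 2 ^ l = (g t : ℕ) % 2 ^ l := by
  simp [walshRows]

/-- Flip the bit `l` of the index `i`. -/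
def flipBit {k : ℕ} (l : ℕ) (i : Fin (2 ^ k)) : Fin (2 ^ k) :=
  if h : l < k then
    ⟨(i : ℕ) ^^^ 2 ^ l, Nat.xor_lt_two_pow i.2 (Nat.pow_lt_pow_right (by norm_num) h)⟩
  else i

theorem flipBit_val {k l : ℕ} (h : l < k) (i : Fin (2 ^ k)) :
    (flipBit l i : ℕ) = (i : ℕ) ^^^ 2 ^ l := by
  rw [flipBit, dif_pos h]

theorem mod_two_pow_of_mod_two_pow_succ {a b l : ℕ} (h : a % 2 ^ (l + 1) = b % 2 ^ (l + 1)) :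
    a % 2 ^ l = b % 2 ^ l := by
  have h2 := congrArg (· % 2 ^ l) h
  simpa [Nat.mod_mod_of_dvd _ (pow_dvd_pow 2 (Nat.le_succ l))] using h2

theorem mem_walshRows_of_succ {k r : ℕ} {g : Fin r → Fin (2 ^ k)} {l : ℕ} {i : Fin (2 ^ k)}
    (h : i ∈ walshRows k g (l + 1)) : i ∈ walshRows k g l := by
  rw [mem_walshRows] at h ⊢
  obtain ⟨t, ht⟩ := h
  exact ⟨t, mod_two_pow_of_mod_two_pow_succ ht⟩

/-- Membership at level `l` looks only at the bits below `l`, which the flip does not touch. So the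
sets `walshRows` are closed under the dependencies of the butterflies. -/
theorem flipBit_mem_walshRows {k r : ℕ} {g : Fin r → Fin (2 ^ k)} {l : ℕ} {i : Fin (2 ^ k)}
    (h : i ∈ walshRows k g (l + 1)) : flipBit l i ∈ walshRows k g l := by
  have h1 := mem_walshRows_of_succ h
  rw [mem_walshRows] at h1 ⊢
  obtain ⟨t, ht⟩ := h1
  refine ⟨t, ?_⟩
  rw [← ht]
  by_cases hl : l < k
  · rw [flipBit_val hl]
    refine Nat.eq_of_testBit_eq fun b => ?_
    rw [Nat.testBit_mod_two_pow, Nat.testBit_mod_two_pow, testBit_xor_two_pow]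
    by_cases hb : b < l
    · rw [if_neg (by omega)]
    · simp [hb]
  · rw [flipBit, dif_neg hl]

theorem self_mem_walshRows {k r : ℕ} (g : Fin r → Fin (2 ^ k)) (l : ℕ) (t : Fin r) :
    g t ∈ walshRows k g l := mem_walshRows.2 ⟨t, rfl⟩

/-- For each sample the low `l` bits are prescribed and the `k - l` high bits are free. -/
theorem card_walshRows_le {k r : ℕ} (g : Fin r → Fin (2 ^ k)) {l : ℕ} (hl : l ≤ k) :
    (walshRows k g l).card ≤ r * 2 ^ (k - l) := by
  have hsub : walshRows k g l ⊆ (Finset.univ : Finset (Fin r)).biUnion fun t =>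
      Finset.univ.filter fun i : Fin (2 ^ k) => (i : ℕ) % 2 ^ l = (g t : ℕ) % 2 ^ l := by
    intro i hi
    simpa [mem_walshRows] using hi
  refine (Finset.card_le_card hsub).trans ((Finset.card_biUnion_le_card_mul _ _ (2 ^ (k - l))
    fun t _ => ?_).trans (by simp))
  rw [← Finset.card_range (2 ^ (k - l))]
  refine Finset.card_le_card_of_injOn (fun i => (i : ℕ) / 2 ^ l) (fun i _ => ?_) ?_
  · simp only [Finset.coe_range, Set.mem_Iio]
    rw [Nat.div_lt_iff_lt_mul (by positivity), ← pow_add, Nat.sub_add_cancel hl]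
    exact i.2
  · intro i hi j hj hij
    simp only [Finset.coe_filter, Finset.mem_univ, true_and, Set.mem_ofPred_eq] at hi hj hij
    ext
    rw [← Nat.div_add_mod (i : ℕ) (2 ^ l), ← Nat.div_add_mod (j : ℕ) (2 ^ l), hij, hi, hj]

/-- The first `m` levels cost at most `2 ^ k` rows each; afterwards the bound `r 2 ^ (k - l)` decays
geometrically and adds at most one more `2 ^ k`. -/
theorem sum_card_walshRows_le {k r m : ℕ} (g : Fin r → Fin (2 ^ k)) (hr : r ≤ 2 ^ m) :
    (∑ l ∈ Finset.range k, (walshRows k g (l + 1)).card : ℝ) ≤ 2 ^ k * (m + 1) := by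
  have hterm : ∀ l ∈ Finset.range k, ((walshRows k g (l + 1)).card : ℝ) ≤
      2 ^ k * if l < m then 1 else (2 ^ m / 2 ^ (l + 1) : ℝ) := by
    intro l hl
    split_ifs
    · have := Finset.card_le_univ (walshRows k g (l + 1))
      rw [Fintype.card_fin] at this
      rw [mul_one]
      exact_mod_cast this
    · have hlk : l + 1 ≤ k := Finset.mem_range.1 hl
      have h1 := (card_walshRows_le g hlk).trans (Nat.mul_le_mul_right _ hr)
      have h2 : (2 ^ k : ℝ) = 2 ^ (k - (l + 1)) * 2 ^ (l + 1) := by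
        rw [← pow_add, Nat.sub_add_cancel hlk]
      calc ((walshRows k g (l + 1)).card : ℝ) ≤ 2 ^ m * 2 ^ (k - (l + 1)) := by exact_mod_cast h1
        _ = _ := by rw [h2]; field_simp
  refine (Finset.sum_le_sum hterm).trans ?_
  rw [← Finset.mul_sum]
  gcongr
  -- The partial sums in closed form; the subtracted geometric tail is what makes the induction
  -- close.
  have hsum : ∀ k : ℕ, (∑ l ∈ Finset.range k, if l < m then 1 else (2 ^ m / 2 ^ (l + 1) : ℝ)) ≤
      if k ≤ m then (k : ℝ) else m + 1 - 2 ^ m / 2 ^ k := by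
    intro k
    induction k with
    | zero => simp
    | succ k ih =>
      rw [Finset.sum_range_succ]
      rcases lt_trichotomy k m with h | h | h
      · rw [if_pos h.le] at ih
        rw [if_pos h, if_pos (show k + 1 ≤ m from h)]
        push_cast
        linarith
      · subst h
        rw [if_pos le_rfl] at ih
        rw [if_neg (lt_irrefl _), if_neg (show ¬ k + 1 ≤ k by omega)]
        have : (2 ^ k / 2 ^ (k + 1) : ℝ) = 1 / 2 := by rw [pow_succ]; field_simp
        rw [this]
        linarith
      · rw [if_neg (show ¬ k ≤ m by omega)] at ih
        rw [if_neg (show ¬ k < m by omega), if_neg (show ¬ k + 1 ≤ m by omega)]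
        have : (2 ^ m / 2 ^ k : ℝ) = 2 * (2 ^ m / 2 ^ (k + 1)) := by rw [pow_succ 2 k]; field_simp
        linarith
  refine (hsum k).trans ?_
  split_ifs with h
  · have : (k : ℝ) ≤ m := by exact_mod_cast h
    linarith
  · have : (0 : ℝ) ≤ 2 ^ m / 2 ^ k := by positivity
    linarith

end Walsh


/-! ### Orthogonalization with respect to the first coordinates -/

section GramSchmidt

/-- The bilinear form that takes the first `s` coordinates into account. -/
def form (s : ℕ) (x y : ℕ → ℝ) : ℝ := ∑ u ∈ Finset.range s, x u * y u

theorem form_comm (s : ℕ) (x y : ℕ → ℝ) : form s x y = form s y x :=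
  Finset.sum_congr rfl fun _ _ => mul_comm _ _

theorem form_sub_mul (s : ℕ) (x y z : ℕ → ℝ) (c : ℝ) :
    form s x (fun t => y t - c * z t) = form s x y - c * form s x z := by
  simp only [form, Finset.mul_sum, ← Finset.sum_sub_distrib]
  exact Finset.sum_congr rfl fun _ _ => by ring

theorem form_sum (s m : ℕ) (x : ℕ → ℝ) (c : ℕ → ℝ) (y : ℕ → ℕ → ℝ) :
    form s x (fun t => ∑ i ∈ Finset.range m, c i * y i t) =
      ∑ i ∈ Finset.range m, c i * form s x (y i) := by
  simp only [form, Finset.mul_sum]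
  rw [Finset.sum_comm]
  exact Finset.sum_congr rfl fun _ _ => Finset.sum_congr rfl fun _ _ => by ring

theorem eq_zero_of_form_self {s : ℕ} {x : ℕ → ℝ} (h : form s x x = 0) {t : ℕ} (ht : t < s) :
    x t = 0 :=
  mul_self_eq_zero.1 ((Finset.sum_eq_zero_iff_of_nonneg fun _ _ => mul_self_nonneg _).1 h t
    (Finset.mem_range.2 ht))

/-- The vector `v j` after the subtraction of its components along the first `i` vectors of the
orthogonalized family `fun i => gsPart v s i i`. -/
def gsPart (v : ℕ → ℕ → ℝ) (s : ℕ) : ℕ → ℕ → ℕ → ℝ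
  | 0, j, t => v j t
  -- The denominator equals the squared length of the `i`-th orthogonalized vector. If it vanishes,
  -- `x / 0 = 0` skips the subtraction, which is right because that vector is zero on the first `s`
  -- coordinates. Coordinates from `s` on follow the same operations but do not affect the
  -- coefficients.
  | i + 1, j, t => gsPart v s i j t -
      form s (gsPart v s i i) (v j) / form s (gsPart v s i i) (v i) * gsPart v s i i t

/-- The orthogonalized family. -/
def gsVec (v : ℕ → ℕ → ℝ) (s i : ℕ) : ℕ → ℝ := gsPart v s i i

/-- The coefficient of `v j` along the `i`-th vector of the orthogonalized family. -/
def gsCoef (v : ℕ → ℕ → ℝ) (s i j : ℕ) : ℝ :=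
  form s (gsVec v s i) (v j) / form s (gsVec v s i) (v i)

variable {v : ℕ → ℕ → ℝ} {s : ℕ}

theorem gsPart_succ (i j : ℕ) :
    gsPart v s (i + 1) j = fun t => gsPart v s i j t - gsCoef v s i j * gsVec v s i t := rfl

theorem gsPart_eq (i j t : ℕ) :
    gsPart v s i j t = v j t - ∑ l ∈ Finset.range i, gsCoef v s l j * gsVec v s l t := by
  induction i with
  | zero => simp [gsPart]
  | succ i ih =>
    rw [gsPart_succ, Finset.sum_range_succ]
    simp only [ih]
    ring

/-- Written with `-` and `(-1) *` to match `form_sub_mul`. -/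
theorem eq_gsVec_add (j : ℕ) :
    v j = fun t => gsVec v s j t -
      (-1) * ∑ l ∈ Finset.range j, gsCoef v s l j * gsVec v s l t := by
  funext t
  rw [gsVec, gsPart_eq]
  ring

theorem form_gsVec_gsPart {i l : ℕ} (hl : l < i) (j : ℕ) :
    form s (gsVec v s l) (gsPart v s i j) = 0 := by
  induction i generalizing l j with
  | zero => omega
  | succ i ih =>
    rw [gsPart_succ, form_sub_mul]
    rcases Nat.lt_succ_iff_lt_or_eq.1 hl with h | h
    · rw [ih h, gsVec, gsVec, ← gsVec, ih h]
      ring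
    · subst h
      have h1 : ∀ j, form s (gsVec v s l) (gsPart v s l j) = form s (gsVec v s l) (v j) := by
        intro j
        have e : gsPart v s l j = fun t => v j t - 1 *
            ∑ l' ∈ Finset.range l, gsCoef v s l' j * gsVec v s l' t := by
          funext t; rw [gsPart_eq, one_mul]
        rw [e, form_sub_mul, form_sum, Finset.sum_eq_zero fun l' hl' => ?_]
        · ring
        · rw [form_comm, gsVec.eq_def v s l, ih (Finset.mem_range.1 hl'), mul_zero]
      have h2 := h1 l
      rw [← gsVec] at h2
      rw [h1, h2, gsCoef]
      by_cases h0 : form s (gsVec v s l) (v l) = 0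
      · rw [h0] at h2
        have : form s (gsVec v s l) (v j) = 0 :=
          Finset.sum_eq_zero fun u hu => by
            rw [eq_zero_of_form_self h2 (Finset.mem_range.1 hu), zero_mul]
        rw [h0, this]
        ring
      · field_simp
        ring

theorem form_gsVec_gsVec {i l : ℕ} (h : l ≠ i) : form s (gsVec v s l) (gsVec v s i) = 0 := by
  rcases Nat.lt_or_gt_of_ne h with h | h
  · exact form_gsVec_gsPart h i
  · rw [form_comm]; exact form_gsVec_gsPart h l

theorem form_gsVec_of_le {i j : ℕ} (h : j ≤ i) :
    form s (gsVec v s i) (v j) = form s (gsVec v s i) (gsVec v s j) := by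
  rw [eq_gsVec_add (v := v) (s := s) j, form_sub_mul, form_sum, Finset.sum_eq_zero fun l hl => ?_]
  · ring
  · rw [form_gsVec_gsVec (by have := Finset.mem_range.1 hl; omega), mul_zero]

/-- The diagonal coefficient is `1`, or `0` where the vector itself vanishes on the first `s`
coordinates. -/
theorem gsCoef_self_mul {i t : ℕ} (ht : t < s) :
    gsCoef v s i i * gsVec v s i t = gsVec v s i t := by
  by_cases h0 : form s (gsVec v s i) (v i) = 0
  · rw [form_gsVec_of_le le_rfl] at h0
    rw [eq_zero_of_form_self h0 ht, mul_zero]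
  · rw [gsCoef, div_self h0, one_mul]

theorem gsCoef_of_lt {i j : ℕ} (h : j < i) : gsCoef v s i j = 0 := by
  rw [gsCoef, form_gsVec_of_le h.le, form_gsVec_gsVec h.ne', zero_div]

/-- The QR factorization, valid for every rank; the coefficients below the diagonal vanish. -/
theorem sum_gsCoef_mul_gsVec {d j t : ℕ} (hj : j < d) (ht : t < s) :
    ∑ i ∈ Finset.range d, gsCoef v s i j * gsVec v s i t = v j t := by
  have hsub : Finset.range (j + 1) ⊆ Finset.range d := Finset.range_mono hj
  rw [← Finset.sum_subset hsub fun i _ hi => by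
    rw [gsCoef_of_lt (by have := Finset.mem_range.not.1 hi; omega), zero_mul],
    Finset.sum_range_succ, gsCoef_self_mul ht]
  have := gsPart_eq (v := v) (s := s) j j t
  rw [← gsVec] at this
  rw [this]
  ring

theorem form_gsPart_eq_zero {d i j : ℕ} {e : ℕ → ℝ} (he : ∀ j < d, form s (v j) e = 0)
    (hi : i ≤ d) (hj : j < d) : form s (gsPart v s i j) e = 0 := by
  induction i generalizing j with
  | zero => exact he j hj
  | succ i ih =>
    rw [form_comm, gsPart_succ, form_sub_mul, form_comm, ih (by omega) hj, form_comm, gsVec,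
      ih (by omega) hi]
    ring

theorem exists_sum_gsVec_eq (m : ℕ) (g : ℕ → ℝ) :
    ∃ w : ℕ → ℝ, ∀ t, ∑ i ∈ Finset.range m, g i * v i t =
      ∑ i ∈ Finset.range m, w i * gsVec v s i t := by
  induction m with
  | zero => exact ⟨0, fun t => by simp⟩
  | succ m ih =>
    obtain ⟨w, hw⟩ := ih
    refine ⟨fun i => if i < m then w i + g m * gsCoef v s i m else g m, fun t => ?_⟩
    simp only [Finset.sum_range_succ, hw, lt_irrefl, if_false]
    have h1 : ∑ i ∈ Finset.range m,
        (if i < m then w i + g m * gsCoef v s i m else g m) * gsVec v s i t =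
        ∑ i ∈ Finset.range m, w i * gsVec v s i t +
          g m * ∑ i ∈ Finset.range m, gsCoef v s i m * gsVec v s i t := by
      rw [Finset.mul_sum, ← Finset.sum_add_distrib]
      refine Finset.sum_congr rfl fun i hi => ?_
      rw [if_pos (Finset.mem_range.1 hi)]
      ring
    have h2 := gsPart_eq (v := v) (s := s) m m t
    rw [← gsVec] at h2
    rw [h1, h2]
    ring

/-- Two orthogonalizations, of the columns and then of the rows of the triangular factor, yield the
solution of least norm of a least squares problem. -/
theorem sum_gsVec_gsCoef_eq {r d : ℕ} {x : ℕ → ℝ}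
    (hnormal : ∀ j < d, form r (v j)
      (fun u => v d u - 1 * ∑ t ∈ Finset.range d, x t * v t u) = 0)
    {h : ℕ → ℝ} (hrow : ∀ t < d, x t = form r h (v t)) {t : ℕ} (ht : t < d) :
    ∑ i ∈ Finset.range d, gsVec (gsCoef v r) d i d / form d (gsVec (gsCoef v r) d i) (gsCoef v r i)
      * gsVec (gsCoef v r) d i t = x t := by
  set R := gsCoef v r with hR
  set p := gsVec R d with hp
  -- The triangular system: the residual is orthogonal to all orthogonalized columns, so `x` solves
  -- `R x = ρ` with `ρ i = R i d`.
  have hRx : ∀ i < d, R i d = form d (R i) x := by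
    intro i hi
    have h1 := form_gsPart_eq_zero hnormal hi.le hi
    rw [form_sub_mul, form_sum, one_mul, sub_eq_zero] at h1
    rw [hR, gsCoef, gsVec, h1, Finset.sum_div]
    exact Finset.sum_congr rfl fun _ _ => by rw [gsCoef, gsVec]; ring
  -- Coordinate `d` of the rows carries `ρ`. Row operations preserve the equations, so each
  -- orthogonalized row still pairs with `x` to its own last coordinate.
  have hpx : ∀ i ≤ d, ∀ j < d, gsPart R d i j d = form d (gsPart R d i j) x := by
    intro i
    induction i with
    | zero => exact fun _ j hj => hRx j hj
    | succ i ih =>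
      intro hi j hj
      rw [form_comm, gsPart_succ, form_sub_mul]
      simp only [gsVec]
      rw [ih (by omega) j hj, ih (by omega) i hi, form_comm d x, form_comm d x]
  -- By `hrow`, `x` lies in the row space of the matrix, hence in that of `R`; this is where least
  -- norm enters.
  obtain ⟨w, hw⟩ : ∃ w : ℕ → ℝ, ∀ t < d, x t = ∑ i ∈ Finset.range d, w i * p i t := by
    obtain ⟨w, hw⟩ := exists_sum_gsVec_eq (v := R) (s := d) d fun i => form r h (gsVec v r i)
    refine ⟨w, fun t ht => ?_⟩
    rw [← hw, hrow t ht]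
    have e : form r h (v t) =
        form r h fun u => ∑ i ∈ Finset.range d, gsCoef v r i t * gsVec v r i u :=
      Finset.sum_congr rfl fun u hu => by
        simp only [sum_gsCoef_mul_gsVec ht (Finset.mem_range.1 hu)]
    rw [e, form_sum]
    exact Finset.sum_congr rfl fun _ _ => mul_comm _ _
  -- Orthogonality isolates the coefficient `w i`, which is then read off from the last coordinate.
  have hpd : ∀ i < d, p i d = w i * form d (p i) (p i) := by
    intro i hi
    have h1 := hpx i hi.le i hi
    rw [← gsVec, ← hp] at h1
    have e : form d (p i) x = form d (p i) fun t => ∑ i ∈ Finset.range d, w i * p i t :=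
      Finset.sum_congr rfl fun u hu => by rw [hw u (Finset.mem_range.1 hu)]
    rw [h1, e, form_sum]
    refine Finset.sum_eq_single_of_mem i (Finset.mem_range.2 hi) fun l _ hl => ?_
    rw [form_gsVec_gsVec hl.symm, mul_zero]
  rw [hw t ht]
  refine Finset.sum_congr rfl fun i hi => ?_
  rw [hpd i (Finset.mem_range.1 hi), form_gsVec_of_le le_rfl, ← hp]
  by_cases h0 : form d (p i) (p i) = 0
  · rw [eq_zero_of_form_self h0 ht, mul_zero, mul_zero]
  · rw [mul_div_assoc, div_self h0, mul_one]

/-- `B† = (B† B)ᵀ B† = Bᵀ (B†)ᵀ B†`: the least norm solution lies in the row space. -/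
theorem exists_pinv_mulVec_eq {m n : ℕ} (B : Matrix (Fin m) (Fin n) ℝ) (c : Fin m → ℝ) :
    ∃ h, pinv B *ᵥ c = Bᵀ *ᵥ h := by
  have hB := pinv_spec B
  refine ⟨((pinv B)ᵀ * pinv B) *ᵥ c, ?_⟩
  rw [mulVec_mulVec, ← Matrix.mul_assoc, ← transpose_mul, hB.symm_right, hB.mul_mul_right]

theorem sum_gsVec_gsCoef_eq_pinv {r d : ℕ} (B : Matrix (Fin r) (Fin d) ℝ) (c : Fin r → ℝ)
    (hB : ∀ (j : Fin d) (u : Fin r), v j u = B u j) (hc : ∀ u : Fin r, v d u = c u) (t : Fin d) :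
    ∑ i ∈ Finset.range d, gsVec (gsCoef v r) d i d / form d (gsVec (gsCoef v r) d i) (gsCoef v r i)
      * gsVec (gsCoef v r) d i t = (pinv B *ᵥ c) t := by
  obtain ⟨h, hh⟩ := exists_pinv_mulVec_eq B c
  have hform : ∀ {m : ℕ} (x y : ℕ → ℝ), form m x y = ∑ u : Fin m, x u * y u := fun x y => by
    rw [form, Finset.sum_range]
  set x := pinv B *ᵥ c with hx
  have key := sum_gsVec_gsCoef_eq (v := v) (r := r) (d := d)
    (x := fun t => if ht : t < d then x ⟨t, ht⟩ else 0)
    (h := fun u => if hu : u < r then h ⟨u, hu⟩ else 0) (fun j hj => ?_) (fun t ht => ?_) t.2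
  · rw [key, dif_pos t.2]
  · have h1 := congrFun (transpose_mulVec_pinv B c) ⟨j, hj⟩
    rw [← hx] at h1
    rw [form_sub_mul, one_mul, sub_eq_zero, hform, hform]
    simp only [mulVec, dotProduct, transpose_apply] at h1
    convert h1.symm using 1
    · refine Finset.sum_congr rfl fun u _ => ?_
      rw [hc, hB ⟨j, hj⟩]
    · refine Finset.sum_congr rfl fun u _ => ?_
      rw [hB ⟨j, hj⟩, Finset.sum_range]
      congr 1
      refine Finset.sum_congr rfl fun i _ => ?_
      rw [dif_pos i.2, hB, mul_comm]
  · have h1 := congrFun hh ⟨t, ht⟩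
    simp only [mulVec, dotProduct, transpose_apply] at h1
    rw [dif_pos ht, h1, hform]
    refine Finset.sum_congr rfl fun u _ => ?_
    rw [dif_pos u.2, hB ⟨t, ht⟩, mul_comm]

end GramSchmidt


/-! ### The computation graph of the algorithm -/

section Graph

/-- The real numbers that the algorithm computes once the random choices are made: the input, the
levels of the Walsh-Hadamard transform, two orthogonalizations (of the columns of the sketched
matrix, and of the rows of the matrix of coefficients), and the solution. -/
inductive Addr (k d : ℕ) : Type
  | inp (i : Fin (2 ^ k)) (j : Fin (d + 1))
  | zero
  | walsh (l : ℕ) (i : Fin (2 ^ k)) (j : ℕ)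
  | part (b : Bool) (i j t : ℕ)
  | prod (b : Bool) (i j t : ℕ)
  | form (b : Bool) (i j t : ℕ)
  | coef (b : Bool) (i j : ℕ)
  | comp (b : Bool) (i j t : ℕ)
  | quot (i : ℕ)
  | term (i t : ℕ)
  | sol (i t : ℕ)

namespace Addr

variable {k d r : ℕ}

/-- An injective code for the nodes. -/
def code : Addr k d → ℕ × ℕ × ℕ × ℕ × Bool
  | inp i j => (0, i, j, 0, false)
  | zero => (1, 0, 0, 0, false)
  | walsh l i j => (2, l, i, j, false)
  | part b i j t => (3, i, j, t, b)
  | prod b i j t => (4, i, j, t, b)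
  | form b i j t => (5, i, j, t, b)
  | coef b i j => (6, i, j, 0, b)
  | comp b i j t => (7, i, j, t, b)
  | quot i => (8, i, 0, 0, false)
  | term i t => (9, i, t, 0, false)
  | sol i t => (10, i, t, 0, false)

theorem code_injective : Function.Injective (code (k := k) (d := d)) := by
  intro a b h
  cases a <;> cases b <;> simp_all [code, Fin.val_inj]

/-- The memory cell of a node. -/
def cell : Addr k d → Cell (2 ^ k) d
  | inp i j => .inl (i, j)
  | a => .inr (Encodable.encode (code a))

theorem cell_injective : Function.Injective (cell (k := k) (d := d)) := by
  intro a b h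
  have key : code a = code b := by
    cases a <;> cases b <;> simp only [cell, Sum.inl.injEq, Sum.inr.injEq, reduceCtorEq,
      Prod.mk.injEq, Encodable.encode_inj] at h <;> first | rfl | exact h | simp [h.1, h.2]
  exact code_injective key

/-- The order of evaluation. -/
def stage : Addr k d → ℕ ×ₗ ℕ ×ₗ ℕ ×ₗ ℕ
  | inp _ _ => toLex (0, toLex (0, toLex (0, 0)))
  | zero => toLex (1, toLex (0, toLex (0, 0)))
  | walsh l _ _ => toLex (2, toLex (l, toLex (0, 0)))
  | part b i _ _ => toLex (3 + b.toNat, toLex (i, toLex (0, 0)))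
  | prod b i _ _ => toLex (3 + b.toNat, toLex (i, toLex (1, 0)))
  | form b i _ t => toLex (3 + b.toNat, toLex (i, toLex (2, t)))
  | coef b i _ => toLex (3 + b.toNat, toLex (i, toLex (3, 0)))
  | comp b i _ _ => toLex (3 + b.toNat, toLex (i, toLex (4, 0)))
  | quot _ => toLex (5, toLex (0, toLex (0, 0)))
  | term _ _ => toLex (5, toLex (1, toLex (0, 0)))
  | sol i _ => toLex (5, toLex (2, toLex (i, 0)))

/-- The number of coordinates that the form takes into account. -/
def dim (d r : ℕ) (b : Bool) : ℕ := if b then d else r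

/-- The number of vectors that are orthogonalized. -/
def numVec (d : ℕ) (b : Bool) : ℕ := if b then d else d + 1

/-- The number of coordinates of the vectors that are orthogonalized. -/
def numCoord (d r : ℕ) (b : Bool) : ℕ := if b then d + 1 else r

/-- The sampled indices, as a function on the natural numbers. -/
def extend (g : Fin r → Fin (2 ^ k)) (t : ℕ) : Fin (2 ^ k) :=
  if h : t < r then g ⟨t, h⟩ else 0

/-- The operation at each node. -/
def node (ω : Sample (2 ^ k) r) : Addr k d → Node (Addr k d)
  | inp _ _ => .const 0
  | zero => .const 0
  -- A random sign costs one step per entry, as `0 + x` or `0 - x`.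
  | walsh 0 i j => .op (if ω.1 i then .add else .sub) zero (inp i (Fin.ofNat (d + 1) j))
  | walsh (l + 1) i j =>
      if (i : ℕ).testBit l then .op .sub (walsh l (flipBit l i) j) (walsh l i j)
      else .op .add (walsh l i j) (walsh l (flipBit l i) j)
  | part false 0 j t => .op .add (walsh k (extend ω.2 t) j) zero
  -- The second pass orthogonalizes the rows of the coefficient matrix; `t = d` is the right-hand
  -- side. Adding `zero` copies the value.
  | part true 0 j t => .op .add (coef false j t) zero
  | part b (i + 1) j t => .op .sub (part b i j t) (comp b i j t)
  | prod b i j t => .op .mul (part b i i t) (part b 0 j t)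
  | form _ _ _ 0 => .const 0
  | form b i j (t + 1) => .op .add (form b i j t) (prod b i j t)
  | coef b i j => .op .div (form b i j (dim d r b)) (form b i i (dim d r b))
  | comp b i j t => .op .mul (coef b i j) (part b i i t)
  | quot i => .op .div (part true i i d) (form true i i d)
  | term i t => .op .mul (quot i) (part true i i t)
  | sol 0 _ => .const 0
  | sol (i + 1) t => .op .add (sol i t) (term i t)

/-- The columns of the input, with random signs. -/
def signed (ω : Sample (2 ^ k) r) (M : Fin (2 ^ k) → Fin (d + 1) → ℝ) (j : ℕ) (i : Fin (2 ^ k)) :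
    ℝ := sgn (ω.1 i) * M i (Fin.ofNat (d + 1) j)

/-- The columns of the sketched matrix. -/
def sketched (ω : Sample (2 ^ k) r) (M : Fin (2 ^ k) → Fin (d + 1) → ℝ) (j t : ℕ) : ℝ :=
  RandLS.walsh k k (signed ω M j) (extend ω.2 t)

/-- The vectors that are orthogonalized. -/
def vec (ω : Sample (2 ^ k) r) (M : Fin (2 ^ k) → Fin (d + 1) → ℝ) : Bool → ℕ → ℕ → ℝ
  | false => sketched ω M
  | true => gsCoef (sketched ω M) r

/-- The value of each node. -/
def val (ω : Sample (2 ^ k) r) (M : Fin (2 ^ k) → Fin (d + 1) → ℝ) : Addr k d → ℝ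
  | inp i j => M i j
  | zero => 0
  | walsh l i j => RandLS.walsh k l (signed ω M j) i
  | part b i j t => gsPart (vec ω M b) (dim d r b) i j t
  | prod b i j t => gsVec (vec ω M b) (dim d r b) i t * vec ω M b j t
  | form b i j t => RandLS.form t (gsVec (vec ω M b) (dim d r b) i) (vec ω M b j)
  | coef b i j => gsCoef (vec ω M b) (dim d r b) i j
  | comp b i j t => gsCoef (vec ω M b) (dim d r b) i j * gsVec (vec ω M b) (dim d r b) i t
  | quot i => gsVec (vec ω M true) d i d / RandLS.form d (gsVec (vec ω M true) d i) (vec ω M true i)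
  | term i t => gsVec (vec ω M true) d i d /
      RandLS.form d (gsVec (vec ω M true) d i) (vec ω M true i) * gsVec (vec ω M true) d i t
  | sol i t => ∑ l ∈ Finset.range i, gsVec (vec ω M true) d l d /
      RandLS.form d (gsVec (vec ω M true) d l) (vec ω M true l) * gsVec (vec ω M true) d l t

/-- The nodes that have to be evaluated. -/
def Used (g : Fin r → Fin (2 ^ k)) : Addr k d → Prop
  | inp _ _ => False
  | zero => True
  | walsh l i j => l ≤ k ∧ i ∈ walshRows k g l ∧ j < d + 1
  | part b i j t => i < d + 1 ∧ j < numVec d b ∧ t < numCoord d r b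
  | prod b i j t => i < d ∧ j < numVec d b ∧ t < dim d r b
  | form b i j t => i < d ∧ j < numVec d b ∧ t < dim d r b + 1
  | coef b i j => i < d ∧ j < numVec d b
  | comp b i j t => i < d ∧ j < numVec d b ∧ t < numCoord d r b
  | quot i => i < d
  | term i t => i < d ∧ t < d
  | sol i t => i < d + 1 ∧ t < d

theorem le_numVec (b : Bool) : d ≤ numVec d b := by cases b <;> simp [numVec]

theorem dim_le_numCoord (b : Bool) : dim d r b ≤ numCoord d r b := by
  cases b <;> simp [dim, numCoord]

theorem sources_node (ω : Sample (2 ^ k) r) {a : Addr k d} (ha : Used ω.2 a) :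
    (node ω a).Sources fun s => ((∃ i j, s = inp i j) ∨ Used ω.2 s) ∧ stage s < stage a := by
  have hv := fun b => le_numVec (d := d) b
  have hc := fun b => dim_le_numCoord (d := d) (r := r) b
  rcases a with ⟨i, j⟩ | _ | ⟨l, i, j⟩ | ⟨b, i, j, t⟩ | ⟨b, i, j, t⟩ | ⟨b, i, j, t⟩ | ⟨b, i, j⟩ |
    ⟨b, i, j, t⟩ | i | ⟨i, t⟩ | ⟨i, t⟩
  · exact ha.elim
  · trivial
  · cases l with
    | zero =>
      exact ⟨⟨Or.inr trivial, by simp [stage, Prod.Lex.toLex_lt_toLex]⟩,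
        ⟨Or.inl ⟨_, _, rfl⟩, by simp [stage, Prod.Lex.toLex_lt_toLex]⟩⟩
    | succ l =>
      obtain ⟨hl, hi, hj⟩ := ha
      have hst : stage (walsh l i j : Addr k d) < stage (walsh (l + 1) i j : Addr k d) := by
        simp [stage, Prod.Lex.toLex_lt_toLex]
      have h1 : Used ω.2 (walsh l i j : Addr k d) := ⟨by omega, mem_walshRows_of_succ hi, hj⟩
      have h2 : Used ω.2 (walsh l (flipBit l i) j : Addr k d) :=
        ⟨by omega, flipBit_mem_walshRows hi, hj⟩
      simp only [node]
      split_ifs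
      · exact ⟨⟨Or.inr h2, hst⟩, Or.inr h1, hst⟩
      · exact ⟨⟨Or.inr h1, hst⟩, Or.inr h2, hst⟩
  · obtain ⟨hi, hj, ht⟩ := ha
    cases i with
    | zero =>
      cases b with
      | false =>
        simp only [numCoord, numVec, if_false, Bool.false_eq_true] at hj ht
        refine ⟨⟨Or.inr ⟨le_rfl, ?_, hj⟩, by simp [stage, Prod.Lex.toLex_lt_toLex]⟩,
          Or.inr trivial, by simp [stage, Prod.Lex.toLex_lt_toLex]⟩
        rw [extend, dif_pos ht]
        exact self_mem_walshRows _ _ _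
      | true =>
        simp only [numCoord, numVec, if_true] at hj ht
        exact ⟨⟨Or.inr ⟨hj, by simpa [numVec] using ht⟩,
          by simp [stage, Prod.Lex.toLex_lt_toLex]⟩,
          Or.inr trivial, by simp [stage, Prod.Lex.toLex_lt_toLex]⟩
    | succ i =>
      have : node ω (part b (i + 1) j t : Addr k d) =
          .op .sub (part b i j t) (comp b i j t) := by cases b <;> rfl
      rw [this]
      exact ⟨⟨Or.inr ⟨by omega, hj, ht⟩, by simp [stage, Prod.Lex.toLex_lt_toLex]⟩,
        Or.inr ⟨by omega, hj, ht⟩, by simp [stage, Prod.Lex.toLex_lt_toLex]⟩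
  · obtain ⟨hi, hj, ht⟩ := ha
    refine ⟨⟨Or.inr ⟨by omega, hi.trans_le (hv b), ht.trans_le (hc b)⟩,
      by simp [stage, Prod.Lex.toLex_lt_toLex]⟩,
      Or.inr ⟨by omega, hj, ht.trans_le (hc b)⟩, ?_⟩
    -- The unmodified vector sits at index `0`. For `i = 0` the index ties, and the next component
    -- of `stage` decides.
    rcases Nat.eq_zero_or_pos i with h | h <;> simp [stage, Prod.Lex.toLex_lt_toLex, h]
  · obtain ⟨hi, hj, ht⟩ := ha
    cases t with
    | zero => trivial
    | succ t =>
      exact ⟨⟨Or.inr ⟨hi, hj, by omega⟩, by simp [stage, Prod.Lex.toLex_lt_toLex]⟩,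
        Or.inr ⟨hi, hj, by omega⟩, by simp [stage, Prod.Lex.toLex_lt_toLex]⟩
  · obtain ⟨hi, hj⟩ := ha
    exact ⟨⟨Or.inr ⟨hi, hj, by omega⟩, by simp [stage, Prod.Lex.toLex_lt_toLex]⟩,
      Or.inr ⟨hi, hi.trans_le (hv b), by omega⟩, by simp [stage, Prod.Lex.toLex_lt_toLex]⟩
  · obtain ⟨hi, hj, ht⟩ := ha
    exact ⟨⟨Or.inr ⟨hi, hj⟩, by simp [stage, Prod.Lex.toLex_lt_toLex]⟩,
      Or.inr ⟨by omega, hi.trans_le (hv b), ht⟩, by simp [stage, Prod.Lex.toLex_lt_toLex]⟩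
  · exact ⟨⟨Or.inr ⟨Nat.lt_succ_of_lt ha, ha, by simp [numCoord]⟩,
      by simp [stage, Prod.Lex.toLex_lt_toLex]⟩,
      Or.inr ⟨ha, ha, by simp [dim]⟩, by simp [stage, Prod.Lex.toLex_lt_toLex]⟩
  · obtain ⟨hi, ht⟩ := ha
    exact ⟨⟨Or.inr hi, by simp [stage, Prod.Lex.toLex_lt_toLex]⟩,
      Or.inr ⟨by omega, hi, by simp [numCoord]; omega⟩, by simp [stage, Prod.Lex.toLex_lt_toLex]⟩
  · obtain ⟨hi, ht⟩ := ha
    cases i with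
    | zero => trivial
    | succ i =>
      exact ⟨⟨Or.inr ⟨by omega, ht⟩, by simp [stage, Prod.Lex.toLex_lt_toLex]⟩,
        Or.inr ⟨by omega, ht⟩, by simp [stage, Prod.Lex.toLex_lt_toLex]⟩

theorem val_eq_eval (ω : Sample (2 ^ k) r) (M : Fin (2 ^ k) → Fin (d + 1) → ℝ) {a : Addr k d}
    (ha : Used ω.2 a) : val ω M a = (node ω a).eval (val ω M) := by
  rcases a with ⟨i, j⟩ | _ | ⟨l, i, j⟩ | ⟨b, i, j, t⟩ | ⟨b, i, j, t⟩ | ⟨b, i, j, t⟩ | ⟨b, i, j⟩ |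
    ⟨b, i, j, t⟩ | i | ⟨i, t⟩ | ⟨i, t⟩
  · exact ha.elim
  · rfl
  · cases l with
    | zero =>
      simp only [val, node, Node.eval, walsh_zero, signed, sgn]
      split_ifs <;> simp [ArithOp.total]
    | succ l =>
      have hl : l < k := ha.1
      simp only [val, node, walsh_succ hl, ← flipBit_val hl]
      split_ifs <;> rfl
  · cases i with
    | zero => cases b <;> simp [val, node, Node.eval, ArithOp.total, gsPart, vec, sketched, dim]
    | succ i => cases b <;> rfl
  · rfl
  · cases t with
    | zero => simp [val, node, Node.eval, RandLS.form]
    | succ t =>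
      simp only [val, node, Node.eval, ArithOp.total, RandLS.form, Finset.sum_range_succ]
  · rfl
  · rfl
  · rfl
  · rfl
  · cases i with
    | zero => simp [val, node, Node.eval]
    | succ i => simp only [val, node, Node.eval, ArithOp.total, Finset.sum_range_succ]

open Classical in
/-- The nodes of one of the two orthogonalizations. -/
def orthNodes (k d r : ℕ) (b : Bool) : Finset (Addr k d) :=
  (Finset.range (d + 1) ×ˢ Finset.range (numVec d b) ×ˢ Finset.range (numCoord d r b)).image
      (fun p => part b p.1 p.2.1 p.2.2) ∪
  (Finset.range d ×ˢ Finset.range (numVec d b) ×ˢ Finset.range (dim d r b)).image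
      (fun p => prod b p.1 p.2.1 p.2.2) ∪
  (Finset.range d ×ˢ Finset.range (numVec d b) ×ˢ Finset.range (dim d r b + 1)).image
      (fun p => form b p.1 p.2.1 p.2.2) ∪
  (Finset.range d ×ˢ Finset.range (numVec d b)).image (fun p => coef b p.1 p.2) ∪
  (Finset.range d ×ˢ Finset.range (numVec d b) ×ˢ Finset.range (numCoord d r b)).image
      (fun p => comp b p.1 p.2.1 p.2.2)

open Classical in
/-- The nodes of the last part of the algorithm. -/
def solNodes (k d : ℕ) : Finset (Addr k d) :=
  (Finset.range d).image quot ∪ (Finset.range d ×ˢ Finset.range d).image (fun p => term p.1 p.2) ∪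
  (Finset.range (d + 1) ×ˢ Finset.range d).image (fun p => sol p.1 p.2)

open Classical in
/-- The nodes of the Walsh-Hadamard transform. -/
def walshNodes (d : ℕ) (g : Fin r → Fin (2 ^ k)) : Finset (Addr k d) :=
  (Finset.range (k + 1)).biUnion fun l =>
    (walshRows k g l ×ˢ Finset.range (d + 1)).image fun p => walsh l p.1 p.2

open Classical in
/-- All the nodes that have to be evaluated. -/
def nodes (d : ℕ) (g : Fin r → Fin (2 ^ k)) : Finset (Addr k d) :=
  insert zero (walshNodes d g ∪ (orthNodes k d r false ∪ orthNodes k d r true ∪ solNodes k d))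

theorem mem_nodes {g : Fin r → Fin (2 ^ k)} {a : Addr k d} : a ∈ nodes d g ↔ Used g a := by
  rcases a with ⟨i, j⟩ | _ | ⟨l, i, j⟩ | ⟨b, i, j, t⟩ | ⟨b, i, j, t⟩ | ⟨b, i, j, t⟩ | ⟨b, i, j⟩ |
    ⟨b, i, j, t⟩ | i | ⟨i, t⟩ | ⟨i, t⟩
  case walsh => simp [nodes, Used, walshNodes, orthNodes, solNodes]
  all_goals try cases b
  all_goals simp [nodes, Used, walshNodes, orthNodes, solNodes]

theorem sum_cost_union_le (ω : Sample (2 ^ k) r) [DecidableEq (Addr k d)]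
    (S T : Finset (Addr k d)) :
    ∑ a ∈ S ∪ T, (node ω a).cost ≤ ∑ a ∈ S, (node ω a).cost + ∑ a ∈ T, (node ω a).cost := by
  rw [← Finset.sum_union_inter]
  exact Nat.le_add_right _ _

theorem sum_cost_le_four_mul (ω : Sample (2 ^ k) r) (S : Finset (Addr k d)) :
    ∑ a ∈ S, (node ω a).cost ≤ S.card * 4 :=
  Finset.sum_le_card_nsmul _ _ _ fun a _ => (node ω a).cost_le

theorem cost_walsh (ω : Sample (2 ^ k) r) (l : ℕ) (i : Fin (2 ^ k)) (j : ℕ) :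
    (node ω (walsh l i j : Addr k d)).cost = 1 := by
  cases l <;> simp only [node] <;> split_ifs <;> rfl

theorem sum_cost_walshNodes_le (ω : Sample (2 ^ k) r) :
    ∑ a ∈ walshNodes d ω.2, (node ω a).cost ≤
      2 ^ k * (d + 1) + (∑ l ∈ Finset.range k, (walshRows k ω.2 (l + 1)).card) * (d + 1) := by
  classical
  have h1 : ∀ a ∈ walshNodes d ω.2, (node ω a).cost ≤ 1 := by
    intro a ha
    simp only [walshNodes, Finset.mem_biUnion, Finset.mem_image] at ha
    obtain ⟨l, -, p, -, rfl⟩ := ha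
    exact (cost_walsh ω l p.1 p.2).le
  refine (Finset.sum_le_card_nsmul _ _ _ h1).trans ?_
  rw [smul_eq_mul, mul_one]
  have h2 : (walshNodes d ω.2).card ≤
      ∑ l ∈ Finset.range (k + 1), (walshRows k ω.2 l).card * (d + 1) := by
    refine Finset.card_biUnion_le.trans (Finset.sum_le_sum fun l _ => ?_)
    refine Finset.card_image_le.trans ?_
    rw [Finset.card_product, Finset.card_range]
  refine h2.trans ?_
  rw [Finset.sum_range_succ', ← Finset.sum_mul, add_comm]
  gcongr
  exact (Finset.card_le_univ _).trans (by simp)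

theorem card_orthNodes_le (b : Bool) :
    (orthNodes k d r b).card ≤ (d + 1) * (numVec d b * numCoord d r b) +
      d * (numVec d b * dim d r b) + d * (numVec d b * (dim d r b + 1)) + d * numVec d b +
      d * (numVec d b * numCoord d r b) := by
  classical
  simp only [orthNodes]
  refine (Finset.card_union_le _ _).trans (add_le_add ((Finset.card_union_le _ _).trans
    (add_le_add ((Finset.card_union_le _ _).trans (add_le_add ((Finset.card_union_le _ _).trans
      (add_le_add ?_ ?_)) ?_)) ?_)) ?_)
  all_goals
    refine Finset.card_image_le.trans (le_of_eq ?_)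
    simp

theorem card_solNodes_le : (solNodes k d).card ≤ d + d * d + (d + 1) * d := by
  classical
  simp only [solNodes]
  refine (Finset.card_union_le _ _).trans (add_le_add ((Finset.card_union_le _ _).trans
    (add_le_add ?_ ?_)) ?_)
  all_goals
    refine Finset.card_image_le.trans (le_of_eq ?_)
    simp

theorem card_orthNodes_add_card_solNodes_le (hd : 1 ≤ d) (hdr : d ≤ r) :
    (orthNodes k d r false).card + (orthNodes k d r true).card + (solNodes k d).card ≤
      28 * (r * d ^ 2) := by
  have h1 := card_orthNodes_le (k := k) (d := d) (r := r) false
  have h2 := card_orthNodes_le (k := k) (d := d) (r := r) true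
  have h3 := card_solNodes_le (k := k) (d := d)
  simp only [numVec, numCoord, dim, if_true, if_false, Bool.false_eq_true] at h1 h2
  -- With `r = d + c` and `d = 1 + e` this compares polynomials in nonnegative variables. The
  -- constant `28` is attained by the counts at `d = r = 1`.
  obtain ⟨c, rfl⟩ := Nat.exists_eq_add_of_le hdr
  obtain ⟨e, rfl⟩ := Nat.exists_eq_add_of_le hd
  nlinarith [Nat.zero_le (c * e), Nat.zero_le (c * e * e), Nat.zero_le (e * e * e),
    Nat.zero_le (e * e)]

theorem sum_cost_nodes_le (ω : Sample (2 ^ k) r) (hd : 1 ≤ d) (hdr : d ≤ r) :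
    ∑ a ∈ nodes d ω.2, (node ω a).cost ≤ 1 + (2 ^ k * (d + 1) +
      (∑ l ∈ Finset.range k, (walshRows k ω.2 (l + 1)).card) * (d + 1) +
        112 * (r * d ^ 2)) := by
  classical
  have hz : (node ω (zero : Addr k d)).cost = 1 := rfl
  have h1 := sum_cost_walshNodes_le (d := d) ω
  have h2 := sum_cost_le_four_mul ω (orthNodes k d r false ∪ orthNodes k d r true ∪ solNodes k d)
  have h3 := (Finset.card_union_le (orthNodes k d r false ∪ orthNodes k d r true)
    (solNodes k d)).trans (add_le_add_left (Finset.card_union_le _ _) _)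
  have h4 := card_orthNodes_add_card_solNodes_le (k := k) hd hdr
  have h5 := sum_cost_union_le ω (walshNodes d ω.2)
    (orthNodes k d r false ∪ orthNodes k d r true ∪ solNodes k d)
  have h6 : ∑ a ∈ nodes d ω.2, (node ω a).cost ≤ 1 + ∑ a ∈ walshNodes d ω.2 ∪
      (orthNodes k d r false ∪ orthNodes k d r true ∪ solNodes k d), (node ω a).cost := by
    rw [nodes, Finset.insert_eq]
    refine le_trans (Finset.sum_le_sum_of_subset (by
      intro a ha; convert ha)) ((sum_cost_union_le ω {zero} _).trans ?_)
    rw [Finset.sum_singleton, hz]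
  omega

end Addr

end Graph


/-! ### The algorithm -/

section Algorithm

/-- Scale invariance of least squares. It lets the program omit the factors `√(n / r)` and `n ^
(-1/2)`, which would need square roots. -/
theorem pinv_smul_mulVec_smul {m n : ℕ} (B : Matrix (Fin m) (Fin n) ℝ) (c : Fin m → ℝ) {α : ℝ}
    (hα : α ≠ 0) : pinv (α • B) *ᵥ (α • c) = pinv B *ᵥ c := by
  have hB := pinv_spec B
  have h : IsMoorePenrose (α • B) (α⁻¹ • pinv B) := by
    constructor <;> simp [smul_smul, hα, hB.mul_mul_left, hB.mul_mul_right, hB.symm_left,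
      hB.symm_right]
  rw [(pinv_spec (α • B)).unique h, mulVec_smul, smul_mulVec, smul_smul, mul_inv_cancel₀ hα,
    one_smul]

variable {k d r : ℕ}

theorem ofNat_val_eq_castSucc (j : Fin d) : Fin.ofNat (d + 1) (j : ℕ) = j.castSucc := by
  ext
  simp

theorem ofNat_self_eq_last : Fin.ofNat (d + 1) d = Fin.last d := by
  ext
  simp

theorem val_sol_eq_sketchedSolution (hr : 0 < r) (A : Matrix (Fin (2 ^ k)) (Fin d) ℝ)
    (b : Fin (2 ^ k) → ℝ) (ω : Sample (2 ^ k) r) (t : Fin d) :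
    Addr.val ω (fun i j => Program.input A b (.inl (i, j))) (Addr.sol d t) =
      sketchedSolution A b ω t := by
  set M : Fin (2 ^ k) → Fin (d + 1) → ℝ := fun i j => Program.input A b (.inl (i, j)) with hM
  set α : ℝ := Real.sqrt ((2 ^ k : ℕ) / r) * (1 / Real.sqrt (2 ^ k : ℕ)) with hα
  have hα0 : α ≠ 0 := by
    have : (0 : ℝ) < r := by exact_mod_cast hr
    positivity
  let B : Matrix (Fin r) (Fin d) ℝ := Matrix.of fun u j => Addr.sketched ω M j u
  let c : Fin r → ℝ := fun u => Addr.sketched ω M d u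
  have hext : ∀ u : Fin r, Addr.extend ω.2 (u : ℕ) = ω.2 u := fun u => by
    rw [Addr.extend, dif_pos u.2]
  have hsk : ∀ (j : ℕ) (u : Fin r), Addr.sketched ω M j u =
      ∑ i, hadamardPM k (ω.2 u) i * (sgn (ω.1 i) * M i (Fin.ofNat (d + 1) j)) := fun j u => by
    rw [Addr.sketched, hext, walsh_self]
    rfl
  have hB : sketch ω * A = α • B := by
    ext u j
    rw [sketch_mul_apply, Matrix.smul_apply, show B u j = _ from hsk j u, mul_apply, hα, smul_eq_mul,
      mul_assoc]
    simp only [Finset.mul_sum]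
    refine Finset.sum_congr rfl fun i _ => ?_
    rw [mul_diagonal, hadamard, Matrix.smul_apply, smul_eq_mul, ofNat_val_eq_castSucc]
    simp only [hM, Program.input, Fin.snoc_castSucc]
    ring
  have hc : sketch ω *ᵥ b = α • c := by
    ext u
    rw [sketch_mulVec_apply, Pi.smul_apply, show c u = _ from hsk d u, mulVec, dotProduct, hα, smul_eq_mul,
      mul_assoc]
    simp only [Finset.mul_sum]
    refine Finset.sum_congr rfl fun i _ => ?_
    rw [mul_diagonal, hadamard, Matrix.smul_apply, smul_eq_mul, ofNat_self_eq_last]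
    simp only [hM, Program.input, Fin.snoc_last]
    ring
  rw [sketchedSolution, hB, hc, pinv_smul_mulVec_smul _ _ hα0]
  exact sum_gsVec_gsCoef_eq_pinv (v := Addr.sketched ω M) B c (fun _ _ => rfl) (fun _ => rfl) t

/-- Add `clog - 1 ≤ log₂ (r + 1)` and `3 = log₂ 8 ≤ log₂ (r + 1)`. -/
theorem clog_add_two_le (hr : 7 ≤ r) :
    (Nat.clog 2 r + 2 : ℝ) ≤ 2 * Real.logb 2 ((r : ℝ) + 1) := by
  have hr' : (7 : ℝ) ≤ r := by exact_mod_cast hr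
  have h1 : 2 ^ (Nat.clog 2 r - 1) < r := Nat.pow_pred_clog_lt_self (by norm_num) (by omega)
  have hc : 0 < Nat.clog 2 r := Nat.clog_pos (by norm_num) (by omega)
  have h2 : ((Nat.clog 2 r - 1 : ℕ) : ℝ) ≤ Real.logb 2 ((r : ℝ) + 1) := by
    rw [Real.le_logb_iff_rpow_le (by norm_num) (by positivity), Real.rpow_natCast]
    have : ((2 ^ (Nat.clog 2 r - 1) : ℕ) : ℝ) < r := by exact_mod_cast h1
    push_cast at this
    linarith
  have h3 : (3 : ℝ) ≤ Real.logb 2 ((r : ℝ) + 1) := by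
    rw [Real.le_logb_iff_rpow_le (by norm_num) (by positivity)]
    norm_num
    linarith
  rw [Nat.cast_sub hc, Nat.cast_one] at h2
  linarith

theorem exists_program (k : ℕ) (hd : 1 ≤ d) (hr : 7 ≤ r) (hdr : d ≤ r) :
    ∃ T : Program (2 ^ k) d,
      (T.steps : ℝ) ≤ (2 ^ k : ℝ) * (d + 1) +
        2 * (2 ^ k : ℝ) * (d + 1) * Real.logb 2 ((r : ℝ) + 1) + 200 * ((r : ℝ) * (d : ℝ) ^ 2) ∧
      ∀ (A : Matrix (Fin (2 ^ k)) (Fin d) ℝ) (b : Fin (2 ^ k) → ℝ),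
        T.run (Program.input A b) =
          (sampleLaw (2 ^ k) r).map fun ω => some (sketchedSolution A b ω) := by
  set m := Nat.clog 2 r with hm
  have hrm : r ≤ 2 ^ m := Nat.le_pow_clog (by norm_num) r
  have hS : ∀ ω : Sample (2 ^ k) r,
      ∑ l ∈ Finset.range k, (walshRows k ω.2 (l + 1)).card ≤ 2 ^ k * (m + 1) := fun ω => by
    exact_mod_cast sum_card_walshRows_le ω.2 hrm
  obtain ⟨T, hT, hrun⟩ := Program.exists_program_of_forall_sample
    (n := 2 ^ k) (d := d) (r := r) (inputs := Set.univ)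
    -- The terms are the zero cell, the signs, the butterflies and the two orthogonalizations with
    -- the solution, where `112 = 4 * 28`.
    (c := 1 + (2 ^ k * (d + 1) + 2 ^ k * (m + 1) * (d + 1) + 112 * (r * d ^ 2)))
    (f := fun mem ω t => Addr.val ω (fun i j => mem (.inl (i, j))) (Addr.sol d t)) (fun ω => by
      obtain ⟨F, hF, hrun⟩ := Program.exists_straightLine Addr.cell_injective (Addr.node ω)
        Addr.stage {s | ∃ i j, s = Addr.inp i j} (Addr.nodes d ω.2) fun a ha =>
          (Addr.sources_node ω (Addr.mem_nodes.1 ha)).mono fun s hs =>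
            ⟨hs.1.imp_right Addr.mem_nodes.2, hs.2⟩
      refine ⟨F (.halt fun t => Addr.cell (Addr.sol d t)), ?_, fun mem _ => ?_⟩
      · refine (hF _).trans ?_
        have h1 := Addr.sum_cost_nodes_le ω hd hdr
        have h2 := Nat.mul_le_mul_right (d + 1) (hS ω)
        simp only [Program.steps]
        omega
      · obtain ⟨mem', hmem', hrun'⟩ := hrun (Addr.val ω fun i j => mem (.inl (i, j)))
          (fun a ha => Addr.val_eq_eval ω _ (Addr.mem_nodes.1 ha)) mem (by
            rintro a ⟨i, j, rfl⟩
            rfl)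
        rw [hrun', Program.run]
        congr 2
        funext t
        exact hmem' _ (Or.inr (Addr.mem_nodes.2 ⟨Nat.lt_succ_self d, t.2⟩)))
  refine ⟨T, ?_, fun A b => ?_⟩
  · have h1 : (T.steps : ℝ) ≤ 2 ^ k + (r + (1 + (2 ^ k * (d + 1) +
        2 ^ k * (m + 1) * (d + 1) + 112 * (r * d ^ 2)))) := by exact_mod_cast hT
    have h2 := clog_add_two_le hr
    rw [← hm] at h2
    have hd' : (1 : ℝ) ≤ d := by exact_mod_cast hd
    have hr' : (7 : ℝ) ≤ r := by exact_mod_cast hr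
    have h3 : (r : ℝ) ≤ r * (d : ℝ) ^ 2 := le_mul_of_one_le_right (by linarith) (one_le_pow₀ hd')
    have hn : (0 : ℝ) < 2 ^ k := by positivity
    -- The `2 ^ k` coin tosses count as one more level per column: `m + 1` levels become `m + 2`,
    -- which `clog_add_two_le` absorbs. The `r` draws and the zero cell go into `200 r d²`.
    have h4 : (2 ^ k : ℝ) ≤ 2 ^ k * (d + 1) := le_mul_of_one_le_right hn.le (by linarith)
    have h5 : (2 ^ k : ℝ) * (d + 1) * (m + 2) ≤
        2 ^ k * (d + 1) * (2 * Real.logb 2 ((r : ℝ) + 1)) := by gcongr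
    linarith
  · rw [hrun _ (Set.mem_univ _)]
    congr 1
    funext ω
    congr 1
    funext t
    exact val_sol_eq_sketchedSolution (by omega) A b ω t

end Algorithm

end RandLS

end

theorem mainTheorem2 :
    ∃ C : ℝ, 0 < C ∧
      ∀ (k d : ℕ), 1 ≤ d → ∀ ε : ℝ, 0 < ε → ε < 1 →
        (∀ (A : Matrix (Fin (2 ^ k)) (Fin d) ℝ) (b : Fin (2 ^ k) → ℝ), A.rank = d →
          0.8 ≤ (RandLS.sampleLaw (2 ^ k) (RandLS.sampleSize (2 ^ k) d ε)).toMeasure.real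
            {ω | RandLS.norm2 (A *ᵥ RandLS.sketchedSolution A b ω - b)
                    ≤ (1 + ε) * RandLS.lsValue A b ∧
                ∀ (U : Matrix (Fin (2 ^ k)) (Fin d) ℝ) (V : Matrix (Fin d) (Fin d) ℝ) (γ : ℝ),
                  RandLS.IsThinSVD A U V → 0 < γ → γ ≤ 1 →
                  γ * RandLS.norm2 b ≤ RandLS.norm2 ((U * Uᵀ) *ᵥ b) →
                  RandLS.norm2 (RandLS.lsSolution A b - RandLS.sketchedSolution A b ω)
                    ≤ Real.sqrt ε * (RandLS.condNum A * Real.sqrt (γ⁻¹ ^ 2 - 1))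
                        * RandLS.norm2 (RandLS.lsSolution A b)}) ∧
        ∃ T : RandLS.Program (2 ^ k) d,
          (T.steps : ℝ) ≤ (2 ^ k : ℝ) * (d + 1)
              + 2 * (2 ^ k : ℝ) * (d + 1)
                  * Real.logb 2 ((RandLS.sampleSize (2 ^ k) d ε : ℝ) + 1)
              + C * ((RandLS.sampleSize (2 ^ k) d ε : ℝ) * (d : ℝ) ^ 2) ∧
          ∀ (A : Matrix (Fin (2 ^ k)) (Fin d) ℝ) (b : Fin (2 ^ k) → ℝ), A.rank = d →
            T.run (RandLS.Program.input A b)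
              = (RandLS.sampleLaw (2 ^ k) (RandLS.sampleSize (2 ^ k) d ε)).map
                  (fun ω => some (RandLS.sketchedSolution A b ω)) := by
  refine ⟨200, by norm_num, fun k d hd ε hε hε1 => ⟨fun A b hA => ?_, ?_⟩⟩
  · refine RandLS.le_success_probability k hd hε b hA fun ω hω => ?_
    exact ⟨RandLS.norm2_mulVec_sub_le hε hω, fun U V γ hUV hγ hγ1 hb =>
      RandLS.norm2_lsSolution_sub_le hUV hA hd hε hω hγ hγ1 hb⟩
  · obtain ⟨hL, hr, -, hl⟩ := RandLS.sampleSize_bounds (n := 2 ^ k) (ε := ε) Nat.one_le_two_pow hd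
    have hd' : (1 : ℝ) ≤ d := by exact_mod_cast hd
    -- The bounds `3` and `9` on the two logarithms make `r` large enough for both `7 ≤ r` and `d ≤
    -- r`.
    have hr' : (48 ^ 2 * d * 3 * 9 : ℝ) ≤ RandLS.sampleSize (2 ^ k) d ε := by
      refine le_trans ?_ hr
      gcongr
    obtain ⟨T, hT, hrun⟩ := RandLS.exists_program k (r := RandLS.sampleSize (2 ^ k) d ε) hd
      (by
        have : (7 : ℝ) ≤ RandLS.sampleSize (2 ^ k) d ε := by linarith
        exact_mod_cast this)
      (by
        have : (d : ℝ) ≤ RandLS.sampleSize (2 ^ k) d ε := by linarith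
        exact_mod_cast this)
    exact ⟨T, hT, fun A b _ => hrun A b⟩
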